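/- Let $(\mathbf V,\otimes,1)$ be a symmetric monoidal category with all small coproducts, such that $\otimes$ preserves coproducts in each variable, and with finite limits. For a set $S$ write $S\otimes 1=\coprod_S 1$; the functor $S\mapsto S\otimes 1$ is left adjoint to $\mathrm{Mor}_{\mathbf V}(1,-)$. Let $\mathbf V\text{-}\mathbf{Cat}$ be the 2-category of small $\mathbf V$-categories, $\mathbf V$-functors and $\mathbf V$-natural transformations. Let $I$ be a small category, and let $I\otimes 1$ be the free $\mathbf V$-category on $I$, with the same objects and $(I\otimes 1)(i,j)=\mathrm{Mor}_I(i,j)\otimes 1$; the diagonal of $I$ and the projection to a point make it a coalgebra category. **Graded categories.** An $I$-graded $\mathbf V$-category $(E,\mu)$ is a small $\mathbf V$-category $E$ with a (strictly coassociative and counital) right comodule structure $\mu:E\to E\otimes(I\otimes 1)$, a $\mathbf V$-functor. On objects $\mu(e)=(e,p(e))$. A degree-preserving left morphism $(E,\mu)\to(E',\mu')$ is a $\mathbf V$-functor $F:E\to E'$ with a $\mathbf V$-natural transformation $\varphi:\mu'\circ F\Rightarrow(F\otimes 1)\circ\mu$ and morphisms $\varphi_2(e):p'(F(e))\to p(e)$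 of $I$ such that $\varphi(e)=1_{F(e)}\otimes\varphi_2(e)$ for all $e$; the morphisms $\varphi_2(e)$ are part of the data. A 2-morphism $(F,\varphi,\varphi_2)\Rightarrow(G,\psi,\psi_2)$ is a $\mathbf V$-natural transformation $\xi:F\Rightarrow G$ with $\psi\circ\mu'\xi=(\xi\otimes 1)\mu\circ\varphi$. With the evident compositions (1-morphisms are composed by pasting, so that $(\psi\varphi)_2(e)=\varphi_2(e)\circ\psi_2(F(e))$ for $(F,\varphi)$ followed by $(G,\psi)$) these form a 2-category $\overleftarrow{\mathbf V\text{-}\mathbf{Cat}}_I$. **Oplax functors.** Let $\overleftarrow{\mathbf{Oplax}}(I,\mathbf V\text{-}\mathbf{Cat})$ be the 2-category whose objects are the oplax functors $X:I\to\mathbf V\text{-}\mathbf{Cat}$, with structure 2-morphisms $\theta:X(v\circ u)\Rightarrow X(v)\circ X(u)$ and $\eta:X(1_i)\Rightarrow 1_{X(i)}$; whose 1-morphisms are the left transformations $(F,\varphi):X\to Y$, i.e. $\mathbf V$-functors $F(i):X(i)\to Y(i)$ with $\mathbf V$-natural transformations $\varphi(u):Y(u)\circ F(i)\Rightarrow F(j)\circ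 X(u)$ for $u:i\to j$, compatible with $\theta$ and $\eta$; and whose 2-morphisms are the modifications. **The 2-functor $\mathrm{Gr}$.** For an oplax functor $X$, the $\mathbf V$-category $\mathrm{Gr}(X)$ has as objects the pairs $(x,i)$ with $i\in I$ and $x\in X(i)$, and $$\mathrm{Gr}(X)((x,i),(y,j))=\coprod_{u:i\to j}X(j)(X(u)(x),y),$$ with composition given by the functors $X(u)$, the compositions of the categories $X(j)$ and $\theta$, and with identities given by $\eta$. Its grading $\mu_X$ has $p(x,i)=i$ and on the summand of $u$ it is $f\mapsto f\otimes u$. A left transformation $(F,\varphi)$ is sent to the functor $(x,i)\mapsto(F(i)(x),i)$ which on the summand of $u:i\to j$ is $F(j)$ followed by precomposition with $\varphi(u)(x)$, with $\varphi_2=1$; a modification $\Theta$ is sent to the transformation with components $\Theta(i)(x)$ of degree $1_i$. This is a (strict) 2-functor $\mathrm{Gr}:\overleftarrow{\mathbf{Oplax}}(I,\mathbf V\text{-}\mathbf{Cat})\to\overleftarrow{\mathbf V\text{-}\mathbf{Cat}}_I$. **The 2-functor $\overleftarrow\Gamma$.** For a graded $\mathbf V$-category $(E,\mu)$ and $i\in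 I$, the $\mathbf V$-category $\mu\downarrow i$ has as objects the pairs $(e,u)$ with $e\in E$ and $u:p(e)\to i$ in $I$, and $(\mu\downarrow i)((e,u),(e',u'))$ is the pullback of $$E(e,e')\xrightarrow{\ \mu\ }E(e,e')\otimes(I\otimes 1)(p(e),p(e'))\xrightarrow{\ 1\otimes u'_*\ }E(e,e')\otimes(I\otimes 1)(p(e),i)\xleftarrow{\ 1\otimes u\ }E(e,e')\otimes 1,$$ with composition and identities induced by those of $E$. The smash product $\overleftarrow\Gamma(\mu)$ is the functor $i\mapsto\mu\downarrow i$, where $v:i\to j$ acts by $(e,u)\mapsto(e,v\circ u)$ and by the identity of $E(e,e')$; it is regarded as an oplax functor. A left morphism $(F,\varphi,\varphi_2)$ acts by $(e,u)\mapsto(F(e),u\circ\varphi_2(e))$ and by $F$ on morphisms, and a 2-morphism $\xi$ by its components $\xi(e)$. This is a (strict) 2-functor $\overleftarrow\Gamma:\overleftarrow{\mathbf V\text{-}\mathbf{Cat}}_I\to\overleftarrow{\mathbf{Oplax}}(I,\mathbf V\text{-}\mathbf{Cat})$. **Theorem.** For all oplax functors $X:I\to\mathbf V\text{-}\mathbf{Cat}$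 and all $I$-graded $\mathbf V$-categories $(E,\mu)$ there are isomorphisms of categories $$\overleftarrow{\mathbf V\text{-}\mathbf{Cat}}_I\big((\mathrm{Gr}(X),\mu_X),(E,\mu)\big)\;\cong\;\overleftarrow{\mathbf{Oplax}}(I,\mathbf V\text{-}\mathbf{Cat})\big(X,\overleftarrow\Gamma(\mu)\big),$$ which are strictly 2-natural in $X$ and in $(E,\mu)$. That is, the 2-functor $\mathrm{Gr}$ is left 2-adjoint to $\overleftarrow\Gamma$. -/

import Mathlib

open CategoryTheory MonoidalCategory Limits

universe v w u

noncomputable section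

namespace EnrichedGr

/-! ### Calculus in enriched categories -/

section Calculus

variable {V : Type u} [Category.{v} V] [MonoidalCategory V] {C : Type w} [EnrichedCategory V C]

/-- The morphism `a^* : C(y,z) ⟶ C(x,z)` given by composition with `a : 1 ⟶ C(x,y)`. -/
def ePre {x y : C} (a : 𝟙_ V ⟶ (x ⟶[V] y)) (z : C) : (y ⟶[V] z) ⟶ (x ⟶[V] z) :=
  (λ_ _).inv ≫ a ▷ _ ≫ eComp V x y z

/-- The morphism `a_* : C(w,x) ⟶ C(w,y)` given by composition with `a : 1 ⟶ C(x,y)`. -/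
def ePost (w : C) {x y : C} (a : 𝟙_ V ⟶ (x ⟶[V] y)) : (w ⟶[V] x) ⟶ (w ⟶[V] y) :=
  (ρ_ _).inv ≫ _ ◁ a ≫ eComp V w x y

/-- Composition in the underlying category (in diagrammatic order). -/
def eMul {x y z : C} (a : 𝟙_ V ⟶ (x ⟶[V] y)) (b : 𝟙_ V ⟶ (y ⟶[V] z)) :
    𝟙_ V ⟶ (x ⟶[V] z) :=
  (λ_ _).inv ≫ (a ⊗ₘ b) ≫ eComp V x y z

lemma comp_ePost {x y z : C} (a : 𝟙_ V ⟶ (x ⟶[V] y)) (b : 𝟙_ V ⟶ (y ⟶[V] z)) :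
    a ≫ ePost x b = eMul a b := by
  simp only [ePost, eMul, MonoidalCategory.tensorHom_def, ← Category.assoc]
  congr 2
  rw [rightUnitor_inv_naturality, unitors_inv_equal]

lemma comp_ePre {x y z : C} (a : 𝟙_ V ⟶ (x ⟶[V] y)) (b : 𝟙_ V ⟶ (y ⟶[V] z)) :
    b ≫ ePre a z = eMul a b := by
  simp only [ePre, eMul, MonoidalCategory.tensorHom_def', ← Category.assoc]
  congr 2
  rw [leftUnitor_inv_naturality]

@[simp] lemma ePre_id (x z : C) : ePre (eId V x) z = 𝟙 _ := by simp [ePre]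

@[simp] lemma ePost_id (x z : C) : ePost x (eId V z) = 𝟙 _ := by simp [ePost]

lemma eComp_ePost {x y z t : C} (a : 𝟙_ V ⟶ (z ⟶[V] t)) :
    eComp V x y z ≫ ePost x a = _ ◁ ePost y a ≫ eComp V x y t := by
  simp only [ePost, whiskerLeft_comp, Category.assoc]
  rw [← e_assoc, rightUnitor_inv_naturality_assoc, ← whisker_exchange_assoc]
  simp

lemma eComp_ePre {x y z t : C} (a : 𝟙_ V ⟶ (x ⟶[V] y)) :
    eComp V y z t ≫ ePre a t = ePre a z ▷ _ ≫ eComp V x z t := by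
  simp only [ePre, comp_whiskerRight, Category.assoc]
  rw [← e_assoc', leftUnitor_inv_naturality_assoc, whisker_exchange_assoc]
  simp

lemma ePost_eComp {x y z t : C} (a : 𝟙_ V ⟶ (y ⟶[V] z)) :
    ePost x a ▷ _ ≫ eComp V x z t = _ ◁ ePre a t ≫ eComp V x y t := by
  simp only [ePre, ePost, comp_whiskerRight, whiskerLeft_comp, Category.assoc]
  rw [← e_assoc']
  simp

lemma ePre_ePost {x y z t : C} (a : 𝟙_ V ⟶ (x ⟶[V] y)) (b : 𝟙_ V ⟶ (z ⟶[V] t)) :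
    ePre a z ≫ ePost x b = ePost y b ≫ ePre a t := by
  rw [ePost, ePre, rightUnitor_inv_naturality_assoc, ← whisker_exchange_assoc, ePost]
  simp only [Category.assoc]
  rw [eComp_ePre, ePre]

@[simp] lemma ePre_eMul {x y z t : C} (a : 𝟙_ V ⟶ (x ⟶[V] y)) (b : 𝟙_ V ⟶ (y ⟶[V] z)) :
    ePre (eMul a b) t = ePre b t ≫ ePre a t := by
  conv_rhs => rw [ePre]
  simp only [Category.assoc]
  rw [eComp_ePre, ← comp_whiskerRight_assoc, comp_ePre, ← ePre]

@[simp] lemma ePost_eMul {x y z t : C} (a : 𝟙_ V ⟶ (x ⟶[V] y)) (b : 𝟙_ V ⟶ (y ⟶[V] z)) :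
    ePost t (eMul a b) = ePost t a ≫ ePost t b := by
  conv_rhs => rw [ePost]
  simp only [Category.assoc]
  rw [eComp_ePost, ← whiskerLeft_comp_assoc, comp_ePost, ← ePost]

@[simp] lemma eMul_id {x y : C} (a : 𝟙_ V ⟶ (x ⟶[V] y)) : eMul a (eId V y) = a := by
  rw [← comp_ePost]; simp

@[simp] lemma id_eMul {x y : C} (a : 𝟙_ V ⟶ (x ⟶[V] y)) : eMul (eId V x) a = a := by
  rw [← comp_ePre]; simp

lemma eMul_assoc {x y z t : C} (a : 𝟙_ V ⟶ (x ⟶[V] y)) (b : 𝟙_ V ⟶ (y ⟶[V] z))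
    (c : 𝟙_ V ⟶ (z ⟶[V] t)) : eMul (eMul a b) c = eMul a (eMul b c) := by
  rw [← comp_ePost, ← comp_ePre (V := V) a b, Category.assoc, ePre_ePost, ← Category.assoc,
    comp_ePost, comp_ePre]

variable {D : Type w} [EnrichedCategory V D] (F : EnrichedFunctor V C D)

lemma map_ePre {x y : C} (a : 𝟙_ V ⟶ (x ⟶[V] y)) (z : C) :
    ePre a z ≫ F.map x z = F.map y z ≫ ePre (a ≫ F.map x y) (F.obj z) := by
  simp only [ePre, Category.assoc, F.map_comp, MonoidalCategory.tensorHom_def',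
    comp_whiskerRight, leftUnitor_inv_naturality_assoc, whisker_exchange_assoc]

lemma map_ePost (t : C) {x y : C} (a : 𝟙_ V ⟶ (x ⟶[V] y)) :
    ePost t a ≫ F.map t y = F.map t x ≫ ePost (F.obj t) (a ≫ F.map x y) := by
  simp only [ePost, Category.assoc, F.map_comp, MonoidalCategory.tensorHom_def,
    MonoidalCategory.whiskerLeft_comp, rightUnitor_inv_naturality_assoc, ← whisker_exchange_assoc]

lemma map_eMul {x y z : C} (a : 𝟙_ V ⟶ (x ⟶[V] y)) (b : 𝟙_ V ⟶ (y ⟶[V] z)) :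
    eMul a b ≫ F.map x z = eMul (a ≫ F.map x y) (b ≫ F.map y z) := by
  simp [eMul]

end Calculus

/-! ### The 2-category of small `V`-categories -/

section VCat

variable {V : Type u} [Category.{v} V] [MonoidalCategory V]
  {C D E : Type w} [EnrichedCategory V C] [EnrichedCategory V D] [EnrichedCategory V E]

/-- The identity `V`-functor. -/
abbrev vid (C : Type w) [EnrichedCategory V C] : EnrichedFunctor V C C where
  obj x := x
  map x y := 𝟙 (x ⟶[V] y)

/-- The composition of `V`-functors (in diagrammatic order). -/
abbrev vcomp (F : EnrichedFunctor V C D) (G : EnrichedFunctor V D E) : EnrichedFunctor V C E where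
  obj x := G.obj (F.obj x)
  map x y := F.map x y ≫ G.map (F.obj x) (F.obj y)

/-- A `V`-natural transformation `F ⟹ G`. -/
@[ext]
structure VNatTrans (F G : EnrichedFunctor V C D) where
  app (x : C) : 𝟙_ V ⟶ (F.obj x ⟶[V] G.obj x)
  naturality (x y : C) :
    F.map x y ≫ ePost (F.obj x) (app y) = G.map x y ≫ ePre (app x) (G.obj y)

namespace VNatTrans

/-- The identity. -/
@[simps]
def id (F : EnrichedFunctor V C D) : VNatTrans F F where
  app x := eId V (F.obj x)
  naturality x y := by simp

/-- Vertical composition. -/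
@[simps]
def comp {F G H : EnrichedFunctor V C D} (α : VNatTrans F G) (β : VNatTrans G H) :
    VNatTrans F H where
  app x := eMul (α.app x) (β.app x)
  naturality x y := by
    rw [ePost_eMul, ePre_eMul, ← Category.assoc, α.naturality, Category.assoc, ePre_ePost,
      ← Category.assoc, β.naturality, Category.assoc]

/-- Whiskering with a `V`-functor applied first. -/
@[simps]
def whiskerL (F : EnrichedFunctor V C D) {G H : EnrichedFunctor V D E} (α : VNatTrans G H) :
    VNatTrans (vcomp F G) (vcomp F H) where
  app x := α.app (F.obj x)
  naturality x y := by
    simp [α.naturality]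

/-- Whiskering with a `V`-functor applied last. -/
@[simps]
def whiskerR {F G : EnrichedFunctor V C D} (α : VNatTrans F G) (H : EnrichedFunctor V D E) :
    VNatTrans (vcomp F H) (vcomp G H) where
  app x := α.app x ≫ H.map _ _
  naturality x y := by
    have key : (F.map x y ≫ H.map (F.obj x) (F.obj y)) ≫
          ePost (H.obj (F.obj x)) (α.app y ≫ H.map (F.obj y) (G.obj y)) =
        (G.map x y ≫ H.map (G.obj x) (G.obj y)) ≫
          ePre (α.app x ≫ H.map (F.obj x) (G.obj x)) (H.obj (G.obj y)) := by
      rw [Category.assoc, Category.assoc, ← map_ePost, ← map_ePre, ← Category.assoc, α.naturality,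
        Category.assoc]
    exact key

end VNatTrans

instance functorCategory : Category (EnrichedFunctor V C D) where
  Hom F G := VNatTrans F G
  id F := VNatTrans.id F
  comp α β := VNatTrans.comp α β
  id_comp α := VNatTrans.ext (by funext x; simp)
  comp_id α := VNatTrans.ext (by funext x; simp)
  assoc α β γ := VNatTrans.ext (by funext x; simp [eMul_assoc])

@[simp] lemma functorCategory_id_app (F : EnrichedFunctor V C D) (x : C) :
    VNatTrans.app (𝟙 F) x = eId V (F.obj x) := rfl

@[simp] lemma functorCategory_comp_app {F G H : EnrichedFunctor V C D} (α : F ⟶ G) (β : G ⟶ H)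
    (x : C) : VNatTrans.app (α ≫ β) x = eMul (α.app x) (β.app x) := rfl

lemma hom_ext {F G : EnrichedFunctor V C D} {α β : F ⟶ G}
    (h : ∀ x, VNatTrans.app α x = VNatTrans.app β x) : α = β :=
  VNatTrans.ext (funext h)

end VCat

/-- A small `V`-category. -/
structure VCat (V : Type u) [Category.{v} V] [MonoidalCategory V] where
  /-- the objects -/
  carrier : Type v
  [str : EnrichedCategory V carrier]

namespace VCat

variable {V : Type u} [Category.{v} V] [MonoidalCategory V]

instance : CoeSort (VCat V) (Type v) := ⟨VCat.carrier⟩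

instance (C : VCat V) : EnrichedCategory V C := C.str

variable {C D E E' : Type v} [EnrichedCategory V C] [EnrichedCategory V D] [EnrichedCategory V E]
  [EnrichedCategory V E']

/-- The associativity of the composition of `V`-functors, with identity components. -/
@[simps]
def associator (F : EnrichedFunctor V C D) (G : EnrichedFunctor V D E)
    (H : EnrichedFunctor V E E') : vcomp (vcomp F G) H ≅ vcomp F (vcomp G H) where
  hom := { app := fun x => eId V (H.obj (G.obj (F.obj x)))
           naturality := fun x y => by simp }
  inv := { app := fun x => eId V (H.obj (G.obj (F.obj x)))
           naturality := fun x y => by simp }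
  hom_inv_id := hom_ext fun x => by simp
  inv_hom_id := hom_ext fun x => by simp

/-- The left unit law of the composition of `V`-functors, with identity components. -/
@[simps]
def leftUnitor (F : EnrichedFunctor V C D) : vcomp (vid C) F ≅ F where
  hom := { app := fun x => eId V (F.obj x)
           naturality := fun x y => by simp }
  inv := { app := fun x => eId V (F.obj x)
           naturality := fun x y => by simp }
  hom_inv_id := hom_ext fun x => by simp
  inv_hom_id := hom_ext fun x => by simp

/-- The right unit law of the composition of `V`-functors, with identity components. -/
@[simps]
def rightUnitor (F : EnrichedFunctor V C D) : vcomp F (vid D) ≅ F where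
  hom := { app := fun x => eId V (F.obj x)
           naturality := fun x y => by simp }
  inv := { app := fun x => eId V (F.obj x)
           naturality := fun x y => by simp }
  hom_inv_id := hom_ext fun x => by simp
  inv_hom_id := hom_ext fun x => by simp

/-- The 2-category of small `V`-categories, `V`-functors and `V`-natural transformations. -/
instance bicategory : Bicategory (VCat V) where
  Hom C D := EnrichedFunctor V C D
  id C := vid C
  comp F G := vcomp F G
  homCategory C D := functorCategory
  whiskerLeft F _ _ α := VNatTrans.whiskerL F α
  whiskerRight α H := VNatTrans.whiskerR α H
  associator := associator
  leftUnitor := leftUnitor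
  rightUnitor := rightUnitor
  whiskerLeft_id F G := hom_ext fun x => by simp
  whiskerLeft_comp F _ _ _ α β := hom_ext fun x => by simp
  id_whiskerLeft α := hom_ext fun x => by simp
  comp_whiskerLeft F G _ _ α := hom_ext fun x => by simp
  id_whiskerRight F G := hom_ext fun x => by simp
  comp_whiskerRight α β G := hom_ext fun x => by simp [map_eMul]
  whiskerRight_id α := hom_ext fun x => by simp
  whiskerRight_comp α G H := hom_ext fun x => by simp
  whisker_assoc F _ _ α H := hom_ext fun x => by simp
  whisker_exchange {_ _ _ F G H I} α β := hom_ext fun x => by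
    have key := β.naturality (F.obj x) (G.obj x)
    have := congrArg (fun t => VNatTrans.app α x ≫ t) key
    simp only [← Category.assoc, comp_ePost, comp_ePre] at this
    exact this.symm
  pentagon F G H I := hom_ext fun x => by simp
  triangle F G := hom_ext fun x => by simp

end VCat

/-! ### Coproducts and tensor products -/

/-- `V` has coproducts (indexed by small sets), and the tensor product preserves them in both
variables. -/
class CoproductMonoidal (V : Type u) [Category.{v} V] [MonoidalCategory V] : Prop where
  hasCoproducts (S : Type v) : HasColimitsOfShape (Discrete S) V
  preservesLeft (S : Type v) (A : V) : PreservesColimitsOfShape (Discrete S) (tensorLeft A)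
  preservesRight (S : Type v) (A : V) : PreservesColimitsOfShape (Discrete S) (tensorRight A)

attribute [instance] CoproductMonoidal.hasCoproducts CoproductMonoidal.preservesLeft
  CoproductMonoidal.preservesRight

section Coproducts

variable {V : Type u} [Category.{v} V] [MonoidalCategory V] [CoproductMonoidal V]

/-- The tensor product with an object on the left preserves coproducts. -/
def tensorLeftIsColimit (A : V) {S : Type v} (X : S → V) :
    IsColimit (Cofan.mk (A ⊗ ∐ X) (fun s => A ◁ Sigma.ι X s)) :=
  isColimitCofanMkObjOfIsColimit (tensorLeft A) _ _ (coproductIsCoproduct X)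

/-- The tensor product with an object on the right preserves coproducts. -/
def tensorRightIsColimit (A : V) {S : Type v} (X : S → V) :
    IsColimit (Cofan.mk ((∐ X) ⊗ A) (fun s => Sigma.ι X s ▷ A)) :=
  isColimitCofanMkObjOfIsColimit (tensorRight A) _ _ (coproductIsCoproduct X)

lemma left_ext {A B : V} {S : Type v} {X : S → V} {f g : A ⊗ (∐ X) ⟶ B}
    (h : ∀ s, A ◁ Sigma.ι X s ≫ f = A ◁ Sigma.ι X s ≫ g) : f = g :=
  (tensorLeftIsColimit A X).hom_ext fun s => h s.as

lemma right_ext {A B : V} {S : Type v} {X : S → V} {f g : (∐ X) ⊗ A ⟶ B}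
    (h : ∀ s, Sigma.ι X s ▷ A ≫ f = Sigma.ι X s ▷ A ≫ g) : f = g :=
  (tensorRightIsColimit A X).hom_ext fun s => h s.as

/-- A morphism out of the tensor product of two coproducts. -/
def tdesc {B : V} {S T : Type v} {X : S → V} {Y : T → V} (f : ∀ s t, X s ⊗ Y t ⟶ B) :
    (∐ X) ⊗ (∐ Y) ⟶ B :=
  (tensorRightIsColimit (∐ Y) X).desc
    (Cofan.mk B fun s => (tensorLeftIsColimit (X s) Y).desc (Cofan.mk B (f s)))

@[simp] lemma ι_tdesc {B : V} {S T : Type v} {X : S → V} {Y : T → V}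
    (f : ∀ s t, X s ⊗ Y t ⟶ B) (s : S) (t : T) :
    (Sigma.ι X s ⊗ₘ Sigma.ι Y t) ≫ tdesc f = f s t := by
  have h1 : Sigma.ι X s ▷ (∐ Y) ≫ tdesc f =
      (tensorLeftIsColimit (X s) Y).desc (Cofan.mk B (f s)) :=
    (tensorRightIsColimit (∐ Y) X).fac _ ⟨s⟩
  rw [MonoidalCategory.tensorHom_def', Category.assoc, h1]
  exact (tensorLeftIsColimit (X s) Y).fac _ ⟨t⟩

lemma tensor_ext {B : V} {S T : Type v} {X : S → V} {Y : T → V} {f g : (∐ X) ⊗ (∐ Y) ⟶ B}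
    (h : ∀ s t, (Sigma.ι X s ⊗ₘ Sigma.ι Y t) ≫ f = (Sigma.ι X s ⊗ₘ Sigma.ι Y t) ≫ g) : f = g := by
  refine right_ext fun s => left_ext fun t => ?_
  simpa [MonoidalCategory.tensorHom_def'] using h s t

lemma mid_ext {A A' B : V} {S : Type v} {X : S → V} {f g : A ⊗ ((∐ X) ⊗ A') ⟶ B}
    (h : ∀ s, A ◁ (Sigma.ι X s ▷ A') ≫ f = A ◁ (Sigma.ι X s ▷ A') ≫ g) : f = g :=
  (isColimitCofanMkObjOfIsColimit (tensorRight A' ⋙ tensorLeft A) _ _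
    (coproductIsCoproduct X)).hom_ext fun s => h s.as

lemma mid_ext' {A A' B : V} {S : Type v} {X : S → V} {f g : A ⊗ (A' ⊗ (∐ X)) ⟶ B}
    (h : ∀ s, A ◁ (A' ◁ Sigma.ι X s) ≫ f = A ◁ (A' ◁ Sigma.ι X s) ≫ g) : f = g :=
  (isColimitCofanMkObjOfIsColimit (tensorLeft A' ⋙ tensorLeft A) _ _
    (coproductIsCoproduct X)).hom_ext fun s => h s.as

lemma tensor_ext₃ {B : V} {S T R : Type v} {X : S → V} {Y : T → V} {Z : R → V}
    {f g : (∐ X) ⊗ ((∐ Y) ⊗ (∐ Z)) ⟶ B}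
    (h : ∀ s t r, (Sigma.ι X s ⊗ₘ (Sigma.ι Y t ⊗ₘ Sigma.ι Z r)) ≫ f =
      (Sigma.ι X s ⊗ₘ (Sigma.ι Y t ⊗ₘ Sigma.ι Z r)) ≫ g) : f = g := by
  refine right_ext fun s => mid_ext fun t => mid_ext' fun r => ?_
  simpa [MonoidalCategory.tensorHom_def'] using h s t r

end Coproducts

/-! ### The free `V`-category on a category -/

section Free

variable (V : Type u) [Category.{v} V] [MonoidalCategory V] [CoproductMonoidal V]

/-- The object `S ⊗ 1` of `V` for a set `S`, i.e. the coproduct of copies of the unit object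
indexed by `S`. -/
abbrev freeObj (S : Type v) : V := ∐ fun _ : S => 𝟙_ V

variable {V} in
/-- The morphism `1 ⟶ S ⊗ 1` given by an element of `S`. -/
abbrev elem {S : Type v} (s : S) : 𝟙_ V ⟶ freeObj V S := Sigma.ι (fun _ : S => 𝟙_ V) s

/-- The functor `S ↦ S ⊗ 1` is left adjoint to the underlying set functor `V(1,-)`. -/
def freeAdjunction : sigmaConst.obj (𝟙_ V) ⊣ coyoneda.obj (Opposite.op (𝟙_ V)) :=
  sigmaConstAdj (𝟙_ V)

variable {V}

/-- The morphism `(S ⊗ 1) ⊗ (T ⊗ 1) ⟶ R ⊗ 1` given by a map `S × T → R`. -/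
def freeMul {S T R : Type v} (m : S → T → R) : freeObj V S ⊗ freeObj V T ⟶ freeObj V R :=
  tdesc fun s t => (λ_ (𝟙_ V)).hom ≫ elem (m s t)

lemma elem_freeMul {S T R : Type v} (m : S → T → R) (s : S) (t : T) :
    (elem s ⊗ₘ elem t) ≫ freeMul m = (λ_ (𝟙_ V)).hom ≫ elem (m s t) := ι_tdesc _ _ _

variable (V)

/-- The objects of the `V`-category `I ⊗ 1`, which are those of `I`. -/
structure FreeCat (I : Type v) where
  /-- the underlying object -/
  as : I

variable {I : Type v} [SmallCategory I]

/-- The free `V`-category `I ⊗ 1` on a small category `I`. -/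
instance freeCategory : EnrichedCategory V (FreeCat I) where
  Hom i j := freeObj V (i.as ⟶ j.as)
  id i := elem (𝟙 i.as)
  comp i j k := freeMul fun u u' => u ≫ u'
  id_comp i j := by
    refine Sigma.hom_ext _ _ fun u => ?_
    rw [leftUnitor_inv_naturality_assoc, ← tensorHom_def'_assoc]
    erw [elem_freeMul]
    simp
  comp_id i j := by
    refine Sigma.hom_ext _ _ fun u => ?_
    rw [rightUnitor_inv_naturality_assoc, ← tensorHom_def_assoc]
    erw [elem_freeMul]
    simp [← unitors_inv_equal]
  assoc i j k l := by
    refine tensor_ext₃ fun u u' u'' => ?_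
    rw [associator_inv_naturality_assoc]
    have h1 : ((elem u ⊗ₘ elem u') ⊗ₘ elem u'') ≫ (freeMul fun u u' => u ≫ u') ▷ _ =
        ((λ_ (𝟙_ V)).hom ≫ elem (u ≫ u')) ⊗ₘ elem u'' := by
      rw [← elem_freeMul (V := V) (fun u u' => u ≫ u')]
      simp [MonoidalCategory.tensorHom_def']
    have h2 : (elem u ⊗ₘ (elem u' ⊗ₘ elem u'')) ≫ _ ◁ (freeMul fun u u' => u ≫ u') =
        elem u ⊗ₘ ((λ_ (𝟙_ V)).hom ≫ elem (u' ≫ u'')) := by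
      rw [← elem_freeMul (V := V) (fun u u' => u ≫ u')]
      simp [MonoidalCategory.tensorHom_def]
    rw [reassoc_of% h1, reassoc_of% h2]
    have h3 : (((λ_ (𝟙_ V)).hom ≫ elem (u ≫ u')) ⊗ₘ elem u'') =
      (λ_ (𝟙_ V)).hom ▷ _ ≫ (elem (u ≫ u') ⊗ₘ elem u'') := by
      simp [MonoidalCategory.tensorHom_def]
    have h4 : (elem u ⊗ₘ ((λ_ (𝟙_ V)).hom ≫ elem (u' ≫ u''))) =
      _ ◁ (λ_ (𝟙_ V)).hom ≫ (elem u ⊗ₘ elem (u' ≫ u'')) := by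
      simp [MonoidalCategory.tensorHom_def']
    rw [h3, h4, Category.assoc, Category.assoc, elem_freeMul, elem_freeMul, Category.assoc]
    simp [unitors_equal]
end Free
section Free

variable {V : Type u} [Category.{v} V] [MonoidalCategory V] [CoproductMonoidal V]
  {I : Type v} [SmallCategory I]

/-- A morphism `u` of `I` as a morphism of (the underlying category of) `I ⊗ 1`. -/
def fel {i j : FreeCat I} (u : i.as ⟶ j.as) : 𝟙_ V ⟶ (i ⟶[V] j) :=
  elem u

lemma free_hom_ext {i j : FreeCat I} {A : V} {f g : (i ⟶[V] j) ⟶ A}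
    (h : ∀ u : i.as ⟶ j.as, fel u ≫ f = fel u ≫ g) : f = g :=
  Sigma.hom_ext _ _ h

@[simp] lemma fel_id (i : FreeCat I) : fel (𝟙 i.as) = eId V i := rfl

lemma fel_comp_eComp {i j k : FreeCat I} (u : i.as ⟶ j.as) (u' : j.as ⟶ k.as) :
    (fel u ⊗ₘ fel u') ≫ eComp V i j k = (λ_ (𝟙_ V)).hom ≫ fel (u ≫ u') :=
  elem_freeMul _ _ _

@[simp] lemma eMul_fel {i j k : FreeCat I} (u : i.as ⟶ j.as) (u' : j.as ⟶ k.as) :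
    eMul (V := V) (fel u) (fel u') = fel (u ≫ u') := by
  rw [eMul, fel_comp_eComp]; simp

variable (V)

/-- The comultiplication of the coalgebra category `I ⊗ 1` on morphism objects; it is the
identity-on-objects morphism induced by the diagonal of `I`. -/
def freeDiag (i j : FreeCat I) : (i ⟶[V] j) ⟶ (i ⟶[V] j) ⊗ (i ⟶[V] j) :=
  Sigma.desc fun u : i.as ⟶ j.as => (λ_ (𝟙_ V)).inv ≫ (fel u ⊗ₘ fel u)

/-- The counit of the coalgebra category `I ⊗ 1` on morphism objects. -/
def freeCounit (i j : FreeCat I) : (i ⟶[V] j) ⟶ 𝟙_ V :=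
  Sigma.desc fun _ : i.as ⟶ j.as => 𝟙 (𝟙_ V)

variable {V}

@[simp] lemma fel_freeDiag {i j : FreeCat I} (u : i.as ⟶ j.as) :
    fel u ≫ freeDiag V i j = (λ_ (𝟙_ V)).inv ≫ (fel u ⊗ₘ fel u) :=
  Sigma.ι_desc _ _

@[simp] lemma fel_freeCounit {i j : FreeCat I} (u : i.as ⟶ j.as) :
    fel u ≫ freeCounit V i j = 𝟙 _ :=
  Sigma.ι_desc _ _

end Free

/-! ### Tensor products of `V`-categories -/

section Tensor

variable {V : Type u} [Category.{v} V] [MonoidalCategory V]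
  {B C D E : Type v} [EnrichedCategory V B] [EnrichedCategory V C] [EnrichedCategory V D]
  [EnrichedCategory V E]

/-- The morphism `a ⊗ b : 1 ≅ 1 ⊗ 1 ⟶ X ⊗ Y`. -/
def etens {X Y : V} (a : 𝟙_ V ⟶ X) (b : 𝟙_ V ⟶ Y) : 𝟙_ V ⟶ X ⊗ Y :=
  (λ_ (𝟙_ V)).inv ≫ (a ⊗ₘ b)

lemma etens_comp {X Y X' Y' : V} (a : 𝟙_ V ⟶ X) (b : 𝟙_ V ⟶ Y) (f : X ⟶ X') (g : Y ⟶ Y') :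
    etens a b ≫ (f ⊗ₘ g) = etens (a ≫ f) (b ≫ g) := by
  simp [etens]

lemma etens_whiskerRight {X Y X' : V} (a : 𝟙_ V ⟶ X) (b : 𝟙_ V ⟶ Y) (f : X ⟶ X') :
    etens a b ≫ f ▷ Y = etens (a ≫ f) b := by
  rw [← tensorHom_id, etens_comp, Category.comp_id]

lemma etens_whiskerLeft {X Y Y' : V} (a : 𝟙_ V ⟶ X) (b : 𝟙_ V ⟶ Y) (g : Y ⟶ Y') :
    etens a b ≫ X ◁ g = etens a (b ≫ g) := by
  rw [← id_tensorHom, etens_comp, Category.comp_id]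

variable [SymmetricCategory V]

lemma leftUnitor_inv_tensorμ (X Y : V) :
    (λ_ (X ⊗ Y)).inv ≫ (λ_ (𝟙_ V)).inv ▷ (X ⊗ Y) ≫ tensorμ (𝟙_ V) (𝟙_ V) X Y =
      ((λ_ X).inv ⊗ₘ (λ_ Y).inv) := by
  rw [Iso.inv_comp_eq, tensor_left_unitality]
  simp [tensorHom_comp_tensorHom]

lemma rightUnitor_inv_tensorμ (X Y : V) :
    (ρ_ (X ⊗ Y)).inv ≫ (X ⊗ Y) ◁ (λ_ (𝟙_ V)).inv ≫ tensorμ X Y (𝟙_ V) (𝟙_ V) =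
      ((ρ_ X).inv ⊗ₘ (ρ_ Y).inv) := by
  rw [Iso.inv_comp_eq, tensor_right_unitality]
  simp [tensorHom_comp_tensorHom]

lemma tensor_pre {x y z : C} {s t r : B} (a : 𝟙_ V ⟶ (x ⟶[V] y)) (b : 𝟙_ V ⟶ (s ⟶[V] t)) :
    (λ_ _).inv ≫ etens a b ▷ _ ≫ tensorμ _ _ _ _ ≫ (eComp V x y z ⊗ₘ eComp V s t r) =
      (ePre a z ⊗ₘ ePre b r) := by
  rw [etens, comp_whiskerRight_assoc, tensorμ_natural_left_assoc]
  have := leftUnitor_inv_tensorμ (V := V) (y ⟶[V] z) (t ⟶[V] r)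
  rw [reassoc_of% this]
  simp [tensorHom_comp_tensorHom, ePre]

lemma tensor_post {x y z : C} {s t r : B} (a : 𝟙_ V ⟶ (y ⟶[V] z)) (b : 𝟙_ V ⟶ (t ⟶[V] r)) :
    (ρ_ _).inv ≫ _ ◁ etens a b ≫ tensorμ _ _ _ _ ≫ (eComp V x y z ⊗ₘ eComp V s t r) =
      (ePost x a ⊗ₘ ePost s b) := by
  rw [etens, MonoidalCategory.whiskerLeft_comp_assoc, tensorμ_natural_right_assoc]
  have := rightUnitor_inv_tensorμ (V := V) (x ⟶[V] y) (s ⟶[V] t)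
  rw [reassoc_of% this]
  simp [tensorHom_comp_tensorHom, ePost]

/-- The tensor product of `V`-categories. -/
instance tensorCategory : EnrichedCategory V (C × B) where
  Hom x y := (x.1 ⟶[V] y.1) ⊗ (x.2 ⟶[V] y.2)
  id x := etens (eId V x.1) (eId V x.2)
  comp x y z := tensorμ _ _ _ _ ≫ (eComp V x.1 y.1 z.1 ⊗ₘ eComp V x.2 y.2 z.2)
  id_comp x y := by
    rw [tensor_pre]; simp
  comp_id x y := by
    rw [tensor_post]; simp
  assoc x y z t := by
    have h := tensor_associativity (x.1 ⟶[V] y.1) (x.2 ⟶[V] y.2) (y.1 ⟶[V] z.1) (y.2 ⟶[V] z.2)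
      (z.1 ⟶[V] t.1) (z.2 ⟶[V] t.2)
    rw [comp_whiskerRight, Category.assoc, tensorμ_natural_left_assoc,
      MonoidalCategory.whiskerLeft_comp, Category.assoc, tensorμ_natural_right_assoc,
      Iso.inv_comp_eq, ← reassoc_of% h]
    simp only [tensorHom_comp_tensorHom, e_assoc']

lemma tensor_eId (x : C × B) : eId V x = etens (eId V x.1) (eId V x.2) := rfl

lemma tensor_eComp (x y z : C × B) : eComp V x y z =
    tensorμ _ _ _ _ ≫ (eComp V x.1 y.1 z.1 ⊗ₘ eComp V x.2 y.2 z.2) := rfl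

lemma ePost_etens {w : C × B} {x y : C} {s t : B} (a : 𝟙_ V ⟶ (x ⟶[V] y))
    (b : 𝟙_ V ⟶ (s ⟶[V] t)) :
    ePost (x := (x, s)) (y := (y, t)) w (etens a b) = ePost w.1 a ⊗ₘ ePost w.2 b := by
  exact tensor_post a b

lemma ePre_etens {w : C × B} {x y : C} {s t : B} (a : 𝟙_ V ⟶ (x ⟶[V] y))
    (b : 𝟙_ V ⟶ (s ⟶[V] t)) :
    ePre (x := (x, s)) (y := (y, t)) (etens a b) w = ePre a w.1 ⊗ₘ ePre b w.2 := by
  exact tensor_pre a b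

/-- The `V`-functor `F ⊗ 1`. -/
abbrev tens (B : Type v) [EnrichedCategory V B] (F : EnrichedFunctor V C D) :
    EnrichedFunctor V (C × B) (D × B) where
  obj x := (F.obj x.1, x.2)
  map x y := F.map x.1 y.1 ▷ (x.2 ⟶[V] y.2)
  map_id x := by
    have key : etens (eId V x.1) (eId V x.2) ≫ F.map x.1 x.1 ▷ (x.2 ⟶[V] x.2) =
        etens (eId V (F.obj x.1)) (eId V x.2) := by
      rw [etens_whiskerRight, F.map_id]
    exact key
  map_comp x y z := by
    rw [tensor_eComp, tensor_eComp, Category.assoc, ← tensorHom_id, ← tensorHom_id,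
      tensorHom_comp_tensorHom, Category.comp_id, F.map_comp, ← tensorHom_id,
      tensorμ_natural_assoc, tensorHom_comp_tensorHom]
    simp

/-- The `V`-natural transformation `ξ ⊗ 1`. -/
def tensTrans (B : Type v) [EnrichedCategory V B] {F G : EnrichedFunctor V C D}
    (ξ : VNatTrans F G) : VNatTrans (tens B F) (tens B G) where
  app x := etens (ξ.app x.1) (eId V x.2)
  naturality x y := by
    have key : F.map x.1 y.1 ▷ (x.2 ⟶[V] y.2) ≫
          (ePost (F.obj x.1) (ξ.app y.1) ⊗ₘ ePost x.2 (eId V y.2)) =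
        G.map x.1 y.1 ▷ (x.2 ⟶[V] y.2) ≫
          (ePre (ξ.app x.1) (G.obj y.1) ⊗ₘ ePre (eId V x.2) y.2) := by
      rw [← tensorHom_id, ← tensorHom_id, tensorHom_comp_tensorHom,
        tensorHom_comp_tensorHom, ξ.naturality, ePost_id, ePre_id]
    rw [ePost_etens, ePre_etens]
    exact key

end Tensor
/-! ### Graded `V`-categories -/

section Graded

variable {V : Type u} [Category.{v} V] [MonoidalCategory V] [SymmetricCategory V]
  [CoproductMonoidal V] (I : Type v) [SmallCategory I]

/-- An `I`-grading on a `V`-category `E`, i.e. a right comodule structure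
`μ : E ⟶ E ⊗ (I ⊗ 1)` over the coalgebra category `I ⊗ 1`. By the counit condition, such a
`V`-functor is of the form `e ↦ (e, p e)` on objects. -/
structure Grading (E : Type v) [EnrichedCategory V E] where
  /-- the degree of objects -/
  p : E → FreeCat I
  /-- the coaction on morphisms -/
  coact (x y : E) : (x ⟶[V] y) ⟶ (x ⟶[V] y) ⊗ (p x ⟶[V] p y)
  /-- compatibility with the identities -/
  id_coact (x : E) : eId V x ≫ coact x x = etens (eId V x) (eId V (p x))
  /-- compatibility with the composition -/
  comp_coact (x y z : E) : eComp V x y z ≫ coact x z =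
    (coact x y ⊗ₘ coact y z) ≫ tensorμ _ _ _ _ ≫ (eComp V x y z ⊗ₘ eComp V (p x) (p y) (p z))
  /-- the counit condition -/
  counit (x y : E) : coact x y ≫ _ ◁ freeCounit V (p x) (p y) ≫ (ρ_ _).hom = 𝟙 _
  /-- coassociativity -/
  coassoc (x y : E) : coact x y ≫ coact x y ▷ _ ≫ (α_ _ _ _).hom =
    coact x y ≫ _ ◁ freeDiag V (p x) (p y)

variable {I} in
/-- The `V`-functor `μ : E ⟶ E ⊗ (I ⊗ 1)` of a grading. -/
abbrev Grading.mu {E : Type v} [EnrichedCategory V E] (g : Grading (V := V) I E) :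
    EnrichedFunctor V E (E × FreeCat I) where
  obj x := (x, g.p x)
  map x y := g.coact x y
  map_id x := g.id_coact x
  map_comp x y z := g.comp_coact x y z

variable (V) in
/-- An `I`-graded (small) `V`-category. -/
structure GradedCat where
  /-- the underlying `V`-category -/
  cat : VCat V
  /-- the grading -/
  gr : Grading (V := V) I cat

variable {I}

namespace GradedCat

/-- A degree-preserving left morphism `(F, φ) : (E, μ) ⟶ (E', μ')` of graded `V`-categories: a
`V`-functor `F`, a `V`-natural transformation `φ : μ' ∘ F ⟹ (F ⊗ 1) ∘ μ`, and morphisms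
`φ₂(x) : p'(F(x)) ⟶ p(x)` of `I` with `φ(x) = 1 ⊗ φ₂(x)`. -/
@[ext]
structure Hom (E E' : GradedCat V I) where
  /-- the `V`-functor -/
  fn : EnrichedFunctor V E.cat E'.cat
  /-- the `V`-natural transformation `φ` -/
  trans : VNatTrans (vcomp fn E'.gr.mu) (vcomp E.gr.mu (tens (FreeCat I) fn))
  /-- the morphisms `φ₂` -/
  deg (x : E.cat) : (E'.gr.p (fn.obj x)).as ⟶ (E.gr.p x).as
  trans_app (x : E.cat) : trans.app x = etens (eId V (fn.obj x)) (fel (deg x))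

variable {E E' E'' E''' : GradedCat V I}

lemma Hom.ext' {F G : Hom E E'} (h : F.fn = G.fn) (h' : HEq F.deg G.deg) : F = G := by
  obtain ⟨F, φ, d, hd⟩ := F
  obtain ⟨G, ψ, d', hd'⟩ := G
  obtain rfl : F = G := h
  obtain rfl : d = d' := eq_of_heq h'
  obtain rfl : φ = ψ := VNatTrans.ext (funext fun x => (hd x).trans (hd' x).symm)
  rfl

/-- The naturality of `φ` in terms of `φ₂`. -/
lemma Hom.nat (F : Hom E E') (x y : E.cat) :
    F.fn.map x y ≫ E'.gr.coact (F.fn.obj x) (F.fn.obj y) ≫ _ ◁ ePost _ (fel (F.deg y)) =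
      E.gr.coact x y ≫ (F.fn.map x y ⊗ₘ ePre (fel (F.deg x)) _) := by
  have h := F.trans.naturality x y
  rw [F.trans_app, F.trans_app, ePost_etens, ePre_etens, ePost_id, ePre_id] at h
  have key : (F.fn.map x y ≫ E'.gr.coact (F.fn.obj x) (F.fn.obj y)) ≫
      (𝟙 _ ⊗ₘ ePost _ (fel (F.deg y))) = (E.gr.coact x y ≫ F.fn.map x y ▷ _) ≫
        (𝟙 _ ⊗ₘ ePre (fel (F.deg x)) _) := h
  rw [id_tensorHom, Category.assoc] at key
  rw [key, Category.assoc, ← tensorHom_id, tensorHom_comp_tensorHom, Category.comp_id,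
    Category.id_comp]

/-- The construction of a degree-preserving left morphism from the morphisms `φ₂`. -/
@[simps fn deg]
def Hom.mk' (fn : EnrichedFunctor V E.cat E'.cat)
    (deg : ∀ x : E.cat, (E'.gr.p (fn.obj x)).as ⟶ (E.gr.p x).as)
    (h : ∀ x y : E.cat,
      fn.map x y ≫ E'.gr.coact (fn.obj x) (fn.obj y) ≫ _ ◁ ePost _ (fel (deg y)) =
      E.gr.coact x y ≫ (fn.map x y ⊗ₘ ePre (fel (deg x)) _)) : Hom E E' where
  fn := fn
  deg := deg
  trans :=
    { app := fun x => etens (eId V (fn.obj x)) (fel (deg x))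
      naturality := fun x y => by
        have key : (fn.map x y ≫ E'.gr.coact (fn.obj x) (fn.obj y)) ≫
            (𝟙 _ ⊗ₘ ePost _ (fel (deg y))) = (E.gr.coact x y ≫ fn.map x y ▷ _) ≫
              (𝟙 _ ⊗ₘ ePre (fel (deg x)) _) := by
          rw [id_tensorHom, Category.assoc, h, Category.assoc, ← tensorHom_id,
            tensorHom_comp_tensorHom, Category.comp_id, Category.id_comp]
        rw [ePost_etens, ePre_etens, ePost_id, ePre_id]
        exact key }
  trans_app x := rfl

/-- The identity morphism. -/
def Hom.id (E : GradedCat V I) : Hom E E :=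
  Hom.mk' (vid E.cat) (fun x => 𝟙 _) fun x y => by
    have key : 𝟙 (x ⟶[V] y) ≫ E.gr.coact x y ≫ _ ◁ ePost _ (eId V (E.gr.p y)) =
        E.gr.coact x y ≫ (𝟙 _ ⊗ₘ ePre (eId V (E.gr.p x)) _) := by
      rw [ePost_id, ePre_id]; simp
    exact key

/-- The composition of left morphisms; see `Hom.comp_trans_app`. -/
def Hom.comp (F : Hom E E') (G : Hom E' E'') : Hom E E'' :=
  Hom.mk' (vcomp F.fn G.fn) (fun x => G.deg (F.fn.obj x) ≫ F.deg x) fun x y => by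
    have h1 := F.nat x y
    have h2 := G.nat (F.fn.obj x) (F.fn.obj y)
    have key : (F.fn.map x y ≫ G.fn.map _ _) ≫
        E''.gr.coact (G.fn.obj (F.fn.obj x)) (G.fn.obj (F.fn.obj y)) ≫
          _ ◁ ePost _ (eMul (fel (G.deg (F.fn.obj y))) (fel (F.deg y))) =
        E.gr.coact x y ≫ ((F.fn.map x y ≫ G.fn.map _ _) ⊗ₘ
          ePre (eMul (fel (G.deg (F.fn.obj x))) (fel (F.deg x))) _) := by
      rw [ePost_eMul, ePre_eMul, MonoidalCategory.whiskerLeft_comp, Category.assoc,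
        reassoc_of% h2, ← tensorHom_comp_tensorHom, ← reassoc_of% h1]
      simp only [← id_tensorHom, tensorHom_comp_tensorHom, Category.comp_id, Category.id_comp,
        ePre_ePost]
    simpa only [eMul_fel] using key

/-- The natural transformation of a composition is given by the pasting of squares. -/
lemma Hom.comp_trans_app (F : Hom E E') (G : Hom E' E'') (x : E.cat) :
    (Hom.comp F G).trans.app x = eMul (G.trans.app (F.fn.obj x))
      (F.trans.app x ≫ (tens (FreeCat I) G.fn).map _ _) := by
  have h : F.trans.app x ≫ (tens (FreeCat I) G.fn).map _ _ =
      etens (eId V (G.fn.obj (F.fn.obj x))) (fel (F.deg x)) := by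
    have key : etens (eId V (F.fn.obj x)) (fel (F.deg x)) ≫ G.fn.map _ _ ▷ _ =
      etens (eId V (G.fn.obj (F.fn.obj x))) (fel (F.deg x)) := by
      rw [etens_whiskerRight, G.fn.map_id]
    rw [F.trans_app]
    exact key
  rw [h, G.trans_app, ← comp_ePost, ePost_etens]
  have key : etens (eId V (G.fn.obj (F.fn.obj x))) (fel (G.deg (F.fn.obj x))) ≫
      (ePost _ (eId V (G.fn.obj (F.fn.obj x))) ⊗ₘ ePost _ (fel (F.deg x))) =
      etens (eId V (G.fn.obj (F.fn.obj x))) (fel (G.deg (F.fn.obj x) ≫ F.deg x)) := by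
    rw [etens_comp, comp_ePost, comp_ePost, eMul_id, eMul_fel]
  exact key.symm

/-- A 2-morphism `(F, φ) ⟹ (G, ψ)`: a `V`-natural transformation `ξ : F ⟹ G` with
`ψ ∘ μ'ξ = (ξ ⊗ 1)μ ∘ φ`. -/
@[ext]
structure Hom₂ (F G : Hom E E') where
  /-- the `V`-natural transformation -/
  nt : VNatTrans F.fn G.fn
  comm : VNatTrans.comp (VNatTrans.whiskerR nt E'.gr.mu) G.trans =
    VNatTrans.comp F.trans (VNatTrans.whiskerL E.gr.mu (tensTrans (FreeCat I) nt))

lemma comm_iff {F G : Hom E E'} (ξ : VNatTrans F.fn G.fn) :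
    VNatTrans.comp (VNatTrans.whiskerR ξ E'.gr.mu) G.trans =
      VNatTrans.comp F.trans (VNatTrans.whiskerL E.gr.mu (tensTrans (FreeCat I) ξ)) ↔
    ∀ x, ξ.app x ≫ E'.gr.coact _ _ ≫ _ ◁ ePost _ (fel (G.deg x)) =
      etens (ξ.app x) (fel (F.deg x)) := by
  rw [VNatTrans.ext_iff, funext_iff]
  refine forall_congr' fun x => ?_
  have h1 : eMul (ξ.app x ≫ E'.gr.mu.map _ _) (G.trans.app x) =
      ξ.app x ≫ E'.gr.coact _ _ ≫ _ ◁ ePost _ (fel (G.deg x)) := by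
    rw [← comp_ePost, G.trans_app, ePost_etens, ePost_id, id_tensorHom, Category.assoc]
  have h2 : eMul (F.trans.app x) ((tensTrans (FreeCat I) ξ).app (E.gr.mu.obj x)) =
      etens (ξ.app x) (fel (F.deg x)) := by
    have key : etens (eId V (F.fn.obj x)) (fel (F.deg x)) ≫
        (ePost _ (ξ.app x) ⊗ₘ ePost _ (eId V (E.gr.p x))) =
        etens (ξ.app x) (fel (F.deg x)) := by
      rw [etens_comp, ePost_id, comp_ePost, id_eMul, Category.comp_id]
    rw [F.trans_app, ← comp_ePost, tensTrans, ePost_etens]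
    exact key
  exact ⟨fun h => h1.symm.trans (h.trans h2), fun h => h1.trans (h.trans h2.symm)⟩


lemma Hom₂.comm' {F G : Hom E E'} (ξ : Hom₂ F G) (x : E.cat) :
    ξ.nt.app x ≫ E'.gr.coact _ _ ≫ _ ◁ ePost _ (fel (G.deg x)) =
      etens (ξ.nt.app x) (fel (F.deg x)) :=
  (comm_iff ξ.nt).1 ξ.comm x

/-- Compatibility of a transformation of identity components. -/
lemma id_comm {e : E.cat} {j : FreeCat I} (u : (E.gr.p e).as ⟶ j.as)
    (w : (E.gr.p e).as ⟶ j.as) (h : u = w) :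
    eId V e ≫ E.gr.coact _ _ ≫ _ ◁ ePost _ (fel (i := E.gr.p e) (j := j) w) =
      etens (eId V e) (fel u) := by
  rw [← Category.assoc, E.gr.id_coact, etens_whiskerLeft, comp_ePost, id_eMul, h]

lemma tensTrans_comp {F G H : EnrichedFunctor V E.cat E'.cat} (α : VNatTrans F G)
    (β : VNatTrans G H) : tensTrans (FreeCat I) (VNatTrans.comp α β) =
      VNatTrans.comp (tensTrans (FreeCat I) α) (tensTrans (FreeCat I) β) :=
  VNatTrans.ext <| funext fun x => by
    have key : etens (eMul (α.app x.1) (β.app x.1)) (eId V x.2) =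
        etens (α.app x.1) (eId V x.2) ≫ (ePost _ (β.app x.1) ⊗ₘ ePost _ (eId V x.2)) := by
      rw [etens_comp, comp_ePost, comp_ePost, id_eMul]
    have key2 : eMul ((tensTrans (FreeCat I) α).app x) ((tensTrans (FreeCat I) β).app x) =
        etens (α.app x.1) (eId V x.2) ≫ (ePost _ (β.app x.1) ⊗ₘ ePost _ (eId V x.2)) := by
      rw [← comp_ePost, tensTrans, tensTrans, ePost_etens]
    exact key.trans key2.symm

/-- The identity. -/
@[simps]
def Hom₂.id (F : Hom E E') : Hom₂ F F where
  nt := VNatTrans.id F.fn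
  comm := (comm_iff _).2 fun _ => id_comm _ _ rfl

/-- Vertical composition. -/
@[simps]
def Hom₂.comp {F G H : Hom E E'} (ξ : Hom₂ F G) (ζ : Hom₂ G H) : Hom₂ F H where
  nt := VNatTrans.comp ξ.nt ζ.nt
  comm := by
    have h1 : VNatTrans.whiskerR (VNatTrans.comp ξ.nt ζ.nt) E'.gr.mu =
        VNatTrans.comp (VNatTrans.whiskerR ξ.nt E'.gr.mu) (VNatTrans.whiskerR ζ.nt E'.gr.mu) :=
      VNatTrans.ext <| funext fun x => map_eMul _ _ _
    have h2 : VNatTrans.whiskerL E.gr.mu (VNatTrans.comp (tensTrans (FreeCat I) ξ.nt)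
        (tensTrans (FreeCat I) ζ.nt)) = VNatTrans.comp
          (VNatTrans.whiskerL E.gr.mu (tensTrans (FreeCat I) ξ.nt))
          (VNatTrans.whiskerL E.gr.mu (tensTrans (FreeCat I) ζ.nt)) := rfl
    have assoc : ∀ {A B C D : EnrichedFunctor V E.cat (E'.cat × FreeCat I)} (α : VNatTrans A B)
        (β : VNatTrans B C) (γ : VNatTrans C D), VNatTrans.comp (VNatTrans.comp α β) γ =
          VNatTrans.comp α (VNatTrans.comp β γ) :=
      fun α β γ => VNatTrans.ext <| funext fun x => eMul_assoc _ _ _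
    rw [h1, tensTrans_comp, h2, assoc, ζ.comm, ← assoc, ξ.comm, assoc]

instance homCategory : Category (Hom E E') where
  Hom F G := Hom₂ F G
  id F := Hom₂.id F
  comp ξ ζ := Hom₂.comp ξ ζ
  id_comp ξ := Hom₂.ext (VNatTrans.ext (by funext x; simp))
  comp_id ξ := Hom₂.ext (VNatTrans.ext (by funext x; simp))
  assoc ξ ζ θ := Hom₂.ext (VNatTrans.ext (by funext x; simp [eMul_assoc]))

/-- Whiskering with a left morphism applied first. -/
def Hom₂.whiskerL (F : Hom E E') {G H : Hom E' E''} (ξ : Hom₂ G H) :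
    Hom₂ (Hom.comp F G) (Hom.comp F H) where
  nt := VNatTrans.whiskerL F.fn ξ.nt
  comm := (comm_iff (F := Hom.comp F G) (G := Hom.comp F H)
      (VNatTrans.whiskerL F.fn ξ.nt)).2 fun x => by
    have h := ξ.comm' (F.fn.obj x)
    have key : ξ.nt.app (F.fn.obj x) ≫ E''.gr.coact _ _ ≫
        _ ◁ ePost _ (eMul (fel (H.deg (F.fn.obj x))) (fel (F.deg x))) =
        etens (ξ.nt.app (F.fn.obj x)) (eMul (fel (G.deg (F.fn.obj x))) (fel (F.deg x))) := by
      rw [ePost_eMul, MonoidalCategory.whiskerLeft_comp, reassoc_of% h, etens_whiskerLeft,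
        comp_ePost]
    rw [eMul_fel, eMul_fel] at key
    exact key

/-- Whiskering with a left morphism applied last. -/
def Hom₂.whiskerR {F G : Hom E E'} (ξ : Hom₂ F G) (H : Hom E' E'') :
    Hom₂ (Hom.comp F H) (Hom.comp G H) where
  nt := VNatTrans.whiskerR ξ.nt H.fn
  comm := (comm_iff (F := Hom.comp F H) (G := Hom.comp G H)
      (VNatTrans.whiskerR ξ.nt H.fn)).2 fun x => by
    have h1 := ξ.comm' x
    have h2 := H.nat (F.fn.obj x) (G.fn.obj x)
    have key : (ξ.nt.app x ≫ H.fn.map _ _) ≫ E''.gr.coact _ _ ≫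
        _ ◁ ePost _ (eMul (fel (H.deg (G.fn.obj x))) (fel (G.deg x))) =
        etens (ξ.nt.app x ≫ H.fn.map _ _) (eMul (fel (H.deg (F.fn.obj x))) (fel (F.deg x))) := by
      rw [ePost_eMul, MonoidalCategory.whiskerLeft_comp, Category.assoc, reassoc_of% h2,
        ← id_tensorHom, tensorHom_comp_tensorHom, ePre_ePost, ← Category.id_comp (H.fn.map _ _),
        Category.assoc, Category.comp_id, ← tensorHom_comp_tensorHom, id_tensorHom,
        reassoc_of% h1, etens_comp, comp_ePre, Category.id_comp]
    rw [eMul_fel, eMul_fel] at key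
    exact key

/-- The associativity of the composition, with identity components. -/
def associator (F : Hom E E') (G : Hom E' E'') (H : Hom E'' E''') :
    Hom.comp (Hom.comp F G) H ≅ Hom.comp F (Hom.comp G H) where
  hom :=
    { nt := (VCat.associator F.fn G.fn H.fn).hom
      comm := (comm_iff (F := Hom.comp (Hom.comp F G) H) (G := Hom.comp F (Hom.comp G H)) _).2
        fun _ => id_comm _ _ (Category.assoc _ _ _).symm }
  inv :=
    { nt := (VCat.associator F.fn G.fn H.fn).inv
      comm := (comm_iff (F := Hom.comp F (Hom.comp G H)) (G := Hom.comp (Hom.comp F G) H) _).2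
        fun _ => id_comm _ _ (Category.assoc _ _ _) }
  hom_inv_id := Hom₂.ext (VCat.associator F.fn G.fn H.fn).hom_inv_id
  inv_hom_id := Hom₂.ext (VCat.associator F.fn G.fn H.fn).inv_hom_id

/-- The left unit law, with identity components. -/
def leftUnitor (F : Hom E E') : Hom.comp (Hom.id E) F ≅ F where
  hom :=
    { nt := (VCat.leftUnitor F.fn).hom
      comm := (comm_iff (F := Hom.comp (Hom.id E) F) (G := F) _).2
        fun _ => id_comm _ _ (Category.comp_id _) }
  inv :=
    { nt := (VCat.leftUnitor F.fn).inv
      comm := (comm_iff (F := F) (G := Hom.comp (Hom.id E) F) _).2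
        fun _ => id_comm _ _ (Category.comp_id _).symm }
  hom_inv_id := Hom₂.ext (VCat.leftUnitor F.fn).hom_inv_id
  inv_hom_id := Hom₂.ext (VCat.leftUnitor F.fn).inv_hom_id

/-- The right unit law, with identity components. -/
def rightUnitor (F : Hom E E') : Hom.comp F (Hom.id E') ≅ F where
  hom :=
    { nt := (VCat.rightUnitor F.fn).hom
      comm := (comm_iff (F := Hom.comp F (Hom.id E')) (G := F) _).2
        fun _ => id_comm _ _ (Category.id_comp _) }
  inv :=
    { nt := (VCat.rightUnitor F.fn).inv
      comm := (comm_iff (F := F) (G := Hom.comp F (Hom.id E')) _).2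
        fun _ => id_comm _ _ (Category.id_comp _).symm }
  hom_inv_id := Hom₂.ext (VCat.rightUnitor F.fn).hom_inv_id
  inv_hom_id := Hom₂.ext (VCat.rightUnitor F.fn).inv_hom_id

variable (V I) in
/-- The 2-category of (left) `I`-graded `V`-categories and degree-preserving left morphisms. -/
instance bicategory : Bicategory (GradedCat V I) where
  Hom E E' := Hom E E'
  id E := Hom.id E
  comp F G := Hom.comp F G
  homCategory _ _ := homCategory
  whiskerLeft F _ _ α := Hom₂.whiskerL F α
  whiskerRight α H := Hom₂.whiskerR α H
  associator := associator
  leftUnitor := leftUnitor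
  rightUnitor := rightUnitor
  whiskerLeft_id {a b c} F G := Hom₂.ext
    (VCat.bicategory.whiskerLeft_id (a := a.cat) (b := b.cat) (c := c.cat) F.fn G.fn)
  whiskerLeft_comp {a b c} F _ _ _ α β := Hom₂.ext
    (VCat.bicategory.whiskerLeft_comp (a := a.cat) (b := b.cat) (c := c.cat) F.fn α.nt β.nt)
  id_whiskerLeft {a b _ _} α := Hom₂.ext
    (VCat.bicategory.id_whiskerLeft (a := a.cat) (b := b.cat) α.nt)
  comp_whiskerLeft {a b c d} F G _ _ α := Hom₂.ext
    (VCat.bicategory.comp_whiskerLeft (a := a.cat) (b := b.cat) (c := c.cat) (d := d.cat)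
      F.fn G.fn α.nt)
  id_whiskerRight {a b c} F G := Hom₂.ext
    (VCat.bicategory.id_whiskerRight (a := a.cat) (b := b.cat) (c := c.cat) F.fn G.fn)
  comp_whiskerRight {a b c _ _ _} α β G := Hom₂.ext
    (VCat.bicategory.comp_whiskerRight (a := a.cat) (b := b.cat) (c := c.cat) α.nt β.nt G.fn)
  whiskerRight_id {a b _ _} α := Hom₂.ext
    (VCat.bicategory.whiskerRight_id (a := a.cat) (b := b.cat) α.nt)
  whiskerRight_comp {a b c d _ _} α G H := Hom₂.ext
    (VCat.bicategory.whiskerRight_comp (a := a.cat) (b := b.cat) (c := c.cat) (d := d.cat)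
      α.nt G.fn H.fn)
  whisker_assoc {a b c d} F _ _ α H := Hom₂.ext
    (VCat.bicategory.whisker_assoc (a := a.cat) (b := b.cat) (c := c.cat) (d := d.cat)
      F.fn α.nt H.fn)
  whisker_exchange {a b c _ _ _ _} α β := Hom₂.ext
    (VCat.bicategory.whisker_exchange (a := a.cat) (b := b.cat) (c := c.cat) α.nt β.nt)
  pentagon {a b c d e} F G H K := Hom₂.ext
    (VCat.bicategory.pentagon (a := a.cat) (b := b.cat) (c := c.cat) (d := d.cat) (e := e.cat)
      F.fn G.fn H.fn K.fn)
  triangle {a b c} F G := Hom₂.ext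
    (VCat.bicategory.triangle (a := a.cat) (b := b.cat) (c := c.cat) F.fn G.fn)

end GradedCat

end Graded
/-! ### Oplax functors with values in `V`-categories -/

namespace Opl

section

variable {V : Type u} [Category.{v} V] [MonoidalCategory V] {I : Type v} [SmallCategory I]
  (X : OplaxFunctor (LocallyDiscrete I) (VCat V))

/-- The `V`-category `X(i)`. -/
abbrev ob (i : I) : VCat V := X.obj ⟨i⟩

/-- The `V`-functor `X(u)`. -/
abbrev fn {i j : I} (u : i ⟶ j) : EnrichedFunctor V (ob X i) (ob X j) := X.map u.toLoc

/-- The component at `x` of `θ : X(v ∘ u) ⟹ X(v) ∘ X(u)`. -/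
def θ {i j k : I} (u : i ⟶ j) (v : j ⟶ k) (x : ob X i) :
    𝟙_ V ⟶ ((fn X (u ≫ v)).obj x ⟶[V] (fn X v).obj ((fn X u).obj x)) :=
  VNatTrans.app (X.mapComp u.toLoc v.toLoc) x

/-- The component at `x` of `η : X(1) ⟹ 1`. -/
def η (i : I) (x : ob X i) : 𝟙_ V ⟶ ((fn X (𝟙 i)).obj x ⟶[V] x) :=
  VNatTrans.app (X.mapId ⟨i⟩) x

/-- The component at `x` of the 2-morphism `X(u) ⟹ X(u')` for `u = u'`. -/
def idx {i j : I} {u u' : i ⟶ j} (h : u = u') (x : ob X i) :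
    𝟙_ V ⟶ ((fn X u).obj x ⟶[V] (fn X u').obj x) :=
  VNatTrans.app (X.map₂ (eqToHom (congrArg Quiver.Hom.toLoc h))) x

@[simp] lemma idx_rfl {i j : I} {u : i ⟶ j} (h : u = u) (x : ob X i) :
    idx X h x = eId V _ := by
  have : X.map₂ (eqToHom (congrArg Quiver.Hom.toLoc h)) = 𝟙 (fn X u) := by
    simp
  rw [idx, this]
  rfl

lemma app_map₂ {i j : I} {u u' : i ⟶ j} (h : u = u') (σ : u.toLoc ⟶ u'.toLoc) (x : ob X i) :
    VNatTrans.app (X.map₂ σ) x = idx X h x := by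
  rw [idx, Subsingleton.elim σ (eqToHom (congrArg Quiver.Hom.toLoc h))]

lemma θ_naturality {i j k : I} (u : i ⟶ j) (v : j ⟶ k) (x y : ob X i) :
    (fn X (u ≫ v)).map x y ≫ ePost _ (θ X u v y) =
      (fn X u).map x y ≫ (fn X v).map _ _ ≫ ePre (θ X u v x) _ := by
  have := VNatTrans.naturality (X.mapComp u.toLoc v.toLoc) x y
  exact this.trans (Category.assoc _ _ _)

lemma η_naturality {i : I} (x y : ob X i) :
    (fn X (𝟙 i)).map x y ≫ ePost _ (η X i y) = ePre (η X i x) _ := by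
  have := VNatTrans.naturality (X.mapId ⟨i⟩) x y
  exact this.trans (Category.id_comp _)

lemma θ_assoc {i j k l : I} (u : i ⟶ j) (v : j ⟶ k) (w : k ⟶ l) (x : ob X i) :
    eMul (θ X (u ≫ v) w x) (θ X u v x ≫ (fn X w).map _ _) =
      eMul (idx X (Category.assoc u v w) x)
        (eMul (θ X u (v ≫ w) x) (θ X v w ((fn X u).obj x))) := by
  have := congrArg (fun t => VNatTrans.app t x) (X.map₂_associator u.toLoc v.toLoc w.toLoc)
  have h2 : eMul (VNatTrans.app (X.map₂ (Bicategory.associator u.toLoc v.toLoc w.toLoc).hom) x)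
      (eMul (θ X u (v ≫ w) x) (θ X v w ((fn X u).obj x))) =
    eMul (θ X (u ≫ v) w x) (eMul (θ X u v x ≫ (fn X w).map _ _) (eId V _)) := this
  rw [eMul_id] at h2
  have h3 : VNatTrans.app (X.map₂ (Bicategory.associator u.toLoc v.toLoc w.toLoc).hom) x =
      idx X (Category.assoc u v w) x := app_map₂ X (Category.assoc u v w) _ x
  exact h2.symm.trans (congrArg (fun t => eMul t _) h3)

lemma θ_id_left {i j : I} (u : i ⟶ j) (x : ob X i) :
    eMul (θ X (𝟙 i) u x) (η X i x ≫ (fn X u).map _ _) = idx X (Category.id_comp u) x := by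
  have := congrArg (fun t => VNatTrans.app t x) (X.map₂_leftUnitor u.toLoc)
  have h2 : VNatTrans.app (X.map₂ (Bicategory.leftUnitor u.toLoc).hom) x =
    eMul (θ X (𝟙 i) u x) (eMul (η X i x ≫ (fn X u).map _ _) (eId V _)) := this
  rw [eMul_id] at h2
  rw [← h2]
  exact app_map₂ X (Category.id_comp u) _ x

lemma θ_id_right {i j : I} (u : i ⟶ j) (x : ob X i) :
    eMul (θ X u (𝟙 j) x) (η X j ((fn X u).obj x)) = idx X (Category.comp_id u) x := by
  have := congrArg (fun t => VNatTrans.app t x) (X.map₂_rightUnitor u.toLoc)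
  have h2 : VNatTrans.app (X.map₂ (Bicategory.rightUnitor u.toLoc).hom) x =
    eMul (θ X u (𝟙 j) x) (eMul (η X j ((fn X u).obj x)) (eId V _)) := this
  rw [eMul_id] at h2
  rw [← h2]
  exact app_map₂ X (Category.comp_id u) _ x

end

end Opl
/-! ### The Grothendieck construction -/

namespace Gr

open Opl

section

variable {V : Type u} [Category.{v} V] [MonoidalCategory V]
  {I : Type v} [SmallCategory I]

/-- The objects `(x, i)` of the Grothendieck construction. -/
@[ext]
structure Obj (X : OplaxFunctor (LocallyDiscrete I) (VCat V)) where
  /-- the index -/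
  i : I
  /-- the object of `X(i)` -/
  x : ob X i

variable {X : OplaxFunctor (LocallyDiscrete I) (VCat V)}

/-- The component `X(j)(X(u)(x), y)` of the object of morphisms. -/
abbrev comp (a b : Obj X) (u : a.i ⟶ b.i) : V := (fn X u).obj a.x ⟶[V] b.x

/-- The composition on components. -/
def mul (a b c : Obj X) (u : a.i ⟶ b.i) (v : b.i ⟶ c.i) :
    comp a b u ⊗ comp b c v ⟶ comp a c (u ≫ v) :=
  (fn X v).map _ _ ▷ _ ≫ eComp V _ _ _ ≫ ePre (θ X u v a.x) _

lemma one_mul (a b : Obj X) (u : a.i ⟶ b.i) :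
    (λ_ _).inv ≫ η X a.i a.x ▷ _ ≫ mul a a b (𝟙 a.i) u =
      ePre (idx X (Category.id_comp u) a.x) b.x := by
  rw [← θ_id_left, ePre_eMul, mul, ← comp_whiskerRight_assoc]
  simp only [ePre, Category.assoc]

lemma mul_one (a b : Obj X) (u : a.i ⟶ b.i) :
    (ρ_ _).inv ≫ _ ◁ η X b.i b.x ≫ mul a b b u (𝟙 b.i) =
      ePre (idx X (Category.comp_id u) a.x) b.x := by
  have := η_naturality (X := X) ((fn X u).obj a.x) b.x
  rw [← θ_id_right, ePre_eMul, mul, whisker_exchange_assoc, ← rightUnitor_inv_naturality_assoc,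
    ← this]
  simp only [ePost, Category.assoc]

lemma mul_assoc (a b c d : Obj X) (u : a.i ⟶ b.i) (v : b.i ⟶ c.i) (w : c.i ⟶ d.i) :
    (α_ _ _ _).inv ≫ mul a b c u v ▷ _ ≫ mul a c d (u ≫ v) w =
      _ ◁ mul b c d v w ≫ mul a b d u (v ≫ w) ≫
        ePre (idx X (Category.assoc u v w) a.x) d.x := by
  have h1 := θ_naturality X v w ((fn X u).obj a.x) b.x
  simp only [mul, comp_whiskerRight, MonoidalCategory.whiskerLeft_comp, Category.assoc]
  rw [whisker_exchange_assoc, ← reassoc_of% (ePost_eComp (V := V)), ← comp_whiskerRight_assoc,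
    ← comp_whiskerRight_assoc (ePre _ _), map_ePre,
    ← comp_whiskerRight_assoc _ (ePost _ (θ X v w b.x)), h1]
  simp only [comp_whiskerRight, Category.assoc]
  have h2 := eComp_ePre (V := V) (z := (fn X w).obj c.x) (t := d.x)
    (θ X u v a.x ≫ (fn X w).map ((fn X (u ≫ v)).obj a.x) ((fn X v).obj ((fn X u).obj a.x)))
  have h3 := eComp_ePre (V := V) (z := (fn X w).obj ((fn X v).obj b.x)) (t := d.x)
    (θ X v w ((fn X u).obj a.x))
  rw [← reassoc_of% h2, ← reassoc_of% h3, ← ePre_eMul, θ_assoc, ePre_eMul, ePre_eMul,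
    ← comp_whiskerRight_assoc (eComp V _ _ _), (fn X w).map_comp]
  simp only [comp_whiskerRight, Category.assoc, MonoidalCategory.tensorHom_def]
  have h4 := e_assoc V ((fn X w).obj ((fn X v).obj ((fn X u).obj a.x)))
    ((fn X w).obj ((fn X v).obj b.x)) ((fn X w).obj c.x) d.x
  rw [whisker_exchange_assoc, whisker_exchange_assoc, whisker_exchange_assoc,
    whisker_exchange_assoc, ← reassoc_of% h4]
  simp

variable [CoproductMonoidal V]

/-- The object of morphisms. -/
abbrev hom (a b : Obj X) : V := ∐ comp a b

/-- The inclusion of a component. -/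
abbrev inc (a b : Obj X) (u : a.i ⟶ b.i) : comp a b u ⟶ hom a b := Sigma.ι (comp a b) u

lemma idx_inc (a b : Obj X) {u u' : a.i ⟶ b.i} (h : u = u') :
    ePre (idx X h a.x) b.x ≫ inc a b u = inc a b u' := by
  subst h
  simp

/-- The composition. -/
def comp' (a b c : Obj X) : hom a b ⊗ hom b c ⟶ hom a c :=
  tdesc fun u v => mul a b c u v ≫ inc a c (u ≫ v)

lemma inc_comp' (a b c : Obj X) (u : a.i ⟶ b.i) (v : b.i ⟶ c.i) :
    (inc a b u ⊗ₘ inc b c v) ≫ comp' a b c = mul a b c u v ≫ inc a c (u ≫ v) :=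
  ι_tdesc _ _ _

/-- The identity. -/
def one (a : Obj X) : 𝟙_ V ⟶ hom a a := η X a.i a.x ≫ inc a a (𝟙 a.i)

/-- The Grothendieck construction of an oplax functor, as a `V`-category. -/
instance category : EnrichedCategory V (Obj X) where
  Hom a b := hom a b
  id a := one a
  comp a b c := comp' a b c
  id_comp a b := by
    refine Sigma.hom_ext _ _ fun u => ?_
    have h := one_mul a b u
    have key : inc a b u ≫ (λ_ _).inv ≫ (η X a.i a.x ≫ inc a a (𝟙 a.i)) ▷ _ ≫ comp' a a b =
        inc a b u := by
      rw [leftUnitor_inv_naturality_assoc, comp_whiskerRight, Category.assoc,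
        whisker_exchange_assoc, ← tensorHom_def'_assoc, inc_comp', reassoc_of% h, idx_inc]
    exact key.trans (Category.comp_id _).symm
  comp_id a b := by
    refine Sigma.hom_ext _ _ fun u => ?_
    have h := mul_one a b u
    have key : inc a b u ≫ (ρ_ _).inv ≫ _ ◁ (η X b.i b.x ≫ inc b b (𝟙 b.i)) ≫ comp' a b b =
        inc a b u := by
      rw [rightUnitor_inv_naturality_assoc, MonoidalCategory.whiskerLeft_comp, Category.assoc,
        ← whisker_exchange_assoc, ← tensorHom_def_assoc, inc_comp', reassoc_of% h, idx_inc]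
    exact key.trans (Category.comp_id _).symm
  assoc a b c d := by
    refine tensor_ext₃ fun u v w => ?_
    have h1 : ((inc a b u ⊗ₘ inc b c v) ⊗ₘ inc c d w) ≫ comp' a b c ▷ hom c d ≫ comp' a c d =
        mul a b c u v ▷ _ ≫ mul a c d (u ≫ v) w ≫ inc a d ((u ≫ v) ≫ w) := by
      rw [← inc_comp', tensorHom_def_assoc, ← whisker_exchange_assoc, tensorHom_def_assoc,
        ← comp_whiskerRight_assoc, inc_comp']
      simp only [comp_whiskerRight, Category.assoc]
      rw [whisker_exchange_assoc, whisker_exchange_assoc]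
    have h2 : (inc a b u ⊗ₘ (inc b c v ⊗ₘ inc c d w)) ≫ hom a b ◁ comp' b c d ≫ comp' a b d =
        _ ◁ mul b c d v w ≫ mul a b d u (v ≫ w) ≫ inc a d (u ≫ (v ≫ w)) := by
      rw [← inc_comp', tensorHom_def'_assoc, whisker_exchange_assoc, tensorHom_def'_assoc,
        ← MonoidalCategory.whiskerLeft_comp_assoc, inc_comp']
      simp only [Category.assoc, MonoidalCategory.whiskerLeft_comp]
      rw [← whisker_exchange_assoc, ← whisker_exchange_assoc]
    have h3 := mul_assoc a b c d u v w
    have key : (inc a b u ⊗ₘ (inc b c v ⊗ₘ inc c d w)) ≫ (α_ _ _ _).inv ≫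
        comp' a b c ▷ hom c d ≫ comp' a c d =
        (inc a b u ⊗ₘ (inc b c v ⊗ₘ inc c d w)) ≫ hom a b ◁ comp' b c d ≫ comp' a b d := by
      rw [associator_inv_naturality_assoc, h1, h2, reassoc_of% h3, idx_inc]
    exact key

/-- The inclusion of a component. -/
def inj (a b : Obj X) (u : a.i ⟶ b.i) : comp a b u ⟶ (a ⟶[V] b) := inc a b u

lemma category_hom_ext {a b : Obj X} {A : V} {f g : (a ⟶[V] b) ⟶ A}
    (h : ∀ u, inj a b u ≫ f = inj a b u ≫ g) : f = g :=
  Sigma.hom_ext _ _ h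

lemma category_tensor_ext {a b c d : Obj X} {A : V} {f g : (a ⟶[V] b) ⊗ (c ⟶[V] d) ⟶ A}
    (h : ∀ u v, (inj a b u ⊗ₘ inj c d v) ≫ f = (inj a b u ⊗ₘ inj c d v) ≫ g) : f = g :=
  tensor_ext h

lemma category_id (a : Obj X) : eId V a = η X a.i a.x ≫ inj a a (𝟙 a.i) := rfl

lemma category_comp (a b c : Obj X) (u : a.i ⟶ b.i) (v : b.i ⟶ c.i) :
    (inj a b u ⊗ₘ inj b c v) ≫ eComp V a b c = mul a b c u v ≫ inj a c (u ≫ v) :=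
  inc_comp' a b c u v

lemma idx_inj (a b : Obj X) {u u' : a.i ⟶ b.i} (h : u = u') :
    ePre (idx X h a.x) b.x ≫ inj a b u = inj a b u' := idx_inc a b h

end

end Gr
/-! ### The grading of the Grothendieck construction -/

lemma tensorμ_unit {V : Type u} [Category.{v} V] [MonoidalCategory V] [SymmetricCategory V]
    (A B : V) :
    ((ρ_ A).inv ⊗ₘ (ρ_ B).inv) ≫ tensorμ A (𝟙_ V) B (𝟙_ V) ≫ _ ◁ (λ_ (𝟙_ V)).hom =
      (ρ_ (A ⊗ B)).inv := by
  simp only [tensorμ, braiding_tensorUnit_left]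
  monoidal

namespace Gr

open Opl

section

variable {V : Type u} [Category.{v} V] [MonoidalCategory V]
  [CoproductMonoidal V] {I : Type v} [SmallCategory I]
  {X : OplaxFunctor (LocallyDiscrete I) (VCat V)}

/-- The degree of an object. -/
abbrev p (a : Obj X) : FreeCat I := ⟨a.i⟩

/-- The coaction `f ↦ f ⊗ u` on the component of `u`. -/
def coact (a b : Obj X) : (a ⟶[V] b) ⟶ (a ⟶[V] b) ⊗ (p a ⟶[V] p b) :=
  Sigma.desc fun u : a.i ⟶ b.i => (ρ_ _).inv ≫ (inj a b u ⊗ₘ fel (i := p a) (j := p b) u)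

lemma inj_coact (a b : Obj X) (u : a.i ⟶ b.i) :
    inj a b u ≫ coact a b = (ρ_ _).inv ≫ (inj a b u ⊗ₘ fel (i := p a) (j := p b) u) :=
  Sigma.ι_desc _ _

variable [SymmetricCategory V]

variable (X) in
/-- The grading of the Grothendieck construction. -/
def grading : Grading (V := V) I (Obj X) where
  p := p
  coact := coact
  id_coact a := by
    have h : fel (i := p a) (j := p a) (𝟙 a.i) = eId V (p a) := fel_id (V := V) (p a)
    rw [category_id, Category.assoc, inj_coact, rightUnitor_inv_naturality_assoc, etens,
      unitors_inv_equal, ← tensorHom_id, tensorHom_comp_tensorHom, Category.id_comp, h]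
  comp_coact a b c := by
    refine category_tensor_ext fun u v => ?_
    have h1 := category_comp a b c u v
    have h2 := fel_comp_eComp (V := V) (i := p a) (j := p b) (k := p c) u v
    have h3 := tensorμ_unit (comp a b u) (comp b c v)
    rw [reassoc_of% h1, inj_coact, tensorHom_comp_tensorHom_assoc, inj_coact, inj_coact,
      ← tensorHom_comp_tensorHom, Category.assoc, tensorμ_natural_assoc,
      tensorHom_comp_tensorHom, h1, h2, ← tensorHom_comp_tensorHom,
      tensorHom_def' (mul a b c u v), Category.assoc, reassoc_of% h3,
      ← rightUnitor_inv_naturality_assoc]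
  counit a b := category_hom_ext fun u => by
    rw [← Category.assoc, inj_coact, Category.assoc, ← id_tensorHom,
      tensorHom_comp_tensorHom_assoc, fel_freeCounit, Category.comp_id, tensorHom_id,
      rightUnitor_naturality, Iso.inv_hom_id_assoc]
  coassoc a b := category_hom_ext fun u => by
    rw [← Category.assoc, inj_coact, Category.assoc, ← tensorHom_id,
      tensorHom_comp_tensorHom_assoc, inj_coact, ← Category.assoc (inj a b u), inj_coact,
      Category.assoc, ← id_tensorHom, tensorHom_comp_tensorHom, fel_freeDiag]
    have h1 : ((ρ_ (comp a b u)).inv ≫ (inj a b u ⊗ₘ fel (V := V) (i := p a) (j := p b) u)) ⊗ₘ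
        fel (V := V) (i := p a) (j := p b) u =
        (ρ_ _).inv ▷ _ ≫ ((inj a b u ⊗ₘ fel (i := p a) (j := p b) u) ⊗ₘ
          fel (i := p a) (j := p b) u) := by
      rw [← tensorHom_id, tensorHom_comp_tensorHom, Category.id_comp]
    have h2 : inj a b u ⊗ₘ ((λ_ (𝟙_ V)).inv ≫ (fel (V := V) (i := p a) (j := p b) u ⊗ₘ
        fel (V := V) (i := p a) (j := p b) u)) =
        _ ◁ (λ_ (𝟙_ V)).inv ≫ (inj a b u ⊗ₘ (fel (i := p a) (j := p b) u ⊗ₘ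
          fel (i := p a) (j := p b) u)) := by
      rw [← id_tensorHom, tensorHom_comp_tensorHom, Category.id_comp]
    have h3 : (ρ_ (comp a b u)).inv ▷ (𝟙_ V) ≫ (α_ _ _ _).hom =
        comp a b u ◁ (λ_ (𝟙_ V)).inv := by monoidal
    rw [Category.comp_id, Category.comp_id, h1, h2, Category.assoc, associator_naturality,
      reassoc_of% h3]

end

end Gr
namespace Opl

section

variable {V : Type u} [Category.{v} V] [MonoidalCategory V] {I : Type v} [SmallCategory I]
  {X Y : OplaxFunctor (LocallyDiscrete I) (VCat V)} (F : Oplax.LaxTrans X Y)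

/-- The `V`-functor `F(i)`. -/
abbrev tfn (i : I) : EnrichedFunctor V (ob X i) (ob Y i) := F.app ⟨i⟩

/-- The component at `x` of `φ(u) : Y(u) ∘ F(i) ⟹ F(j) ∘ X(u)`. -/
def φ {i j : I} (u : i ⟶ j) (x : ob X i) :
    𝟙_ V ⟶ ((fn Y u).obj ((tfn F i).obj x) ⟶[V] (tfn F j).obj ((fn X u).obj x)) :=
  VNatTrans.app (F.naturality u.toLoc) x

lemma φ_naturality {i j : I} (u : i ⟶ j) (x y : ob X i) :
    (tfn F i).map x y ≫ (fn Y u).map _ _ ≫ ePost _ (φ F u y) =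
      (fn X u).map x y ≫ (tfn F j).map _ _ ≫ ePre (φ F u x) _ := by
  have := VNatTrans.naturality (F.naturality u.toLoc) x y
  exact (Category.assoc _ _ _).symm.trans (this.trans (Category.assoc _ _ _))

lemma φ_id {i : I} (x : ob X i) :
    eMul (φ F (𝟙 i) x) (η X i x ≫ (tfn F i).map _ _) = η Y i ((tfn F i).obj x) := by
  have := congrArg (fun t => VNatTrans.app t x) (F.naturality_id ⟨i⟩)
  have h2 : eMul (φ F (𝟙 i) x) (η X i x ≫ (tfn F i).map _ _) =
    eMul (η Y i ((tfn F i).obj x)) (eMul (eId V _) (eId V _)) := this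
  rw [h2, eMul_id, eMul_id]

lemma φ_comp {i j k : I} (u : i ⟶ j) (v : j ⟶ k) (x : ob X i) :
    eMul (φ F (u ≫ v) x) (θ X u v x ≫ (tfn F k).map _ _) =
      eMul (θ Y u v ((tfn F i).obj x))
        (eMul (φ F u x ≫ (fn Y v).map _ _) (φ F v ((fn X u).obj x))) := by
  have := congrArg (fun t => VNatTrans.app t x) (F.naturality_comp u.toLoc v.toLoc)
  have h2 : eMul (φ F (u ≫ v) x) (θ X u v x ≫ (tfn F k).map _ _) =
    eMul (θ Y u v ((tfn F i).obj x)) (eMul (eId V _)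
      (eMul (φ F u x ≫ (fn Y v).map _ _) (eMul (eId V _)
        (eMul (φ F v ((fn X u).obj x)) (eId V _))))) := this
  rw [h2, eMul_id, id_eMul, id_eMul]

variable {F} {G : Oplax.LaxTrans X Y} (Θ : Oplax.LaxTrans.Modification F G)

/-- The component at `x` of `Θ(i)`. -/
abbrev mapp (i : I) (x : ob X i) : 𝟙_ V ⟶ ((tfn F i).obj x ⟶[V] (tfn G i).obj x) :=
  VNatTrans.app (Θ.app ⟨i⟩) x

lemma mapp_naturality (i : I) (x y : ob X i) :
    (tfn F i).map x y ≫ ePost _ (mapp Θ i y) = (tfn G i).map x y ≫ ePre (mapp Θ i x) _ :=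
  VNatTrans.naturality (Θ.app ⟨i⟩) x y

lemma mapp_φ {i j : I} (u : i ⟶ j) (x : ob X i) :
    eMul (mapp Θ i x ≫ (fn Y u).map _ _) (φ G u x) =
      eMul (φ F u x) (mapp Θ j ((fn X u).obj x)) :=
  congrArg (fun t => VNatTrans.app t x) (Θ.naturality u.toLoc)

end

end Opl

namespace Gr

open Opl

section

variable {V : Type u} [Category.{v} V] [MonoidalCategory V]
  {I : Type v} [SmallCategory I]
  {X Y : OplaxFunctor (LocallyDiscrete I) (VCat V)} (F : Oplax.LaxTrans X Y)

/-- The action of `Gr(F, φ)` on objects. -/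
abbrev onObj (a : Obj X) : Obj Y := ⟨a.i, (tfn F a.i).obj a.x⟩

/-- The action of `Gr(F, φ)` on the component of `u`. -/
def onComp (a b : Obj X) (u : a.i ⟶ b.i) : comp a b u ⟶ comp (onObj F a) (onObj F b) u :=
  (tfn F b.i).map _ _ ≫ ePre (φ F u a.x) _

lemma onComp_mul (a b c : Obj X) (u : a.i ⟶ b.i) (v : b.i ⟶ c.i) :
    mul a b c u v ≫ onComp F a c (u ≫ v) =
      (onComp F a b u ⊗ₘ onComp F b c v) ≫ mul (onObj F a) (onObj F b) (onObj F c) u v := by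
  have h1 := φ_comp F u v a.x
  have h2 := φ_naturality F v ((fn X u).obj a.x) b.x
  have h3 := map_ePre (tfn F c.i) (θ X u v a.x) c.x
  have h4 := (tfn F c.i).map_comp ((fn X v).obj ((fn X u).obj a.x)) ((fn X v).obj b.x) c.x
  have h5 := map_ePre (fn Y v) (φ F u a.x) ((tfn F b.i).obj b.x)
  have h6 := ePost_eComp (V := V) (x := (fn Y v).obj ((fn Y u).obj ((tfn F a.i).obj a.x)))
    (t := (tfn F c.i).obj c.x) (φ F v b.x)
  have h7 := eComp_ePre (V := V) (z := (tfn F c.i).obj ((fn X v).obj b.x))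
    (t := (tfn F c.i).obj c.x) (eMul (φ F u a.x ≫ (fn Y v).map _ _) (φ F v ((fn X u).obj a.x)))
  have L : mul a b c u v ≫ onComp F a c (u ≫ v) =
      (((fn X v).map _ _ ≫ (tfn F c.i).map _ _) ⊗ₘ (tfn F c.i).map _ _) ≫ eComp V _ _ _ ≫
        ePre (eMul (φ F u a.x ≫ (fn Y v).map _ _) (φ F v ((fn X u).obj a.x))) _ ≫
          ePre (θ Y u v _) _ := by
    simp only [mul, onComp, Category.assoc]
    rw [reassoc_of% h3, ← ePre_eMul, h1, ePre_eMul, reassoc_of% h4, ← tensorHom_id,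
      tensorHom_comp_tensorHom_assoc, Category.id_comp]
  have R : (onComp F a b u ⊗ₘ onComp F b c v) ≫ mul (onObj F a) (onObj F b) (onObj F c) u v =
      (((fn X v).map _ _ ≫ (tfn F c.i).map _ _) ⊗ₘ (tfn F c.i).map _ _) ≫ eComp V _ _ _ ≫
        ePre (eMul (φ F u a.x ≫ (fn Y v).map _ _) (φ F v ((fn X u).obj a.x))) _ ≫
          ePre (θ Y u v _) _ := by
    have k1 : ((tfn F b.i).map ((fn X u).obj a.x) b.x ≫ ePre (φ F u a.x) _) ≫
        (fn Y v).map _ _ ≫ ePost _ (φ F v b.x) = (fn X v).map _ _ ≫ (tfn F c.i).map _ _ ≫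
          ePre (eMul (φ F u a.x ≫ (fn Y v).map _ _) (φ F v ((fn X u).obj a.x))) _ := by
      rw [Category.assoc, reassoc_of% h5, ePre_ePost, reassoc_of% h2, ePre_eMul]
    have k2 : (onComp F a b u ⊗ₘ onComp F b c v) ≫
        (fn Y v).map ((fn Y u).obj ((tfn F a.i).obj a.x)) ((tfn F b.i).obj b.x) ▷ _ =
        (((tfn F b.i).map ((fn X u).obj a.x) b.x ≫ ePre (φ F u a.x) _) ≫
          (fn Y v).map _ _ ⊗ₘ (tfn F c.i).map _ _) ≫ _ ◁ ePre (φ F v b.x) _ := by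
      rw [← tensorHom_id, ← id_tensorHom, tensorHom_comp_tensorHom, tensorHom_comp_tensorHom,
        Category.comp_id, Category.comp_id]
      rfl
    rw [reassoc_of% h7, mul, reassoc_of% k2, ← reassoc_of% h6, ← tensorHom_id,
      tensorHom_comp_tensorHom_assoc]
    simp only [Category.assoc] at k1 ⊢
    rw [k1, ← tensorHom_id, tensorHom_comp_tensorHom_assoc]
    simp only [Category.assoc]
  rw [L, R]

variable [CoproductMonoidal V]

/-- The action of `Gr(F, φ)` on morphisms. -/
def onHom (a b : Obj X) : (a ⟶[V] b) ⟶ (onObj F a ⟶[V] onObj F b) :=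
  Sigma.desc fun u : a.i ⟶ b.i => onComp F a b u ≫ inj (onObj F a) (onObj F b) u

lemma inj_onHom (a b : Obj X) (u : a.i ⟶ b.i) :
    inj a b u ≫ onHom F a b = onComp F a b u ≫ inj (onObj F a) (onObj F b) u :=
  Sigma.ι_desc _ _

/-- The `V`-functor `Gr(F, φ)`. -/
abbrev functor : EnrichedFunctor V (Obj X) (Obj Y) where
  obj := onObj F
  map := onHom F
  map_id a := by
    have h := φ_id F a.x
    rw [← comp_ePre] at h
    rw [category_id, Category.assoc, inj_onHom, onComp, category_id, ← h]
    simp only [Category.assoc]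
  map_comp a b c := category_tensor_ext fun u v => by
    have h1 := category_comp a b c u v
    rw [reassoc_of% h1, inj_onHom, tensorHom_comp_tensorHom_assoc, inj_onHom, inj_onHom,
      ← tensorHom_comp_tensorHom, Category.assoc, category_comp, ← Category.assoc, onComp_mul,
      Category.assoc]

lemma inj_ePost {a b c : Obj X} (u : a.i ⟶ b.i) (v : b.i ⟶ c.i) (t : 𝟙_ V ⟶ comp b c v) :
    inj a b u ≫ ePost a (t ≫ inj b c v) =
      (fn X v).map _ _ ≫ ePost _ t ≫ ePre (θ X u v a.x) _ ≫ inj a c (u ≫ v) := by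
  rw [ePost, rightUnitor_inv_naturality_assoc, MonoidalCategory.whiskerLeft_comp, Category.assoc,
    ← whisker_exchange_assoc, ← tensorHom_def_assoc, category_comp, mul,
    ePost]
  simp only [Category.assoc]
  rw [whisker_exchange_assoc, ← rightUnitor_inv_naturality_assoc]

lemma inj_ePre {a b c : Obj X} (u : a.i ⟶ b.i) (v : b.i ⟶ c.i) (s : 𝟙_ V ⟶ comp a b u) :
    inj b c v ≫ ePre (s ≫ inj a b u) c =
      ePre (s ≫ (fn X v).map _ _) _ ≫ ePre (θ X u v a.x) _ ≫ inj a c (u ≫ v) := by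
  rw [ePre, leftUnitor_inv_naturality_assoc, comp_whiskerRight, Category.assoc,
    whisker_exchange_assoc, ← tensorHom_def'_assoc, category_comp, mul]
  simp only [ePre, Category.assoc, comp_whiskerRight]

/-- The morphism `(s, 1_i) : (x, i) ⟶ (x', i)` given by a morphism `s : x ⟶ x'` of `X(i)`. -/
def lift {i : I} {x x' : ob X i} (s : 𝟙_ V ⟶ (x ⟶[V] x')) :
    𝟙_ V ⟶ ((⟨i, x⟩ : Obj X) ⟶[V] ⟨i, x'⟩) :=
  eMul (η X i x) s ≫ inj ⟨i, x⟩ ⟨i, x'⟩ (𝟙 i)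

lemma inj_ePost_lift {a : Obj X} {j : I} {y y' : ob X j} (u : a.i ⟶ j)
    (s : 𝟙_ V ⟶ (y ⟶[V] y')) :
    inj a ⟨j, y⟩ u ≫ ePost a (lift s) = ePost _ s ≫ inj a ⟨j, y'⟩ u := by
  have h1 := η_naturality (X := X) ((fn X u).obj a.x) y
  have h2 := θ_id_right X u a.x
  rw [lift, inj_ePost (b := ⟨j, y⟩), ePost_eMul, Category.assoc, reassoc_of% h1,
    reassoc_of% (ePre_ePost (V := V)), ← reassoc_of% (ePre_eMul (V := V)), h2]
  exact congrArg (fun t => ePost _ s ≫ t) (idx_inj a ⟨j, y'⟩ (Category.comp_id u))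

lemma inj_ePre_lift {b : Obj X} {i : I} {x x' : ob X i} (u : i ⟶ b.i)
    (s : 𝟙_ V ⟶ (x ⟶[V] x')) :
    inj ⟨i, x'⟩ b u ≫ ePre (lift s) b = ePre (s ≫ (fn X u).map _ _) _ ≫ inj ⟨i, x⟩ b u := by
  have h1 := map_eMul (fn X u) (η X i x) s
  have h2 : ePre (η X i x ≫ (fn X u).map _ _) b.x ≫ ePre (θ X (𝟙 i) u x) b.x =
      ePre (idx X (Category.id_comp u) x) b.x := by
    rw [← ePre_eMul, θ_id_left]
  rw [lift, inj_ePre (b := ⟨i, x'⟩), h1, ePre_eMul, Category.assoc, reassoc_of% h2]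
  exact congrArg (fun t => ePre _ _ ≫ t) (idx_inj ⟨i, x⟩ b (Category.id_comp u))

lemma lift_id {i : I} (x : ob X i) : lift (eId V x) = eId V (⟨i, x⟩ : Obj X) := by
  rw [lift, eMul_id, category_id]

lemma lift_eMul {i : I} {x y z : ob X i} (s : 𝟙_ V ⟶ (x ⟶[V] y)) (t : 𝟙_ V ⟶ (y ⟶[V] z)) :
    lift (eMul s t) = eMul (lift s) (lift t) := by
  rw [← comp_ePost (lift s), lift, lift, Category.assoc, inj_ePost_lift, ← eMul_assoc,
    ← comp_ePost _ t, Category.assoc]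

variable {F} {G : Oplax.LaxTrans X Y} (Θ : Oplax.LaxTrans.Modification F G)

/-- The `V`-natural transformation `Gr(Θ)`. -/
def trans : VNatTrans (functor F) (functor G) where
  app a := lift (mapp Θ a.i a.x)
  naturality a b := category_hom_ext fun u => by
    have h1 := mapp_naturality Θ b.i ((fn X u).obj a.x) b.x
    have h2 := mapp_φ Θ u a.x
    have key : inj a b u ≫ onHom F a b ≫ ePost _ (lift (mapp Θ b.i b.x)) =
        inj a b u ≫ onHom G a b ≫ ePre (lift (mapp Θ a.i a.x)) (onObj G b) := by
      rw [← Category.assoc, inj_onHom, ← Category.assoc, inj_onHom, Category.assoc, Category.assoc,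
        inj_ePost_lift, inj_ePre_lift, onComp, onComp, Category.assoc, Category.assoc,
        ← reassoc_of% (ePre_eMul (V := V)), h2, reassoc_of% (ePre_ePost (V := V)),
        reassoc_of% h1, ePre_eMul, Category.assoc]
    exact key

end

end Gr
namespace Gr

open Opl
open scoped Oplax.LaxTrans Oplax.LaxTrans.OplaxFunctor

section

variable {V : Type u} [Category.{v} V] [MonoidalCategory V] [CoproductMonoidal V]
  [SymmetricCategory V] {I : Type v} [SmallCategory I]
  {X Y : OplaxFunctor (LocallyDiscrete I) (VCat V)}

variable (X) in
/-- The graded `V`-category `(Gr(X), μ_X)`. -/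
def gr : GradedCat V I where
  cat := ⟨Obj X⟩
  gr := grading X

/-- The degree-preserving left morphism `(Gr(F, φ), Gr(φ))`, with `Gr(φ)(x, i) = 1 ⊗ 1_i`. -/
def grMap (F : X ⟶ Y) : gr X ⟶ gr Y :=
  GradedCat.Hom.mk' (E := gr X) (E' := gr Y) (functor F) (fun a => 𝟙 (Obj.i a)) fun (a b : Obj X) =>
    category_hom_ext fun u => by
      have key : inj a b u ≫ onHom F a b ≫ coact (onObj F a) (onObj F b) ≫
          _ ◁ ePost _ (eId V (p b)) =
          inj a b u ≫ coact a b ≫ (onHom F a b ⊗ₘ ePre (eId V (p a)) (p b)) := by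
        rw [ePost_id, ePre_id, MonoidalCategory.whiskerLeft_id, Category.comp_id,
          reassoc_of% (inj_onHom F a b u), inj_coact, reassoc_of% (inj_coact a b u),
          tensorHom_comp_tensorHom, inj_onHom, Category.comp_id, rightUnitor_inv_naturality_assoc,
          ← tensorHom_id, tensorHom_comp_tensorHom, Category.id_comp]
      exact key

/-- The 2-morphism `Gr(Θ)`, with `Gr(Θ)(x, i) = (Θ(i)(x), 1_i)`. -/
def grMap₂ {F G : X ⟶ Y} (Θ : F ⟶ G) : grMap F ⟶ grMap G where
  nt := trans Θ.as
  comm := (GradedCat.comm_iff (F := grMap F) (G := grMap G) (trans Θ.as)).2 fun (a : Obj X) => by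
    have key : (eMul (η Y a.i _) (mapp Θ.as a.i a.x) ≫ inj (onObj F a) (onObj G a) (𝟙 a.i)) ≫
        coact (onObj F a) (onObj G a) ≫ _ ◁ ePost _ (eId V (p a)) =
        etens (lift (mapp Θ.as a.i a.x)) (eId V (p a)) := by
      have h : fel (V := V) (i := p (onObj F a)) (j := p (onObj G a)) (𝟙 a.i) = eId V (p a) :=
        fel_id _
      rw [ePost_id, MonoidalCategory.whiskerLeft_id, Category.comp_id, Category.assoc, inj_coact,
        rightUnitor_inv_naturality_assoc, etens, lift, unitors_inv_equal,
        ← tensorHom_id, tensorHom_comp_tensorHom, Category.id_comp, h]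
    exact key

variable (V I) in
/-- The Grothendieck construction, from oplax functors, left transformations and modifications
to graded `V`-categories. -/
def pre : PrelaxFunctor (OplaxFunctor (LocallyDiscrete I) (VCat V)) (GradedCat V I) where
  obj X := gr X
  map F := grMap F
  map₂ Θ := grMap₂ Θ
  map₂_id _ := GradedCat.Hom₂.ext (VNatTrans.ext (funext fun _ => lift_id _))
  map₂_comp _ _ := GradedCat.Hom₂.ext (VNatTrans.ext (funext fun _ => lift_eMul _ _))

end

end Gr
/-! ### Comma categories and the smash product construction -/

/-- A general form of the stability of homogeneous morphisms under composition. -/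
lemma homog_comp_aux {V : Type u} [Category.{v} V] [MonoidalCategory V] {C D : Type w}
    [EnrichedCategory V C] [EnrichedCategory V D] (M J : EnrichedFunctor V C D) {x y z : C}
    (α : 𝟙_ V ⟶ (M.obj x ⟶[V] J.obj x)) (β : 𝟙_ V ⟶ (M.obj y ⟶[V] J.obj y))
    (γ : 𝟙_ V ⟶ (M.obj z ⟶[V] J.obj z)) {A B : V} {h : A ⟶ (x ⟶[V] y)} {k : B ⟶ (y ⟶[V] z)}
    (hh : h ≫ M.map x y ≫ ePost _ β = h ≫ J.map x y ≫ ePre α _)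
    (hk : k ≫ M.map y z ≫ ePost _ γ = k ≫ J.map y z ≫ ePre β _) :
    ((h ⊗ₘ k) ≫ eComp V x y z) ≫ M.map x z ≫ ePost _ γ =
      ((h ⊗ₘ k) ≫ eComp V x y z) ≫ J.map x z ≫ ePre α _ := by
  rw [Category.assoc, ← Category.assoc (eComp V x y z), M.map_comp, Category.assoc, eComp_ePost,
    Category.assoc, ← Category.assoc (eComp V x y z), J.map_comp, Category.assoc, eComp_ePre,
    tensorHom_comp_tensorHom_assoc, tensorHom_comp_tensorHom_assoc, ← id_tensorHom,
    ← tensorHom_id, tensorHom_comp_tensorHom_assoc, tensorHom_comp_tensorHom_assoc,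
    Category.assoc, Category.assoc, Category.assoc, hk, Category.comp_id, Category.comp_id]
  have h1 : (h ≫ M.map x y ⊗ₘ k ≫ J.map y z ≫ ePre β (J.obj z)) =
      (h ≫ M.map x y ⊗ₘ k ≫ J.map y z) ≫ _ ◁ ePre β (J.obj z) := by
    rw [← id_tensorHom, tensorHom_comp_tensorHom, Category.comp_id, Category.assoc]
  have h2 : (h ≫ J.map x y ≫ ePre α (J.obj y) ⊗ₘ k ≫ J.map y z) =
      (h ≫ M.map x y ⊗ₘ k ≫ J.map y z) ≫ ePost (M.obj x) β ▷ _ := by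
    rw [← hh, ← tensorHom_id, tensorHom_comp_tensorHom, Category.comp_id, Category.assoc]
  rw [h1, h2, Category.assoc, Category.assoc, ePost_eComp]

section Shift

variable {V : Type u} [Category.{v} V] [MonoidalCategory V] [SymmetricCategory V]

/-- The `V`-functor `E ⟶ E ⊗ B` given by `e ↦ (e, i)` and `f ↦ f ⊗ 1_i`. -/
abbrev constFn {E B : Type v} [EnrichedCategory V E] [EnrichedCategory V B] (i : B) :
    EnrichedFunctor V E (E × B) where
  obj e := (e, i)
  map x y := (ρ_ (x ⟶[V] y)).inv ≫ (x ⟶[V] y) ◁ eId V i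
  map_id x := by
    have key : eId V x ≫ (ρ_ (x ⟶[V] x)).inv ≫ (x ⟶[V] x) ◁ eId V i =
        etens (eId V x) (eId V i) := by
      rw [rightUnitor_inv_naturality_assoc, etens, unitors_inv_equal,
        MonoidalCategory.tensorHom_def]
    exact key
  map_comp x y z := by
    have h := tensorμ_unit (x ⟶[V] y) (y ⟶[V] z)
    have h2 : (eId V i ⊗ₘ eId V i) ≫ eComp V i i i = (λ_ (𝟙_ V)).hom ≫ eId V i := by
      have := eMul_id (eId V i)
      rw [eMul, Iso.inv_comp_eq] at this
      exact this
    have key : eComp V x y z ≫ (ρ_ (x ⟶[V] z)).inv ≫ (x ⟶[V] z) ◁ eId V i =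
        (((ρ_ (x ⟶[V] y)).inv ≫ (x ⟶[V] y) ◁ eId V i) ⊗ₘ
          ((ρ_ (y ⟶[V] z)).inv ≫ (y ⟶[V] z) ◁ eId V i)) ≫ tensorμ _ _ _ _ ≫
            (eComp V x y z ⊗ₘ eComp V i i i) := by
      rw [← tensorHom_comp_tensorHom, Category.assoc, ← id_tensorHom, ← id_tensorHom,
        ← id_tensorHom, tensorμ_natural_assoc, tensorHom_comp_tensorHom, h2, id_tensorHom_id, Category.id_comp,
        tensorHom_def' (eComp V x y z), MonoidalCategory.whiskerLeft_comp, Category.assoc,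
        reassoc_of% h, rightUnitor_inv_naturality_assoc, whisker_exchange,
        id_tensorHom]
    exact key

end Shift

namespace Grading

variable {V : Type u} [Category.{v} V] [MonoidalCategory V] [SymmetricCategory V]
  [CoproductMonoidal V] {I : Type v} [SmallCategory I] {E : Type v} [EnrichedCategory V E]
  (g : Grading (V := V) I E)

/-- The objects `(e, u : p(e) ⟶ i)` of the comma category `μ ↓ i`. -/
@[ext]
structure Comma (i : I) where
  /-- the object of `E` -/
  e : E
  /-- the morphism of `I` -/
  u : (g.p e).as ⟶ i

variable {g} {i : I}

/-- The morphism `E(e,e') ⟶ E(e,e') ⊗ (I ⊗ 1)(p(e), i)` given by `μ` and composition with `u'`. -/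
def Comma.left (a b : g.Comma i) :
    (a.e ⟶[V] b.e) ⟶ (a.e ⟶[V] b.e) ⊗ (g.p a.e ⟶[V] (⟨i⟩ : FreeCat I)) :=
  g.coact a.e b.e ≫ _ ◁ ePost (g.p a.e) (fel (j := (⟨i⟩ : FreeCat I)) b.u)

/-- The morphism `1 ⊗ u : E(e,e') ⊗ 1 ⟶ E(e,e') ⊗ (I ⊗ 1)(p(e), i)`. -/
def Comma.right (a b : g.Comma i) :
    (a.e ⟶[V] b.e) ⊗ 𝟙_ V ⟶ (a.e ⟶[V] b.e) ⊗ (g.p a.e ⟶[V] (⟨i⟩ : FreeCat I)) :=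
  _ ◁ fel (j := (⟨i⟩ : FreeCat I)) a.u

/-- The condition that a morphism to `E(e,e')` factors through `(μ ↓ i)((e,u),(e',u'))`. -/
def Comma.Homog (a b : g.Comma i) {A : V} (h : A ⟶ (a.e ⟶[V] b.e)) : Prop :=
  h ≫ a.left b = h ≫ (ρ_ _).inv ≫ a.right b

lemma Comma.homog_iff (a b : g.Comma i) {A : V} (h : A ⟶ (a.e ⟶[V] b.e)) :
    a.Homog b h ↔ h ≫ g.mu.map a.e b.e ≫
        ePost (a.e, g.p a.e) (x := (b.e, g.p b.e)) (y := (b.e, (⟨i⟩ : FreeCat I)))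
          (etens (eId V b.e) (fel b.u)) =
      h ≫ (constFn (⟨i⟩ : FreeCat I)).map a.e b.e ≫
        ePre (x := (a.e, g.p a.e)) (y := (a.e, (⟨i⟩ : FreeCat I)))
          (etens (eId V a.e) (fel a.u)) (b.e, (⟨i⟩ : FreeCat I)) := by
  have h1 : g.mu.map a.e b.e ≫
        ePost (a.e, g.p a.e) (x := (b.e, g.p b.e)) (y := (b.e, (⟨i⟩ : FreeCat I)))
          (etens (eId V b.e) (fel b.u)) = a.left b := by
    rw [ePost_etens, ePost_id, id_tensorHom]
    rfl
  have h2 : (constFn (⟨i⟩ : FreeCat I)).map a.e b.e ≫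
        ePre (x := (a.e, g.p a.e)) (y := (a.e, (⟨i⟩ : FreeCat I)))
          (etens (eId V a.e) (fel a.u)) (b.e, (⟨i⟩ : FreeCat I)) =
      (ρ_ _).inv ≫ a.right b := by
    have key : ((ρ_ (a.e ⟶[V] b.e)).inv ≫ (a.e ⟶[V] b.e) ◁ eId V (⟨i⟩ : FreeCat I)) ≫
        _ ◁ ePre (fel a.u) (⟨i⟩ : FreeCat I) = (ρ_ _).inv ≫ a.right b := by
      rw [Category.assoc, ← MonoidalCategory.whiskerLeft_comp, comp_ePre, eMul_id]
      rfl
    rw [ePre_etens, ePre_id, id_tensorHom]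
    exact key
  rw [h1, h2]
  rfl

lemma Comma.homog_id (a : g.Comma i) : a.Homog a (eId V a.e) := by
  rw [Comma.homog_iff, ← Category.assoc, g.mu.map_id, ← Category.assoc,
    (constFn (⟨i⟩ : FreeCat I)).map_id]
  have h1 := comp_ePost (V := V) (eId V (a.e, g.p a.e))
    (z := (a.e, (⟨i⟩ : FreeCat I))) (etens (eId V a.e) (fel a.u))
  have h2 := comp_ePre (V := V) (x := (a.e, g.p a.e)) (etens (eId V a.e) (fel a.u))
    (eId V (a.e, (⟨i⟩ : FreeCat I)))
  rw [id_eMul] at h1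
  rw [eMul_id] at h2
  exact h1.trans h2.symm

lemma Comma.Homog.comp {a b c : g.Comma i} {A B : V} {h : A ⟶ (a.e ⟶[V] b.e)}
    {k : B ⟶ (b.e ⟶[V] c.e)} (hh : a.Homog b h) (hk : b.Homog c k) :
    a.Homog c ((h ⊗ₘ k) ≫ eComp V a.e b.e c.e) :=
  (Comma.homog_iff a c _).2 (homog_comp_aux g.mu (constFn (⟨i⟩ : FreeCat I))
    (etens (eId V a.e) (fel a.u)) (etens (eId V b.e) (fel b.u)) (etens (eId V c.e) (fel c.u))
    ((Comma.homog_iff a b h).1 hh) ((Comma.homog_iff b c k).1 hk))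

lemma Comma.Homog.precomp {a b : g.Comma i} {A B : V} {h : A ⟶ (a.e ⟶[V] b.e)}
    (hh : a.Homog b h) (f : B ⟶ A) : a.Homog b (f ≫ h) := by
  unfold Comma.Homog at *
  rw [Category.assoc, hh, Category.assoc]

section

variable [HasFiniteLimits V]

/-- The object of morphisms of `μ ↓ i`, defined by a pullback. -/
abbrev Comma.hom (a b : g.Comma i) : V := pullback (a.left b) (a.right b)

/-- The projection to `E(e,e')`. -/
abbrev Comma.fst (a b : g.Comma i) : a.hom b ⟶ (a.e ⟶[V] b.e) := pullback.fst _ _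

lemma Comma.snd_eq (a b : g.Comma i) :
    pullback.snd (a.left b) (a.right b) = a.fst b ≫ (ρ_ _).inv := by
  have h1 : ePost (g.p a.e) (fel (j := (⟨i⟩ : FreeCat I)) b.u) ≫ freeCounit V _ _ =
      freeCounit V _ _ :=
    free_hom_ext fun v => by
      rw [← Category.assoc, comp_ePost, eMul_fel, fel_freeCounit, fel_freeCounit]
  have hl : a.left b ≫ _ ◁ freeCounit V _ _ ≫ (ρ_ _).hom = 𝟙 _ := by
    rw [Comma.left, Category.assoc, ← MonoidalCategory.whiskerLeft_comp_assoc, h1, g.counit]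
  have hr : a.right b ≫ _ ◁ freeCounit V _ _ ≫ (ρ_ _).hom = (ρ_ _).hom := by
    rw [Comma.right, ← MonoidalCategory.whiskerLeft_comp_assoc, fel_freeCounit,
      MonoidalCategory.whiskerLeft_id, Category.id_comp]
  have := (pullback.condition (f := a.left b) (g := a.right b)) =≫
    (_ ◁ freeCounit V _ _ ≫ (ρ_ _).hom)
  rw [Category.assoc, Category.assoc, hl, hr, Category.comp_id] at this
  rw [Comma.fst, this, Category.assoc, Iso.hom_inv_id, Category.comp_id]

lemma Comma.homog_fst (a b : g.Comma i) : a.Homog b (a.fst b) := by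
  unfold Comma.Homog
  rw [pullback.condition, Comma.snd_eq, Category.assoc]

lemma Comma.hom_ext {a b : g.Comma i} {A : V} {h k : A ⟶ a.hom b}
    (w : h ≫ a.fst b = k ≫ a.fst b) : h = k := by
  refine pullback.hom_ext w ?_
  rw [Comma.snd_eq, reassoc_of% w]

/-- The factorization through `μ ↓ i`. -/
def Comma.lift (a b : g.Comma i) {A : V} (h : A ⟶ (a.e ⟶[V] b.e)) (hh : a.Homog b h) :
    A ⟶ a.hom b :=
  pullback.lift h (h ≫ (ρ_ _).inv) (hh.trans (Category.assoc _ _ _).symm)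

@[simp] lemma Comma.lift_fst (a b : g.Comma i) {A : V} (h : A ⟶ (a.e ⟶[V] b.e))
    (hh : a.Homog b h) : a.lift b h hh ≫ a.fst b = h :=
  pullback.lift_fst _ _ _

/-- The composition of `μ ↓ i`. -/
def Comma.mul (a b c : g.Comma i) : a.hom b ⊗ b.hom c ⟶ a.hom c :=
  a.lift c ((a.fst b ⊗ₘ b.fst c) ≫ eComp V a.e b.e c.e) ((a.homog_fst b).comp (b.homog_fst c))

@[simp] lemma Comma.mul_fst (a b c : g.Comma i) :
    a.mul b c ≫ a.fst c = (a.fst b ⊗ₘ b.fst c) ≫ eComp V a.e b.e c.e :=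
  a.lift_fst c _ _

/-- The `V`-category `μ ↓ i`. -/
instance Comma.category : EnrichedCategory V (g.Comma i) where
  Hom a b := a.hom b
  id a := a.lift a (eId V a.e) a.homog_id
  comp a b c := a.mul b c
  id_comp a b := Comma.hom_ext (by
    rw [Category.assoc, Category.assoc, Comma.mul_fst, ← tensorHom_id, ← Category.assoc (_ ⊗ₘ _),
      tensorHom_comp_tensorHom, Comma.lift_fst, Category.id_comp, MonoidalCategory.tensorHom_def', Category.assoc,
      ← leftUnitor_inv_naturality_assoc, e_id_comp, Category.comp_id])
  comp_id a b := Comma.hom_ext (by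
    rw [Category.assoc, Category.assoc, Comma.mul_fst, ← id_tensorHom, ← Category.assoc (_ ⊗ₘ _),
      tensorHom_comp_tensorHom, Comma.lift_fst, Category.id_comp, MonoidalCategory.tensorHom_def, Category.assoc,
      ← rightUnitor_inv_naturality_assoc, e_comp_id, Category.comp_id])
  assoc a b c d := Comma.hom_ext (by
    rw [Category.assoc, Category.assoc, Category.assoc, Comma.mul_fst, Comma.mul_fst,
      ← tensorHom_id, ← id_tensorHom, ← Category.assoc (_ ⊗ₘ _), tensorHom_comp_tensorHom,
      ← Category.assoc (_ ⊗ₘ _), tensorHom_comp_tensorHom, Comma.mul_fst, Comma.mul_fst,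
      Category.id_comp, Category.id_comp]
    have h1 : ((a.fst b ⊗ₘ b.fst c) ≫ eComp V a.e b.e c.e ⊗ₘ c.fst d) =
        ((a.fst b ⊗ₘ b.fst c) ⊗ₘ c.fst d) ≫ eComp V a.e b.e c.e ▷ _ := by
      rw [← tensorHom_id, tensorHom_comp_tensorHom, Category.comp_id]
    have h2 : (a.fst b ⊗ₘ (b.fst c ⊗ₘ c.fst d) ≫ eComp V b.e c.e d.e) =
        (a.fst b ⊗ₘ (b.fst c ⊗ₘ c.fst d)) ≫ _ ◁ eComp V b.e c.e d.e := by
      rw [← id_tensorHom, tensorHom_comp_tensorHom, Category.comp_id]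
    rw [h1, h2, Category.assoc, Category.assoc, ← associator_inv_naturality_assoc, e_assoc])

variable (g) in
/-- The `V`-functor `μ ↓ i ⟶ E` given by `(e, u) ↦ e`. -/
abbrev Comma.proj (i : I) : EnrichedFunctor V (g.Comma i) E where
  obj a := a.e
  map a b := a.fst b
  map_id a := a.lift_fst a (eId V a.e) a.homog_id
  map_comp a b c := a.mul_fst b c

end

end Grading

namespace Grading

lemma etens_eq {V : Type u} [Category.{v} V] [MonoidalCategory V] {A B : V} (a : 𝟙_ V ⟶ A)
    (b : 𝟙_ V ⟶ B) : etens a b = a ≫ (ρ_ A).inv ≫ A ◁ b := by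
  rw [etens, unitors_inv_equal, MonoidalCategory.tensorHom_def, rightUnitor_inv_naturality_assoc]

variable {V : Type u} [Category.{v} V] [MonoidalCategory V] [SymmetricCategory V]
  [CoproductMonoidal V] {I : Type v} [SmallCategory I] {E : Type v} [EnrichedCategory V E]
  {g : Grading (V := V) I E} {i j : I}

lemma Comma.homog_def (a b : g.Comma i) {A : V} (h : A ⟶ (a.e ⟶[V] b.e)) :
    a.Homog b h ↔ h ≫ g.coact a.e b.e ≫ _ ◁ ePost _ (fel (j := (⟨i⟩ : FreeCat I)) b.u) =
      h ≫ (ρ_ _).inv ≫ _ ◁ fel (j := (⟨i⟩ : FreeCat I)) a.u :=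
  Iff.rfl

/-- The action of `u : i ⟶ j` on the objects of `μ ↓ i`. -/
abbrev Comma.push (u : i ⟶ j) (a : g.Comma i) : g.Comma j := ⟨a.e, a.u ≫ u⟩

lemma Comma.Homog.push {a b : g.Comma i} {A : V} {h : A ⟶ (a.e ⟶[V] b.e)}
    (hh : a.Homog b h) (u : i ⟶ j) : (a.push u).Homog (b.push u) h := by
  have key := congrArg (· ≫ _ ◁ ePost (g.p a.e) (fel (V := V) (i := (⟨i⟩ : FreeCat I))
    (j := (⟨j⟩ : FreeCat I)) u)) ((Comma.homog_def a b h).1 hh)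
  simp only [Category.assoc, ← MonoidalCategory.whiskerLeft_comp, ← ePost_eMul, comp_ePost,
    eMul_fel] at key
  exact key

lemma homog_eId (e : E) {u u' : (g.p e).as ⟶ i} (h : u = u') :
    Comma.Homog (⟨e, u⟩ : g.Comma i) ⟨e, u'⟩ (eId V e) := by
  subst h
  exact Comma.homog_id _

variable [HasFiniteLimits V]

lemma Comma.id_fst (a : g.Comma i) : eId V a ≫ a.fst a = eId V a.e :=
  a.lift_fst a (eId V a.e) a.homog_id

lemma Comma.eMul_fst {a b c : g.Comma i} (s : 𝟙_ V ⟶ (a ⟶[V] b)) (t : 𝟙_ V ⟶ (b ⟶[V] c)) :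
    eMul s t ≫ a.fst c = eMul (s ≫ a.fst b) (t ≫ b.fst c) :=
  map_eMul (Comma.proj g i) s t

lemma Comma.ePost_fst (a : g.Comma i) {b c : g.Comma i} (s : 𝟙_ V ⟶ (b ⟶[V] c)) :
    ePost a s ≫ a.fst c = a.fst b ≫ ePost a.e (s ≫ b.fst c) :=
  map_ePost (Comma.proj g i) a s

lemma Comma.ePre_fst {a b : g.Comma i} (s : 𝟙_ V ⟶ (a ⟶[V] b)) (c : g.Comma i) :
    ePre s c ≫ a.fst c = b.fst c ≫ ePre (s ≫ a.fst b) c.e :=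
  map_ePre (Comma.proj g i) s c

/-- The morphism `(e, u) ⟶ (e, u')` of `μ ↓ i` for `u = u'`, given by the identity of `e`. -/
def can {e : E} {u u' : (g.p e).as ⟶ i} (h : u = u') :
    𝟙_ V ⟶ ((⟨e, u⟩ : g.Comma i) ⟶[V] ⟨e, u'⟩) :=
  Comma.lift _ _ (eId V e) (homog_eId e h)

lemma can_fst {e : E} {u u' : (g.p e).as ⟶ i} (h : u = u') :
    can h ≫ Comma.fst (⟨e, u⟩ : g.Comma i) ⟨e, u'⟩ = eId V e :=
  Comma.lift_fst _ _ _ _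

lemma can_rfl (a : g.Comma i) : can (rfl : a.u = a.u) = eId V a :=
  Comma.hom_ext ((can_fst _).trans (Comma.id_fst a).symm)

lemma eMul_can {e : E} {u u' u'' : (g.p e).as ⟶ i} (h : u = u') (h' : u' = u'') :
    eMul (can h) (can h') = can (g := g) (h.trans h') :=
  Comma.hom_ext (by rw [Comma.eMul_fst, can_fst, can_fst, can_fst, eMul_id])

/-- The `V`-functor `μ ↓ i ⟶ μ ↓ j` given by `u : i ⟶ j`. -/
abbrev shift (u : i ⟶ j) : EnrichedFunctor V (g.Comma i) (g.Comma j) where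
  obj a := a.push u
  map a b := Comma.lift (a.push u) (b.push u) (a.fst b) ((a.homog_fst b).push u)
  map_id a := Comma.hom_ext (by
    rw [Category.assoc, Comma.lift_fst, Comma.id_fst, Comma.id_fst])
  map_comp a b c := Comma.hom_ext (by
    have h1 : eComp V a b c ≫ a.fst c = (a.fst b ⊗ₘ b.fst c) ≫ eComp V a.e b.e c.e :=
      a.mul_fst b c
    have h2 : eComp V (a.push u) (b.push u) (c.push u) ≫ (a.push u).fst (c.push u) =
        ((a.push u).fst (b.push u) ⊗ₘ (b.push u).fst (c.push u)) ≫ eComp V a.e b.e c.e :=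
      (a.push u).mul_fst (b.push u) (c.push u)
    rw [Category.assoc, Comma.lift_fst, h1, Category.assoc, h2, tensorHom_comp_tensorHom_assoc,
      Comma.lift_fst, Comma.lift_fst])

lemma shift_fst (u : i ⟶ j) (a b : g.Comma i) :
    (shift u).map a b ≫ (a.push u).fst (b.push u) = a.fst b :=
  Comma.lift_fst _ _ _ ((a.homog_fst b).push u)

lemma can_shift {e : E} {w w' : (g.p e).as ⟶ i} (h : w = w') (u : i ⟶ j) :
    can h ≫ (shift u).map _ _ = can (g := g) (e := e) (congrArg (· ≫ u) h) :=
  Comma.hom_ext (by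
    rw [Category.assoc]
    exact (congrArg (can h ≫ ·) (shift_fst u _ _)).trans ((can_fst h).trans (can_fst _).symm))

lemma can_naturality {e e' : E} {u u' : (g.p e).as ⟶ i} {w w' : (g.p e').as ⟶ i} (h : u = u')
    (h' : w = w') {A : V} (s : A ⟶ ((⟨e, u⟩ : g.Comma i) ⟶[V] ⟨e', w⟩))
    (t : A ⟶ ((⟨e, u'⟩ : g.Comma i) ⟶[V] ⟨e', w'⟩))
    (hst : s ≫ Comma.fst ⟨e, u⟩ ⟨e', w⟩ = t ≫ Comma.fst ⟨e, u'⟩ ⟨e', w'⟩) :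
    s ≫ ePost _ (can h') = t ≫ ePre (can h) _ :=
  Comma.hom_ext (by
    rw [Category.assoc, Comma.ePost_fst, can_fst, ePost_id, Category.comp_id, Category.assoc,
      Comma.ePre_fst, can_fst, ePre_id, Category.comp_id, hst])

variable (g)

/-- The component at `u` of the action of the 2-morphisms `u ⟹ u'`, for `u = u'`. -/
def shiftEq {i j : I} {u u' : i ⟶ j} (h : u = u') :
    VNatTrans (shift (g := g) u) (shift u') where
  app a := can (congrArg (a.u ≫ ·) h)
  naturality a b := can_naturality _ _ _ _ ((shift_fst u a b).trans (shift_fst u' a b).symm)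

/-- The equality of `V`-functors `(1_i)_* = 1`. -/
def shiftId (i : I) : VNatTrans (shift (g := g) (𝟙 i)) (vid (g.Comma i)) where
  app a := can (Category.comp_id a.u)
  naturality a b := can_naturality _ _ _ _ ((shift_fst (𝟙 i) a b).trans (Category.id_comp _).symm)

/-- The equality of `V`-functors `(u' ∘ u)_* = u'_* ∘ u_*`. -/
def shiftComp {i j k : I} (u : i ⟶ j) (u' : j ⟶ k) :
    VNatTrans (shift (g := g) (u ≫ u')) (vcomp (shift u) (shift u')) where
  app a := can (Category.assoc a.u u u').symm
  naturality a b := can_naturality _ _ _ _ (by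
    have h1 := shift_fst u' (a.push u) (b.push u)
    rw [Category.assoc, h1, shift_fst, shift_fst])

end Grading

namespace Smash

open Grading
open scoped Oplax.LaxTrans Oplax.LaxTrans.OplaxFunctor

variable {V : Type u} [Category.{v} V] [MonoidalCategory V] [SymmetricCategory V]
  [CoproductMonoidal V] {I : Type v} [SmallCategory I]

section

variable {E E' : GradedCat V I} (F : GradedCat.Hom E E') {i j : I}

/-- The action of a left morphism on the objects of the comma categories,
`(e, u) ↦ (F(e), u ∘ φ₂(e))`. -/
abbrev onObj (a : E.gr.Comma i) : E'.gr.Comma i := ⟨F.fn.obj a.e, F.deg a.e ≫ a.u⟩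

lemma homog_map {a b : E.gr.Comma i} {A : V} {h : A ⟶ (a.e ⟶[V] b.e)} (hh : a.Homog b h) :
    (onObj F a).Homog (onObj F b) (h ≫ F.fn.map a.e b.e) := by
  have h1 := (Comma.homog_def a b h).1 hh
  have h2 := F.nat a.e b.e
  have key : (h ≫ F.fn.map a.e b.e) ≫ E'.gr.coact _ _ ≫ _ ◁ ePost _
        (eMul (fel (F.deg b.e)) (fel (j := (⟨i⟩ : FreeCat I)) b.u)) =
      (h ≫ F.fn.map a.e b.e) ≫ (ρ_ _).inv ≫
        _ ◁ (eMul (fel (F.deg a.e)) (fel (j := (⟨i⟩ : FreeCat I)) a.u)) := by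
    rw [ePost_eMul, MonoidalCategory.whiskerLeft_comp, Category.assoc, reassoc_of% h2]
    have h3 : (F.fn.map a.e b.e ⊗ₘ ePre (fel (F.deg a.e)) (E.gr.p b.e)) ≫
        _ ◁ ePost _ (fel (j := (⟨i⟩ : FreeCat I)) b.u) =
        _ ◁ ePost _ (fel (j := (⟨i⟩ : FreeCat I)) b.u) ≫
          (F.fn.map a.e b.e ⊗ₘ ePre (fel (F.deg a.e)) _) := by
      simp only [← id_tensorHom, tensorHom_comp_tensorHom, Category.comp_id, Category.id_comp,
        ePre_ePost]
    rw [h3, reassoc_of% h1, ← id_tensorHom, tensorHom_comp_tensorHom, comp_ePre, Category.id_comp,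
      MonoidalCategory.tensorHom_def, ← rightUnitor_inv_naturality_assoc, Category.assoc]
  rw [eMul_fel, eMul_fel] at key
  exact key

lemma homog_trans {F G : GradedCat.Hom E E'} (ξ : GradedCat.Hom₂ F G) (a : E.gr.Comma i) :
    (onObj F a).Homog (onObj G a) (ξ.nt.app a.e) := by
  have h := ξ.comm' a.e
  have key : ξ.nt.app a.e ≫ E'.gr.coact _ _ ≫ _ ◁ ePost _
        (eMul (fel (G.deg a.e)) (fel (j := (⟨i⟩ : FreeCat I)) a.u)) =
      ξ.nt.app a.e ≫ (ρ_ _).inv ≫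
        _ ◁ (eMul (fel (F.deg a.e)) (fel (j := (⟨i⟩ : FreeCat I)) a.u)) := by
    rw [ePost_eMul, MonoidalCategory.whiskerLeft_comp, reassoc_of% h, etens_whiskerLeft,
      comp_ePost, etens_eq]
  rw [eMul_fel, eMul_fel] at key
  exact key

end
variable [HasFiniteLimits V]

/-- The smash product oplax functor `Γ(μ) : i ↦ μ ↓ i` of a graded `V`-category. -/
def obj (E : GradedCat V I) : OplaxFunctor (LocallyDiscrete I) (VCat V) where
  obj i := ⟨E.gr.Comma i.as⟩
  map u := shift u.as
  map₂ σ := shiftEq E.gr (congrArg Discrete.as (LocallyDiscrete.eq_of_hom σ))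
  map₂_id {i _} _ := hom_ext fun (a : E.gr.Comma i.as) => can_rfl (a.push _)
  map₂_comp {i _ u u' u''} σ τ := hom_ext fun (a : E.gr.Comma i.as) =>
    (eMul_can (congrArg (fun t => a.u ≫ Discrete.as t) (LocallyDiscrete.eq_of_hom σ))
      (congrArg (fun t => a.u ≫ Discrete.as t) (LocallyDiscrete.eq_of_hom τ))).symm
  mapId i := shiftId E.gr i.as
  mapComp u u' := shiftComp E.gr u.as u'.as
  mapComp_naturality_left {i j k u u'} σ v := hom_ext fun (a : E.gr.Comma i.as) => by
    obtain rfl := LocallyDiscrete.eq_of_hom σ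
    have key : eMul (can (g := E.gr) (i := k.as) (e := a.e) rfl)
        (can (Category.assoc a.u u.as v.as).symm) =
        eMul (can (Category.assoc a.u u.as v.as).symm)
          (can (u := a.u ≫ u.as) rfl ≫ (shift v.as).map _ _) := by
      rw [can_shift, eMul_can, eMul_can]
    exact key
  mapComp_naturality_right {i j k} u v v' σ := hom_ext fun (a : E.gr.Comma i.as) => by
    obtain rfl := LocallyDiscrete.eq_of_hom σ
    have key : eMul (can (g := E.gr) (i := k.as) (e := a.e) rfl)
        (can (Category.assoc a.u u.as v.as).symm) =
        eMul (can (Category.assoc a.u u.as v.as).symm) (can rfl) := by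
      rw [eMul_can, eMul_can]
    exact key
  map₂_associator {i j k l} u v w := hom_ext fun (a : E.gr.Comma i.as) => by
    have key : eMul (can (g := E.gr) (i := l.as) (e := a.e)
          (congrArg (a.u ≫ ·) (Category.assoc u.as v.as w.as)))
        (eMul (can (Category.assoc a.u u.as (v.as ≫ w.as)).symm)
          (can (Category.assoc (a.u ≫ u.as) v.as w.as).symm)) =
        eMul (can (Category.assoc a.u (u.as ≫ v.as) w.as).symm)
          (eMul (can (Category.assoc a.u u.as v.as).symm ≫ (shift w.as).map _ _)
            (eId V _)) := by
      rw [eMul_id, can_shift, eMul_can, eMul_can, eMul_can]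
    exact key
  map₂_leftUnitor {i j} u := hom_ext fun (a : E.gr.Comma i.as) => by
    have key : can (g := E.gr) (i := j.as) (e := a.e)
          (congrArg (a.u ≫ ·) (Category.id_comp u.as)) =
        eMul (can (Category.assoc a.u (𝟙 _) u.as).symm)
          (eMul (can (Category.comp_id a.u) ≫ (shift u.as).map _ _) (eId V _)) := by
      rw [eMul_id, can_shift, eMul_can]
    exact key
  map₂_rightUnitor {i j} u := hom_ext fun (a : E.gr.Comma i.as) => by
    have key : can (g := E.gr) (i := j.as) (e := a.e)
          (congrArg (a.u ≫ ·) (Category.comp_id u.as)) =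
        eMul (can (Category.assoc a.u u.as (𝟙 _)).symm)
          (eMul (can (Category.comp_id (a.u ≫ u.as))) (eId V _)) := by
      rw [eMul_id, eMul_can]
    exact key

section Functoriality

variable {E E' : GradedCat V I} (F : GradedCat.Hom E E') {i j : I}

/-- The `V`-functor `μ ↓ i ⟶ μ' ↓ i` given by a left morphism. -/
abbrev functor (i : I) : EnrichedFunctor V (E.gr.Comma i) (E'.gr.Comma i) where
  obj a := onObj F a
  map a b := Comma.lift (onObj F a) (onObj F b) (a.fst b ≫ F.fn.map a.e b.e)
    (homog_map F (a.homog_fst b))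
  map_id a := Comma.hom_ext (by
    have h := F.fn.map_id a.e
    rw [Category.assoc, Comma.lift_fst, Comma.id_fst, ← Category.assoc, Comma.id_fst, h])
  map_comp a b c := Comma.hom_ext (by
    have h := F.fn.map_comp a.e b.e c.e
    have h1 : eComp V a b c ≫ a.fst c = (a.fst b ⊗ₘ b.fst c) ≫ eComp V a.e b.e c.e :=
      a.mul_fst b c
    have h2 : eComp V (onObj F a) (onObj F b) (onObj F c) ≫ (onObj F a).fst (onObj F c) =
        ((onObj F a).fst (onObj F b) ⊗ₘ (onObj F b).fst (onObj F c)) ≫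
          eComp V (F.fn.obj a.e) (F.fn.obj b.e) (F.fn.obj c.e) :=
      (onObj F a).mul_fst (onObj F b) (onObj F c)
    rw [Category.assoc, Comma.lift_fst, ← Category.assoc, h1, Category.assoc, h, Category.assoc,
      h2, tensorHom_comp_tensorHom_assoc, tensorHom_comp_tensorHom_assoc,
      Comma.lift_fst, Comma.lift_fst])

lemma functor_fst (a b : E.gr.Comma i) :
    (functor F i).map a b ≫ (onObj F a).fst (onObj F b) = a.fst b ≫ F.fn.map a.e b.e :=
  Comma.lift_fst _ _ _ (homog_map F (a.homog_fst b))

lemma can_functor {e : E.cat} {u u' : (E.gr.p e).as ⟶ i} (h : u = u') :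
    can h ≫ (functor F i).map _ _ =
      can (g := E'.gr) (e := F.fn.obj e) (congrArg (F.deg e ≫ ·) h) :=
  Comma.hom_ext (by
    have h1 := functor_fst F (⟨e, u⟩ : E.gr.Comma i) ⟨e, u'⟩
    have h2 := can_fst h (g := E.gr)
    rw [Category.assoc]
    refine (congrArg (can h ≫ ·) h1).trans ?_
    have h3 : can h ≫ Comma.fst (⟨e, u⟩ : E.gr.Comma i) ⟨e, u'⟩ ≫ F.fn.map e e =
        eId V (F.fn.obj e) := by
      rw [reassoc_of% h2, F.fn.map_id]
    exact h3.trans (can_fst _).symm)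

/-- The equality of `V`-functors `u_* ∘ Γ(F)(i) = Γ(F)(j) ∘ u_*`. -/
def mapNat (u : i ⟶ j) :
    VNatTrans (vcomp (functor F i) (shift u)) (vcomp (shift u) (functor F j)) where
  app a := can (Category.assoc (F.deg a.e) a.u u)
  naturality a b := can_naturality _ _ _ _ (by
    have h1 := shift_fst u (onObj F a) (onObj F b)
    have h2 := functor_fst F (a.push u) (b.push u)
    have h3 := functor_fst F a b
    have h4 : ((functor F i).map a b ≫ (shift u).map (onObj F a) (onObj F b)) ≫
          ((onObj F a).push u).fst ((onObj F b).push u) =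
        ((shift u).map a b ≫ (functor F j).map (a.push u) (b.push u)) ≫
          (onObj F (a.push u)).fst (onObj F (b.push u)) := by
      rw [Category.assoc, h1, h3, Category.assoc, h2, reassoc_of% (shift_fst u a b)]
    exact h4)

/-- The left transformation `Γ(F, φ)`. -/
def map (F : E ⟶ E') : obj E ⟶ obj E' where
  app i := functor F i.as
  naturality u := mapNat F u.as
  naturality_naturality {i j u u'} σ := hom_ext fun (a : E.gr.Comma i.as) => by
    obtain rfl := LocallyDiscrete.eq_of_hom σ
    have key : eMul (can (g := E'.gr) (i := j.as) (Category.assoc (GradedCat.Hom.deg F a.e) a.u u.as))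
        (can (u := a.u ≫ u.as) rfl ≫ (functor F j.as).map _ _) =
        eMul (can rfl) (can (Category.assoc (GradedCat.Hom.deg F a.e) a.u u.as)) := by
      rw [can_functor, eMul_can, eMul_can]
    exact key
  naturality_id i := hom_ext fun (a : E.gr.Comma i.as) => by
    have key : eMul (can (g := E'.gr) (i := i.as)
          (Category.assoc (GradedCat.Hom.deg F a.e) a.u (𝟙 _)))
        (can (Category.comp_id a.u) ≫ (functor F i.as).map _ _) =
        eMul (can (Category.comp_id (GradedCat.Hom.deg F a.e ≫ a.u)))
          (eMul (eId V _) (eId V _)) := by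
      rw [can_functor, eMul_can, eMul_id, eMul_id]
    exact key
  naturality_comp {i j k} u v := hom_ext fun (a : E.gr.Comma i.as) => by
    have key : eMul (can (g := E'.gr) (i := k.as)
          (Category.assoc (GradedCat.Hom.deg F a.e) a.u (u.as ≫ v.as)))
        (can (Category.assoc a.u u.as v.as).symm ≫ (functor F k.as).map _ _) =
        eMul (can (Category.assoc (GradedCat.Hom.deg F a.e ≫ a.u) u.as v.as).symm)
          (eMul (eId V _) (eMul
            (can (Category.assoc (GradedCat.Hom.deg F a.e) a.u u.as) ≫ (shift v.as).map _ _)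
            (eMul (eId V _) (eMul
              (can (Category.assoc (GradedCat.Hom.deg F a.e) (a.u ≫ u.as) v.as)) (eId V _))))) := by
      rw [can_functor, can_shift, eMul_id, id_eMul, id_eMul, eMul_can, eMul_can, eMul_can]
    exact key

variable {F} {G : GradedCat.Hom E E'} (ξ : GradedCat.Hom₂ F G)

/-- The component at `(e, u)` of `Γ(ξ)(i)`. -/
def tapp (a : E.gr.Comma i) : 𝟙_ V ⟶ (onObj F a ⟶[V] onObj G a) :=
  Comma.lift (onObj F a) (onObj G a) (ξ.nt.app a.e) (homog_trans ξ a)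

lemma tapp_fst (a : E.gr.Comma i) : tapp ξ a ≫ (onObj F a).fst (onObj G a) = ξ.nt.app a.e :=
  Comma.lift_fst _ _ _ (homog_trans ξ a)

/-- The `V`-natural transformation `Γ(ξ)(i)`. -/
def trans (i : I) : VNatTrans (functor F i) (functor G i) where
  app a := tapp ξ a
  naturality a b := Comma.hom_ext (by
    have h := ξ.nt.naturality a.e b.e
    rw [Category.assoc, Comma.ePost_fst, reassoc_of% (functor_fst F a b), tapp_fst, Category.assoc,
      Comma.ePre_fst, reassoc_of% (functor_fst G a b), tapp_fst, h])

/-- The modification `Γ(ξ)`. -/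
def map₂ {F G : E ⟶ E'} (ξ : F ⟶ G) : map F ⟶ map G where
  as :=
    { app i := trans ξ i.as
      naturality {i j} u := hom_ext fun (a : E.gr.Comma i.as) => by
        have key : eMul (tapp ξ a ≫ (shift u.as).map _ _)
              (can (Category.assoc (GradedCat.Hom.deg G a.e) a.u u.as)) =
            eMul (can (Category.assoc (GradedCat.Hom.deg F a.e) a.u u.as))
              (tapp ξ (a.push u.as)) :=
          Comma.hom_ext (by
            rw [Comma.eMul_fst, Comma.eMul_fst, can_fst, can_fst, tapp_fst, Category.assoc,
              shift_fst, tapp_fst, eMul_id, id_eMul])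
        exact key }

end Functoriality

variable (V I) in
/-- The smash product construction `Γ`, from graded `V`-categories to oplax functors, left
transformations and modifications. -/
def pre : PrelaxFunctor (GradedCat V I) (OplaxFunctor (LocallyDiscrete I) (VCat V)) where
  obj E := obj E
  map F := map F
  map₂ ξ := map₂ ξ
  map₂_id {E E'} F := Oplax.LaxTrans.homCategory.ext fun i =>
    hom_ext fun (a : E.gr.Comma i.as) => by
      have key : tapp (GradedCat.Hom₂.id F) a = eId V (onObj F a) :=
        Comma.hom_ext (by rw [tapp_fst, Comma.id_fst]; rfl)
      exact key
  map₂_comp {E E' F G H} ξ ζ := Oplax.LaxTrans.homCategory.ext fun i =>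
    hom_ext fun (a : E.gr.Comma i.as) => by
      have key : tapp (GradedCat.Hom₂.comp ξ ζ) a = eMul (tapp ξ a) (tapp ζ a) :=
        Comma.hom_ext (by rw [Comma.eMul_fst, tapp_fst, tapp_fst, tapp_fst]; rfl)
      exact key

end Smash

/-! ### The two constructions as 2-functors -/

section Strictness

lemma enrichedFunctor_ext {V : Type u} [Category.{v} V] [MonoidalCategory V] {C D : Type w}
    [EnrichedCategory V C] [EnrichedCategory V D] {F G : EnrichedFunctor V C D}
    (h : ∀ x, F.obj x = G.obj x) (h' : ∀ x y, HEq (F.map x y) (G.map x y)) : F = G := by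
  obtain ⟨f, m, _, _⟩ := F
  obtain ⟨f', m', _, _⟩ := G
  obtain rfl : f = f' := funext h
  obtain rfl : m = m' := funext fun x => funext fun y => eq_of_heq (h' x y)
  rfl

lemma vNatTrans_heq {V : Type u} [Category.{v} V] [MonoidalCategory V] {C D : Type w}
    [EnrichedCategory V C] [EnrichedCategory V D] {F G F' G' : EnrichedFunctor V C D}
    (hF : F = F') (hG : G = G') {α : VNatTrans F G} {β : VNatTrans F' G'}
    (h : ∀ x, HEq (α.app x) (β.app x)) : HEq α β := by
  subst hF hG
  exact heq_of_eq (VNatTrans.ext (funext fun x => eq_of_heq (h x)))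

variable {V : Type u} [Category.{v} V] [MonoidalCategory V]

section

variable [SymmetricCategory V] [CoproductMonoidal V] {I : Type v} [SmallCategory I]

lemma GradedCat.Hom₂.heq {E E' : GradedCat V I} {F G F' G' : GradedCat.Hom E E'}
    (hF : F = F') (hG : G = G') {ξ : GradedCat.Hom₂ F G} {ζ : GradedCat.Hom₂ F' G'}
    (h : ∀ x, HEq (ξ.nt.app x) (ζ.nt.app x)) : HEq ξ ζ := by
  subst hF hG
  exact heq_of_eq (GradedCat.Hom₂.ext (VNatTrans.ext (funext fun x => eq_of_heq (h x))))

end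

open scoped Oplax.LaxTrans Oplax.LaxTrans.OplaxFunctor

lemma eqToHom_conj {C : Type*} [Category* C] {a b c d : C} (h : a = b) (h' : c = d) {f : a ⟶ d}
    {g : b ⟶ c} (w : HEq f g) : f = eqToHom h ≫ g ≫ eqToHom h' := by
  subst h h'
  simpa using w

lemma eqToHom_conj' {C : Type*} [Category* C] {a b c : C} (h : a = b) {f : a ⟶ c}
    {g : b ⟶ c} (w : HEq f g) : f = eqToHom h ≫ g := by
  subst h
  simpa using w

namespace Gr

open Opl

variable {I : Type v} [SmallCategory I] {X Y Z : OplaxFunctor (LocallyDiscrete I) (VCat V)}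

lemma φ_id' (X : OplaxFunctor (LocallyDiscrete I) (VCat V)) {i j : I} (u : i ⟶ j) (x : ob X i) :
    φ (𝟙 X : X ⟶ X) u x = eId V ((fn X u).obj x) :=
  eMul_id (eId V ((fn X u).obj x))

lemma φ_comp' (F : X ⟶ Y) (G : Y ⟶ Z) {i j : I} (u : i ⟶ j) (x : ob X i) :
    φ (F ≫ G) u x =
      eMul (φ G u ((tfn F i).obj x)) (φ F u x ≫ (tfn G j).map _ _) := by
  have key : φ (F ≫ G) u x = eMul (eId V _) (eMul (φ G u ((tfn F i).obj x))
      (eMul (eId V _) (eMul (φ F u x ≫ (tfn G j).map _ _) (eId V _)))) := rfl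
  rw [key, id_eMul, id_eMul, eMul_id]

variable [CoproductMonoidal V]

lemma onHom_id (a b : Obj X) : onHom (𝟙 X : X ⟶ X) a b = 𝟙 (a ⟶[V] b) :=
  category_hom_ext fun u => by
    have key : inj a b u ≫ onHom (𝟙 X : X ⟶ X) a b = inj a b u ≫ 𝟙 (a ⟶[V] b) := by
      rw [inj_onHom, onComp, φ_id', Category.comp_id]
      have h : (𝟙 (comp a b u) ≫ ePre (eId V ((fn X u).obj a.x)) b.x) ≫ inj a b u =
          inj a b u := by
        rw [ePre_id, Category.id_comp, Category.id_comp]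
      exact h
    exact key

lemma onHom_comp (F : X ⟶ Y) (G : Y ⟶ Z) (a b : Obj X) :
    onHom (F ≫ G) a b = onHom F a b ≫ onHom G (onObj F a) (onObj F b) :=
  category_hom_ext fun u => by
    have h1 := map_ePre (tfn G b.i) (φ F u a.x) ((tfn F b.i).obj b.x)
    have h2 : onComp (F ≫ G) a b u = onComp F a b u ≫ onComp G (onObj F a) (onObj F b) u := by
      have h3 : onComp (F ≫ G) a b u = ((tfn F b.i).map _ _ ≫ (tfn G b.i).map _ _) ≫
        ePre (φ (F ≫ G) u a.x) ((tfn G b.i).obj ((tfn F b.i).obj b.x)) := rfl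
      have h4 : ((tfn F b.i).map ((fn X u).obj a.x) b.x ≫ (tfn G b.i).map _ _) ≫
          ePre (eMul (φ G u ((tfn F a.i).obj a.x)) (φ F u a.x ≫ (tfn G b.i).map _ _))
            ((tfn G b.i).obj ((tfn F b.i).obj b.x)) =
          onComp F a b u ≫ onComp G (onObj F a) (onObj F b) u := by
        rw [ePre_eMul, onComp, onComp, Category.assoc, Category.assoc, reassoc_of% h1]
      rw [h3, φ_comp']
      exact h4
    have key : inj a b u ≫ onHom (F ≫ G) a b =
        inj a b u ≫ onHom F a b ≫ onHom G (onObj F a) (onObj F b) := by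
      rw [inj_onHom, h2, ← Category.assoc (inj a b u), inj_onHom, Category.assoc, inj_onHom,
        ← Category.assoc]
      rfl
    exact key

lemma lift_onHom (F : X ⟶ Y) {i : I} {x x' : ob X i} (s : 𝟙_ V ⟶ (x ⟶[V] x')) :
    lift s ≫ onHom F ⟨i, x⟩ ⟨i, x'⟩ = lift (s ≫ (tfn F i).map x x') := by
  have h1 := map_eMul (tfn F i) (η X i x) s
  have key : eMul (η X i x) s ≫ onComp F ⟨i, x⟩ ⟨i, x'⟩ (𝟙 i) =
      eMul (η Y i ((tfn F i).obj x)) (s ≫ (tfn F i).map x x') := by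
    rw [onComp, ← Category.assoc, h1, comp_ePre, ← eMul_assoc, φ_id]
  rw [lift, Category.assoc, inj_onHom, ← Category.assoc, key]
  rfl

variable [SymmetricCategory V]

lemma grMap_id (X : OplaxFunctor (LocallyDiscrete I) (VCat V)) : grMap (𝟙 X) = 𝟙 (gr X) :=
  GradedCat.Hom.ext' (E := gr X) (E' := gr X) (enrichedFunctor_ext (fun _ => rfl)
    fun a b => heq_of_eq (onHom_id a b)) HEq.rfl

lemma grMap_comp (F : X ⟶ Y) (G : Y ⟶ Z) : grMap (F ≫ G) = grMap F ≫ grMap G :=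
  GradedCat.Hom.ext' (E := gr X) (E' := gr Z) (enrichedFunctor_ext (fun _ => rfl)
    fun a b => heq_of_eq (onHom_comp F G a b))
    (heq_of_eq (funext fun (a : Obj X) => (Category.comp_id (𝟙 a.i)).symm))

variable (V I) in
/-- The 2-functor `Gr` from oplax functors, left transformations and modifications to graded
`V`-categories. -/
def twoFunctor : StrictPseudofunctor (OplaxFunctor (LocallyDiscrete I) (VCat V)) (GradedCat V I) :=
  StrictPseudofunctor.mk'
    { pre V I with
      map_id := grMap_id
      map_comp := grMap_comp
      map₂_whisker_left := fun _ _ _ _ => eqToHom_conj _ _ <|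
        GradedCat.Hom₂.heq (grMap_comp _ _) (grMap_comp _ _) fun _ => HEq.rfl
      map₂_whisker_right := fun {X _ _ _ _} Θ G => eqToHom_conj _ _ <|
        GradedCat.Hom₂.heq (grMap_comp _ _) (grMap_comp _ _) fun (a : Obj X) =>
          heq_of_eq (lift_onHom G (mapp Θ.as a.i a.x)).symm
      map₂_left_unitor := fun {X _} F => eqToHom_conj' _ <|
        GradedCat.Hom₂.heq ((grMap_comp _ _).trans (congrArg (· ≫ grMap F) (grMap_id X))) rfl fun _ => heq_of_eq (lift_id _)
      map₂_right_unitor := fun {_ Y} F => eqToHom_conj' _ <|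
        GradedCat.Hom₂.heq ((grMap_comp _ _).trans (congrArg (grMap F ≫ ·) (grMap_id Y))) rfl fun _ => heq_of_eq (lift_id _)
      map₂_associator := fun F G H => eqToHom_conj _ _ <|
        GradedCat.Hom₂.heq
          ((grMap_comp _ _).trans (congrArg (· ≫ grMap H) (grMap_comp F G)))
          ((grMap_comp _ _).trans (congrArg (grMap F ≫ ·) (grMap_comp G H))) fun _ => heq_of_eq (lift_id _) }

end Gr

lemma laxTrans_ext {B C : Type*} [Bicategory B] [Bicategory C] {X Y : OplaxFunctor B C}
    {F G : X ⟶ Y} (h : ∀ i, F.app i = G.app i)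
    (h' : ∀ (i j : B) (u : i ⟶ j), HEq (F.naturality u) (G.naturality u)) : F = G := by
  obtain ⟨f, m, _, _, _⟩ := F
  obtain ⟨f', m', _, _, _⟩ := G
  obtain rfl : f = f' := funext h
  obtain rfl : @m = @m' := funext fun i => funext fun j => funext fun u => eq_of_heq (h' i j u)
  rfl

lemma modification_heq {B C : Type*} [Bicategory B] [Bicategory C] {X Y : OplaxFunctor B C}
    {F G F' G' : X ⟶ Y} (hF : F = F') (hG : G = G') {Θ : F ⟶ G} {Ξ : F' ⟶ G'}
    (h : ∀ i, HEq (Θ.as.app i) (Ξ.as.app i)) : HEq Θ Ξ := by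
  subst hF hG
  exact heq_of_eq (Oplax.LaxTrans.homCategory.ext fun i => eq_of_heq (h i))

namespace Smash

open Grading

variable [SymmetricCategory V] [CoproductMonoidal V] {I : Type v} [SmallCategory I]

lemma comma_ext {E : Type v} [EnrichedCategory V E] {g : Grading (V := V) I E} {i : I} {e : E}
    {u u' : (g.p e).as ⟶ i} (h : u = u') : (⟨e, u⟩ : g.Comma i) = ⟨e, u'⟩ := by
  rw [h]

variable {E E' E'' : GradedCat V I}

lemma onObj_comp₃ {E''' : GradedCat V I} (F : GradedCat.Hom E E') (G : GradedCat.Hom E' E'')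
    (H : GradedCat.Hom E'' E''') {i : I} (a : E.gr.Comma i) :
    onObj (GradedCat.Hom.comp (GradedCat.Hom.comp F G) H) a = onObj H (onObj G (onObj F a)) :=
  comma_ext (((Category.assoc _ _ _).trans (congrArg (H.deg _ ≫ ·) (Category.assoc _ _ _))))

lemma onObj_comp₃' {E''' : GradedCat V I} (F : GradedCat.Hom E E') (G : GradedCat.Hom E' E'')
    (H : GradedCat.Hom E'' E''') {i : I} (a : E.gr.Comma i) :
    onObj (GradedCat.Hom.comp F (GradedCat.Hom.comp G H)) a = onObj H (onObj G (onObj F a)) :=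
  comma_ext ((Category.assoc _ _ _).trans (Category.assoc _ _ _))

variable [HasFiniteLimits V]

lemma comma_heq {E : Type v} [EnrichedCategory V E] {g : Grading (V := V) I E} {i : I}
    {a b a' b' : g.Comma i} (ha : a = a') (hb : b = b') {A : V} {h : A ⟶ (a ⟶[V] b)}
    {h' : A ⟶ (a' ⟶[V] b')} (w : HEq (h ≫ a.fst b) (h' ≫ a'.fst b')) : HEq h h' := by
  subst ha hb
  exact heq_of_eq (Comma.hom_ext (eq_of_heq w))

lemma functor_id (E : GradedCat V I) (i : I) :
    functor (GradedCat.Hom.id E) i = vid (E.gr.Comma i) :=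
  enrichedFunctor_ext (fun _ => comma_ext (Category.id_comp _)) fun a b =>
    comma_heq (comma_ext (Category.id_comp _)) (comma_ext (Category.id_comp _))
      (heq_of_eq ((functor_fst (GradedCat.Hom.id E) a b).trans
        ((Category.comp_id _).trans (Category.id_comp _).symm)))

lemma functor_comp (F : GradedCat.Hom E E') (G : GradedCat.Hom E' E'') (i : I) :
    functor (GradedCat.Hom.comp F G) i = vcomp (functor F i) (functor G i) :=
  enrichedFunctor_ext (fun _ => comma_ext (Category.assoc _ _ _)) fun a b =>
    comma_heq (comma_ext (Category.assoc _ _ _)) (comma_ext (Category.assoc _ _ _)) (heq_of_eq (by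
      have h1 := functor_fst (GradedCat.Hom.comp F G) a b
      have h2 : ((functor F i).map a b ≫ (functor G i).map (onObj F a) (onObj F b)) ≫
          (onObj G (onObj F a)).fst (onObj G (onObj F b)) =
          a.fst b ≫ F.fn.map a.e b.e ≫ G.fn.map _ _ := by
        rw [Category.assoc, functor_fst, reassoc_of% (functor_fst F a b)]
      exact h1.trans h2.symm))

lemma map_id (E : GradedCat V I) : map (𝟙 E) = 𝟙 (obj E) :=
  laxTrans_ext (fun i => functor_id E i.as) fun i j u =>
    vNatTrans_heq (congrArg (vcomp · (shift u.as)) (functor_id E i.as))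
      (congrArg (vcomp (shift u.as) ·) (functor_id E j.as)) fun (a : E.gr.Comma i.as) => by
        have key : HEq (can (g := E.gr) (Category.assoc (𝟙 _) a.u u.as))
            (eMul (V := V) (eId V (a.push u.as)) (eId V (a.push u.as))) :=
          comma_heq (comma_ext (by rw [Category.id_comp])) (comma_ext (Category.id_comp _))
            (heq_of_eq ((can_fst _).trans (by rw [eMul_id, Comma.id_fst])))
        exact key

lemma map_comp (F : E ⟶ E') (G : E' ⟶ E'') : map (F ≫ G) = map F ≫ map G :=
  laxTrans_ext (fun i => functor_comp F G i.as) fun i j u =>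
    vNatTrans_heq (congrArg (vcomp · (shift u.as)) (functor_comp F G i.as))
      (congrArg (vcomp (shift u.as) ·) (functor_comp F G j.as)) fun (a : E.gr.Comma i.as) => by
        have key : HEq (can (g := E''.gr)
              (Category.assoc (GradedCat.Hom.deg G _ ≫ GradedCat.Hom.deg F a.e) a.u u.as))
            (eMul (eId V _) (eMul
              (can (g := E''.gr) (Category.assoc (GradedCat.Hom.deg G _)
                (GradedCat.Hom.deg F a.e ≫ a.u) u.as))
              (eMul (eId V _) (eMul
                (can (Category.assoc (GradedCat.Hom.deg F a.e) a.u u.as) ≫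
                  (functor G j.as).map _ _)
                (eId V _))))) :=
          comma_heq (comma_ext (by simp)) (comma_ext (by simp))
            (heq_of_eq ((can_fst _).trans (by
              rw [eMul_id, id_eMul, id_eMul, can_functor, eMul_can, can_fst])))
        exact key

variable (V I) in
/-- The 2-functor `Γ` from graded `V`-categories to oplax functors, left transformations and
modifications. -/
def twoFunctor : StrictPseudofunctor (GradedCat V I) (OplaxFunctor (LocallyDiscrete I) (VCat V)) :=
  StrictPseudofunctor.mk'
    { pre V I with
      map_id := map_id
      map_comp := map_comp
      map₂_whisker_left := fun {E _ _} F _ _ ξ => eqToHom_conj _ _ <|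
        modification_heq (map_comp _ _) (map_comp _ _) fun i => vNatTrans_heq
          (functor_comp _ _ _) (functor_comp _ _ _) fun (a : E.gr.Comma i.as) => by
            have key : HEq (tapp (GradedCat.Hom₂.whiskerL F ξ) a) (tapp ξ (onObj F a)) :=
              comma_heq (comma_ext (Category.assoc _ _ _)) (comma_ext (Category.assoc _ _ _))
                (heq_of_eq ((tapp_fst _ _).trans (tapp_fst ξ (onObj F a)).symm))
            exact key
      map₂_whisker_right := fun {E _ _ F F'} ξ G => eqToHom_conj _ _ <|
        modification_heq (map_comp _ _) (map_comp _ _) fun i => vNatTrans_heq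
          (functor_comp _ _ _) (functor_comp _ _ _) fun (a : E.gr.Comma i.as) => by
            have h : (tapp ξ a ≫ (functor G i.as).map (onObj F a) (onObj F' a)) ≫
                (onObj G (onObj F a)).fst (onObj G (onObj F' a)) =
                ξ.nt.app a.e ≫ (GradedCat.Hom.fn G).map _ _ := by
              rw [Category.assoc, functor_fst, reassoc_of% (tapp_fst ξ a)]
            have key : HEq (tapp (GradedCat.Hom₂.whiskerR ξ G) a)
                (tapp ξ a ≫ (functor G i.as).map (onObj F a) (onObj F' a)) :=
              comma_heq (comma_ext (Category.assoc _ _ _)) (comma_ext (Category.assoc _ _ _))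
                (heq_of_eq ((tapp_fst _ _).trans h.symm))
            exact key
      map₂_left_unitor := fun {E E'} F => eqToHom_conj' _ <|
        modification_heq ((map_comp _ _).trans (congrArg (· ≫ map F) (map_id E))) rfl
          fun i => vNatTrans_heq
            ((functor_comp _ _ _).trans
              (congrArg (vcomp · (functor F i.as)) (functor_id E i.as)))
            rfl fun (a : E.gr.Comma i.as) => by
              have key : HEq (tapp (GradedCat.leftUnitor F).hom a) (eId V (onObj F a)) :=
                comma_heq (comma_ext (congrArg (· ≫ a.u) (Category.comp_id _))) rfl
                  (heq_of_eq ((tapp_fst _ _).trans (Comma.id_fst (onObj F a)).symm))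
              exact key
      map₂_right_unitor := fun {E E'} F => eqToHom_conj' _ <|
        modification_heq ((map_comp _ _).trans (congrArg (map F ≫ ·) (map_id E'))) rfl
          fun i => vNatTrans_heq
            ((functor_comp _ _ _).trans
              (congrArg (vcomp (functor F i.as) ·) (functor_id E' i.as)))
            rfl fun (a : E.gr.Comma i.as) => by
              have key : HEq (tapp (GradedCat.rightUnitor F).hom a) (eId V (onObj F a)) :=
                comma_heq (comma_ext (congrArg (· ≫ a.u) (Category.id_comp _))) rfl
                  (heq_of_eq ((tapp_fst _ _).trans (Comma.id_fst (onObj F a)).symm))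
              exact key
      map₂_associator := fun {E _ _ _} F G H => eqToHom_conj _ _ <|
        modification_heq ((map_comp _ _).trans (congrArg (· ≫ map H) (map_comp F G)))
          ((map_comp _ _).trans (congrArg (map F ≫ ·) (map_comp G H)))
          fun i => vNatTrans_heq
            ((functor_comp _ _ _).trans
              (congrArg (vcomp · (functor H i.as)) (functor_comp F G i.as)))
            ((functor_comp _ _ _).trans
              (congrArg (vcomp (functor F i.as) ·) (functor_comp G H i.as)))
            fun (a : E.gr.Comma i.as) => by
              have key : HEq (tapp (GradedCat.associator F G H).hom a)
                  (eId V (onObj H (onObj G (onObj F a)))) :=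
                comma_heq (onObj_comp₃ F G H a) (onObj_comp₃' F G H a)
                  (heq_of_eq ((tapp_fst _ _).trans
                    (Comma.id_fst (onObj H (onObj G (onObj F a)))).symm))
              exact key }

end Smash

end Strictness

end EnrichedGr

end

open scoped CategoryTheory.Oplax.LaxTrans CategoryTheory.Oplax.LaxTrans.OplaxFunctor

/-!
# The Grothendieck construction is left 2-adjoint to the smash product

A `V`-functor out of `Gr(X)` is determined by what it does on the summands
`X(j)(X(u)(x), y)` of the objects of morphisms, and every summand is generated by two kinds of
morphisms: those coming from the inclusions `X(i) ⟶ Gr(X)` (`Gr.inclFunctor`) and the morphisms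
`(x, i) ⟶ (X(u)(x), j)` given by identities (`Gr.cocart`). Indeed the summand of `u` is the object
of morphisms of `X(j)` precomposed with `Gr.cocart u x` (`Gr.incl_ePre_cocart`). The morphisms
`Gr.cocart u x` are `V`-natural in `x` and compatible with `η` and `θ`
(`Gr.cocart_naturality`, `Gr.cocart_id`, `Gr.cocart_comp`), so that a `V`-functor `F` on `Gr(X)`
restricts to something of the shape of a left transformation out of `X`.

The degrees enter as follows. A family `φ₂(x, i) : p(F(x, i)) ⟶ i` makes each `(F(x, i), φ₂(x, i))`
an object of `μ ↓ i`, and `F` is compatible with the gradings along `φ₂` exactly when its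
restriction to the summand of `u` factors through the pullback defining `μ ↓ j`
(`Adj.homog_inj_iff`). Thus left morphisms `Gr(X) ⟶ (E, μ)` are the same as left transformations
`X ⟶ Γ(μ)`: in one direction, `Adj.toTrans` restricts `F` along the inclusions and `Gr.cocart`; in
the other, `Adj.fromTrans` applies `Gr` and projects `Gr(Γ(μ))` to `E` (`Adj.counit`).

Since the objects of morphisms of `μ ↓ i` are subobjects of those of `E`, every identity between
2-cells with values in `Γ(μ)` can be verified in `E`. Equalities of 1-cells are equalities of
structures containing objects and morphisms between these, whence the heterogeneous equalities
in `Adj.trans_ext` and `Adj.transHom_heq`.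
-/

noncomputable section

namespace EnrichedGr

/-! ### The cone of an oplax functor over its Grothendieck construction -/

namespace Gr

open Opl

section

variable {V : Type u} [Category.{v} V] [MonoidalCategory V] [CoproductMonoidal V]
  {I : Type v} [SmallCategory I] {X Y : OplaxFunctor (LocallyDiscrete I) (VCat V)}

/-- The action of the inclusion `X(i) ⟶ Gr(X)` on morphisms: precomposition with the component
of `η`, followed by the inclusion of the summand of `1_i`. -/
def incl {i : I} (x y : ob X i) :
    (x ⟶[V] y) ⟶ ((⟨i, x⟩ : Obj X) ⟶[V] ⟨i, y⟩) :=
  ePre (η X i x) y ≫ inj ⟨i, x⟩ ⟨i, y⟩ (𝟙 i)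

lemma comp_incl {i : I} {x y : ob X i} (s : 𝟙_ V ⟶ (x ⟶[V] y)) : s ≫ incl x y = lift s := by
  rw [incl, ← Category.assoc, comp_ePre, lift]

/-- Composing the summand of `u` with a morphism in the image of `X(j)` is composition in `X(j)`:
the structure cells `θ` and `η` cancel. -/
lemma inj_incl_comp (a : Obj X) {j : I} (y y' : ob X j) (u : a.i ⟶ j) :
    (inj a ⟨j, y⟩ u ⊗ₘ incl y y') ≫ eComp V a ⟨j, y⟩ ⟨j, y'⟩ =
      eComp V ((fn X u).obj a.x) y y' ≫ inj a ⟨j, y'⟩ u := by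
  have h1 := category_comp a ⟨j, y⟩ ⟨j, y'⟩ u (𝟙 j)
  have h2 := ePost_eComp (V := V) (x := (fn X (𝟙 j)).obj ((fn X u).obj a.x)) (t := y') (η X j y)
  have h3 := η_naturality (X := X) ((fn X u).obj a.x) y
  have h4 := eComp_ePre (V := V) (z := y) (t := y') (η X j ((fn X u).obj a.x))
  have h5 : ePre (η X j ((fn X u).obj a.x)) y' ≫ ePre (θ X u (𝟙 j) a.x) y' =
      ePre (idx X (Category.comp_id u) a.x) y' := by
    rw [← ePre_eMul, θ_id_right]
  have h6 : (inj a ⟨j, y⟩ u ⊗ₘ incl y y') =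
      _ ◁ ePre (η X j y) y' ≫ (inj a ⟨j, y⟩ u ⊗ₘ inj ⟨j, y⟩ ⟨j, y'⟩ (𝟙 j)) := by
    rw [← id_tensorHom, tensorHom_comp_tensorHom, Category.id_comp, incl]
  rw [h6, Category.assoc, h1, mul]
  simp only [Category.assoc]
  rw [whisker_exchange_assoc, ← reassoc_of% h2, ← comp_whiskerRight_assoc, h3,
    ← reassoc_of% h4, reassoc_of% h5]
  exact congrArg (_ ≫ ·) (idx_inj a ⟨j, y'⟩ (Category.comp_id u))

variable (X) in
/-- The inclusion `X(i) ⟶ Gr(X)`, as a `V`-functor. -/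
abbrev inclFunctor (i : I) : EnrichedFunctor V (ob X i) (Obj X) where
  obj x := ⟨i, x⟩
  map x y := incl x y
  map_id x := by rw [comp_incl, lift_id]
  map_comp x y z := by
    have h1 := inj_incl_comp (X := X) ⟨i, x⟩ y z (𝟙 i)
    have h2 := eComp_ePre (V := V) (z := y) (t := z) (η X i x)
    have h3 : (incl x y ⊗ₘ incl y z) =
        ePre (η X i x) y ▷ _ ≫ (inj ⟨i, x⟩ ⟨i, y⟩ (𝟙 i) ⊗ₘ incl y z) := by
      rw [← tensorHom_id, tensorHom_comp_tensorHom, Category.id_comp]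
      rfl
    rw [h3, Category.assoc, h1, ← reassoc_of% h2, incl]

/-- The morphism `(x, i) ⟶ (X(u)(x), j)` of the underlying category of `Gr(X)` given by the
identity of `X(u)(x)` in the summand of `u : i ⟶ j`. -/
def cocart {i j : I} (u : i ⟶ j) (x : ob X i) :
    𝟙_ V ⟶ ((⟨i, x⟩ : Obj X) ⟶[V] ⟨j, (fn X u).obj x⟩) :=
  eId V ((fn X u).obj x) ≫ inj ⟨i, x⟩ ⟨j, (fn X u).obj x⟩ u

/-- Composing `cocart u x` with a morphism of `X(j)` puts the latter into the summand of `u`. -/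
lemma cocart_ePost_lift {i j : I} (u : i ⟶ j) (x : ob X i) {y : ob X j}
    (s : 𝟙_ V ⟶ ((fn X u).obj x ⟶[V] y)) :
    eMul (cocart u x) (lift s) = s ≫ inj ⟨i, x⟩ ⟨j, y⟩ u := by
  have h := inj_ePost_lift (a := ⟨i, x⟩) u s
  rw [← comp_ePost, cocart, Category.assoc, h, ← Category.assoc, comp_ePost, id_eMul]

/-- Every summand is obtained from the image of `X(j)` by precomposition with `cocart u x`. In this
sense these morphisms are cocartesian. -/
lemma incl_ePre_cocart {i j : I} (u : i ⟶ j) (x : ob X i) (y : ob X j) :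
    incl ((fn X u).obj x) y ≫ ePre (cocart u x) ⟨j, y⟩ = inj ⟨i, x⟩ ⟨j, y⟩ u := by
  have h := inj_incl_comp (X := X) ⟨i, x⟩ ((fn X u).obj x) y u
  rw [ePre, leftUnitor_inv_naturality_assoc, ← tensorHom_def'_assoc, cocart]
  have h2 : (eId V ((fn X u).obj x) ≫ inj ⟨i, x⟩ ⟨j, (fn X u).obj x⟩ u) ⊗ₘ
        incl ((fn X u).obj x) y =
      eId V ((fn X u).obj x) ▷ _ ≫ (inj ⟨i, x⟩ ⟨j, (fn X u).obj x⟩ u ⊗ₘ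
        incl ((fn X u).obj x) y) := by
    rw [← tensorHom_id, tensorHom_comp_tensorHom, Category.id_comp]
  rw [h2, Category.assoc, h, e_id_comp_assoc]

lemma cocart_naturality {i j : I} (u : i ⟶ j) (x y : ob X i) :
    incl x y ≫ ePost _ (cocart u y) =
      (fn X u).map x y ≫ incl _ _ ≫ ePre (cocart u x) _ := by
  have h1 := inj_ePost (a := ⟨i, x⟩) (b := ⟨i, y⟩) (c := ⟨j, (fn X u).obj y⟩) (𝟙 i) u
    (eId V ((fn X u).obj y))
  have h2 := map_ePre (fn X u) (η X i x) y
  have h3 : ePre (η X i x ≫ (fn X u).map _ _) ((fn X u).obj y) ≫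
      ePre (θ X (𝟙 i) u x) ((fn X u).obj y) =
        ePre (idx X (Category.id_comp u) x) ((fn X u).obj y) := by
    rw [← ePre_eMul, θ_id_left]
  have h4 := idx_inj ⟨i, x⟩ ⟨j, (fn X u).obj y⟩ (Category.id_comp u)
  rw [incl_ePre_cocart, incl, Category.assoc]
  refine (congrArg (_ ≫ ·) h1).trans ?_
  rw [ePost_id, Category.id_comp, reassoc_of% h2, reassoc_of% h3]
  exact congrArg (_ ≫ ·) h4

lemma cocart_id {i : I} (x : ob X i) :
    eMul (cocart (𝟙 i) x) (η X i x ≫ incl _ _) = eId V (⟨i, x⟩ : Obj X) := by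
  rw [comp_incl, cocart_ePost_lift, category_id]

lemma cocart_comp {i j k : I} (u : i ⟶ j) (v : j ⟶ k) (x : ob X i) :
    eMul (cocart (u ≫ v) x) (θ X u v x ≫ incl _ _) =
      eMul (cocart u x) (cocart v ((fn X u).obj x)) := by
  have h1 := inj_ePost (a := ⟨i, x⟩) (b := ⟨j, (fn X u).obj x⟩)
    (c := ⟨k, (fn X v).obj ((fn X u).obj x)⟩) u v (eId V ((fn X v).obj ((fn X u).obj x)))
  have h2 := (fn X v).map_id ((fn X u).obj x)
  rw [comp_incl, cocart_ePost_lift, ← comp_ePost, cocart, cocart, Category.assoc]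
  refine Eq.symm ((congrArg (_ ≫ ·) h1).trans ?_)
  rw [ePost_id, Category.id_comp, reassoc_of% h2, ← Category.assoc, comp_ePre, eMul_id]

/-! ### Compatibility of the cone with transformations -/

variable (F : Oplax.LaxTrans X Y)

lemma incl_onHom {i : I} (x y : ob X i) :
    incl x y ≫ onHom F ⟨i, x⟩ ⟨i, y⟩ = (tfn F i).map x y ≫ incl _ _ := by
  have h1 := map_ePre (tfn F i) (η X i x) y
  have h2 : ePre (η X i x ≫ (tfn F i).map _ _) ((tfn F i).obj y) ≫
      ePre (φ F (𝟙 i) x) ((tfn F i).obj y) = ePre (η Y i ((tfn F i).obj x)) _ := by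
    rw [← ePre_eMul, φ_id]
  have h3 : ePre (η X i x) y ≫ onComp F ⟨i, x⟩ ⟨i, y⟩ (𝟙 i) =
      (tfn F i).map x y ≫ ePre (η Y i ((tfn F i).obj x)) _ := by
    rw [onComp, reassoc_of% h1, h2]
  rw [incl, Category.assoc, inj_onHom, reassoc_of% h3]
  rfl

lemma cocart_onHom {i j : I} (u : i ⟶ j) (x : ob X i) :
    cocart u x ≫ onHom F _ _ =
      eMul (cocart u ((tfn F i).obj x)) (φ F u x ≫ incl _ _) := by
  have h := (tfn F j).map_id ((fn X u).obj x)
  have h1 : eId V ((fn X u).obj x) ≫ onComp F ⟨i, x⟩ ⟨j, (fn X u).obj x⟩ u = φ F u x := by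
    rw [onComp, ← Category.assoc, h, comp_ePre, eMul_id]
  rw [comp_incl, cocart_ePost_lift, cocart, Category.assoc, inj_onHom, reassoc_of% h1]

end

end Gr

/-! ### From left morphisms on the Grothendieck construction to left transformations -/

namespace Adj

open Opl Grading

variable {V : Type u} [Category.{v} V] [MonoidalCategory V] [SymmetricCategory V]
  [CoproductMonoidal V] {I : Type v} [SmallCategory I]
  {X X' : OplaxFunctor (LocallyDiscrete I) (VCat V)} {E E' : GradedCat V I}

/-- The `V`-functor on `Gr(X)` underlying a left morphism. -/
abbrev gfn (F : Gr.gr X ⟶ E) : EnrichedFunctor V (Gr.Obj X) E.cat := GradedCat.Hom.fn F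

/-- The morphism `φ₂(x, i) : p(F(x, i)) ⟶ i` of a left morphism `F` on `Gr(X)`. -/
abbrev gdeg (F : Gr.gr X ⟶ E) (a : Gr.Obj X) : (E.gr.p ((gfn F).obj a)).as ⟶ a.i :=
  GradedCat.Hom.deg F a

/-- The `V`-natural transformation underlying a 2-morphism. -/
abbrev gnt {F G : Gr.gr X ⟶ E} (ξ : F ⟶ G) : VNatTrans (gfn F) (gfn G) := GradedCat.Hom₂.nt ξ

/-- A `V`-functor `P` on `Gr(X)` is compatible with the gradings along given morphisms
`d(x, i) : p(P(x, i)) ⟶ i` if and only if its restriction to the summand of each `u` is homogeneous,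
that is, factors through the comma category of the target of `u`. -/
lemma homog_inj_iff (P : EnrichedFunctor V (Gr.Obj X) E.cat)
    (d : ∀ a : Gr.Obj X, (E.gr.p (P.obj a)).as ⟶ a.i) (a b : Gr.Obj X) :
    P.map a b ≫ E.gr.coact _ _ ≫ _ ◁ ePost _ (fel (j := Gr.p b) (d b)) =
        Gr.coact a b ≫ (P.map a b ⊗ₘ ePre (fel (j := Gr.p a) (d a)) (Gr.p b)) ↔
      ∀ u : a.i ⟶ b.i, Comma.Homog (⟨P.obj a, d a ≫ u⟩ : E.gr.Comma b.i) ⟨P.obj b, d b⟩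
        (Gr.inj a b u ≫ P.map a b) := by
  have key (u : a.i ⟶ b.i) :
      Gr.inj a b u ≫ Gr.coact a b ≫ (P.map a b ⊗ₘ ePre (fel (j := Gr.p a) (d a)) (Gr.p b)) =
        (Gr.inj a b u ≫ P.map a b) ≫ (ρ_ _).inv ≫
          _ ◁ fel (i := E.gr.p (P.obj a)) (j := Gr.p b) (d a ≫ u) := by
    have h := eMul_fel (V := V) (i := E.gr.p (P.obj a)) (j := Gr.p a) (k := Gr.p b) (d a) u
    rw [← Category.assoc, Gr.inj_coact, Category.assoc, tensorHom_comp_tensorHom, comp_ePre,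
      MonoidalCategory.tensorHom_def, ← rightUnitor_inv_naturality_assoc, h]
  refine ⟨fun h u => ?_, fun h => Gr.category_hom_ext fun u => ?_⟩
  · exact (Category.assoc _ _ _).trans ((congrArg (_ ≫ ·) h).trans (key u))
  · exact (Category.assoc _ _ _).symm.trans ((h u).trans (key u).symm)

section

variable (F : Gr.gr X ⟶ E)

lemma homog_inj (a b : Gr.Obj X) (u : a.i ⟶ b.i) :
    Comma.Homog (⟨(gfn F).obj a, gdeg F a ≫ u⟩ : E.gr.Comma b.i) ⟨(gfn F).obj b, gdeg F b⟩
      (Gr.inj a b u ≫ (gfn F).map a b) :=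
  (homog_inj_iff (gfn F) (gdeg F) a b).1 (GradedCat.Hom.nat F a b) u

lemma homog_incl {i : I} (x y : ob X i) :
    Comma.Homog (⟨(gfn F).obj ⟨i, x⟩, gdeg F ⟨i, x⟩⟩ : E.gr.Comma i)
      ⟨(gfn F).obj ⟨i, y⟩, gdeg F ⟨i, y⟩⟩ (Gr.incl x y ≫ (gfn F).map ⟨i, x⟩ ⟨i, y⟩) := by
  have h := homog_inj F ⟨i, x⟩ ⟨i, y⟩ (𝟙 i)
  rw [Category.comp_id] at h
  rw [Gr.incl, Category.assoc]
  exact h.precomp _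

lemma homog_cocart {i j : I} (u : i ⟶ j) (x : ob X i) :
    Comma.Homog (⟨(gfn F).obj ⟨i, x⟩, gdeg F ⟨i, x⟩ ≫ u⟩ : E.gr.Comma j)
      ⟨(gfn F).obj ⟨j, (fn X u).obj x⟩, gdeg F ⟨j, (fn X u).obj x⟩⟩
      (Gr.cocart u x ≫ (gfn F).map ⟨i, x⟩ ⟨j, (fn X u).obj x⟩) := by
  rw [Gr.cocart, Category.assoc]
  exact (homog_inj F ⟨i, x⟩ ⟨j, (fn X u).obj x⟩ u).precomp _

end

lemma homog_gnt {F G : Gr.gr X ⟶ E} (ξ : F ⟶ G) (a : Gr.Obj X) :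
    Comma.Homog (⟨(gfn F).obj a, gdeg F a⟩ : E.gr.Comma a.i) ⟨(gfn G).obj a, gdeg G a⟩
      ((gnt ξ).app a) :=
  (GradedCat.Hom₂.comm' ξ a).trans (etens_eq _ _)

variable [HasFiniteLimits V]

/-- The object `(F(x, i), φ₂(x, i))` of `μ ↓ i`. -/
abbrev tobj (F : Gr.gr X ⟶ E) {i : I} (x : ob X i) : E.gr.Comma i :=
  ⟨(gfn F).obj ⟨i, x⟩, gdeg F ⟨i, x⟩⟩

/-- The `V`-functor `X(i) ⟶ μ ↓ i` induced by a left morphism `F` on `Gr(X)`. -/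
abbrev tfunctor (F : Gr.gr X ⟶ E) (i : I) : EnrichedFunctor V (ob X i) (E.gr.Comma i) where
  obj x := tobj F x
  map x y := Comma.lift (tobj F x) (tobj F y) _ (homog_incl F x y)
  map_id x := Comma.hom_ext (by
    have h1 := (Gr.inclFunctor X i).map_id x
    have h2 := (gfn F).map_id ⟨i, x⟩
    rw [Category.assoc, Comma.lift_fst, Comma.id_fst, reassoc_of% h1, h2])
  map_comp x y z := Comma.hom_ext (by
    have h1 := (Gr.inclFunctor X i).map_comp x y z
    have h2 := (gfn F).map_comp ⟨i, x⟩ ⟨i, y⟩ ⟨i, z⟩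
    have h3 : eComp V (tobj F x) (tobj F y) (tobj F z) ≫ (tobj F x).fst (tobj F z) =
        ((tobj F x).fst (tobj F y) ⊗ₘ (tobj F y).fst (tobj F z)) ≫ eComp V _ _ _ :=
      (tobj F x).mul_fst (tobj F y) (tobj F z)
    rw [Category.assoc, Comma.lift_fst, Category.assoc, h3, tensorHom_comp_tensorHom_assoc,
      Comma.lift_fst, Comma.lift_fst, reassoc_of% h1, h2, tensorHom_comp_tensorHom_assoc])

lemma tfunctor_fst (F : Gr.gr X ⟶ E) {i : I} (x y : ob X i) :
    (tfunctor F i).map x y ≫ (tobj F x).fst (tobj F y) =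
      Gr.incl x y ≫ (gfn F).map ⟨i, x⟩ ⟨i, y⟩ :=
  Comma.lift_fst _ _ _ (homog_incl F x y)

/-- The image under `F` of the morphism `(x, i) ⟶ (X(u)(x), j)`, as a morphism of `μ ↓ j`. -/
def tcell (F : Gr.gr X ⟶ E) {i j : I} (u : i ⟶ j) (x : ob X i) :
    𝟙_ V ⟶ ((tobj F x).push u ⟶[V] tobj F ((fn X u).obj x)) :=
  Comma.lift ((tobj F x).push u) (tobj F ((fn X u).obj x)) _ (homog_cocart F u x)

lemma tcell_fst (F : Gr.gr X ⟶ E) {i j : I} (u : i ⟶ j) (x : ob X i) :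
    tcell F u x ≫ ((tobj F x).push u).fst (tobj F ((fn X u).obj x)) =
      Gr.cocart u x ≫ (gfn F).map ⟨i, x⟩ ⟨j, (fn X u).obj x⟩ :=
  Comma.lift_fst _ _ _ (homog_cocart F u x)

/-- The `V`-natural transformation of the components `tcell F u`. -/
def tnat (F : Gr.gr X ⟶ E) {i j : I} (u : i ⟶ j) :
    VNatTrans (vcomp (tfunctor F i) (shift u)) (vcomp (fn X u) (tfunctor F j)) where
  app x := tcell F u x
  naturality x y := Comma.hom_ext (by
    have h1 := congrArg (· ≫ (gfn F).map _ _) (Gr.cocart_naturality u x y)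
    have h2 := map_ePost (gfn F) ⟨i, x⟩ (Gr.cocart u y)
    have h3 := map_ePre (gfn F) (Gr.cocart u x) ⟨j, (fn X u).obj y⟩
    simp only [Category.assoc] at h1
    rw [h2, h3] at h1
    have h4 := shift_fst u (tobj F x) (tobj F y)
    have h5 := Comma.ePost_fst ((tobj F x).push u) (tcell F u y)
    have h6 := Comma.ePre_fst (tcell F u x) (tobj F ((fn X u).obj y))
    have key : (((tfunctor F i).map x y ≫ (shift u).map (tobj F x) (tobj F y)) ≫
          ePost _ (tcell F u y)) ≫ ((tobj F x).push u).fst (tobj F ((fn X u).obj y)) =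
        (((fn X u).map x y ≫ (tfunctor F j).map _ _) ≫ ePre (tcell F u x) _) ≫
          ((tobj F x).push u).fst (tobj F ((fn X u).obj y)) := by
      rw [Category.assoc, h5, Category.assoc, reassoc_of% h4, reassoc_of% (tfunctor_fst F x y),
        tcell_fst, h1, Category.assoc, h6, tcell_fst, Category.assoc,
        reassoc_of% (tfunctor_fst F ((fn X u).obj x) ((fn X u).obj y))]
    exact key)

/-- The left transformation `X ⟶ Γ(μ)` corresponding to a left morphism `Gr(X) ⟶ (E, μ)`. -/
def toTrans (F : Gr.gr X ⟶ E) : X ⟶ Smash.obj E where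
  app i := tfunctor F i.as
  naturality u := tnat F u.as
  naturality_naturality {i j u u'} σ := hom_ext fun (x : ob X i.as) => by
    obtain rfl := LocallyDiscrete.eq_of_hom σ
    have h1 := app_map₂ X (i := i.as) (j := j.as) (u := u.as) rfl σ x
    have h2 := (tfunctor F j.as).map_id ((fn X u.as).obj x)
    have key : eMul (tcell F u.as x) (idx X (u := u.as) rfl x ≫
          (tfunctor F j.as).map ((fn X u.as).obj x) ((fn X u.as).obj x)) =
        eMul (can rfl) (tcell F u.as x) := by
      rw [idx_rfl, h2, eMul_id]
      exact (((congrArg (eMul · (tcell F u.as x)) (can_rfl ((tobj F x).push u.as))).trans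
        (id_eMul _))).symm
    exact (congrArg (fun t => eMul (tcell F u.as x) (t ≫ (tfunctor F j.as).map _ _)) h1).trans key
  naturality_id i := hom_ext fun (x : ob X i.as) => by
    have key : eMul (tcell F (𝟙 i.as) x) (η X i.as x ≫ (tfunctor F i.as).map _ _) =
        eMul (can (Category.comp_id (gdeg F ⟨i.as, x⟩))) (eMul (eId V _) (eId V _)) := by
      have h1 := congrArg (· ≫ (gfn F).map _ _) (Gr.cocart_id (X := X) x)
      simp only [map_eMul, Category.assoc] at h1
      rw [(gfn F).map_id] at h1
      rw [eMul_id, eMul_id]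
      refine Comma.hom_ext ?_
      rw [Comma.eMul_fst, tcell_fst, Category.assoc, tfunctor_fst, can_fst, h1]
    exact key
  naturality_comp {i j k} u v := hom_ext fun (x : ob X i.as) => by
    have key : eMul (tcell F (u.as ≫ v.as) x) (θ X u.as v.as x ≫ (tfunctor F k.as).map _ _) =
        eMul (can (Category.assoc (gdeg F ⟨i.as, x⟩) u.as v.as).symm) (eMul (eId V _)
          (eMul (tcell F u.as x ≫ (shift v.as).map _ _) (eMul (eId V _)
            (eMul (tcell F v.as ((fn X u.as).obj x)) (eId V _))))) := by
      have h1 := congrArg (· ≫ (gfn F).map _ _) (Gr.cocart_comp (X := X) u.as v.as x)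
      simp only [map_eMul, Category.assoc] at h1
      have h2 : (tcell F u.as x ≫ (shift v.as).map _ _) ≫
            (((tobj F x).push u.as).push v.as).fst ((tobj F ((fn X u.as).obj x)).push v.as) =
          Gr.cocart u.as x ≫ (gfn F).map _ _ := by
        rw [Category.assoc, shift_fst, tcell_fst]
      rw [eMul_id, id_eMul, id_eMul]
      refine Comma.hom_ext ?_
      rw [Comma.eMul_fst, Comma.eMul_fst, Comma.eMul_fst, tcell_fst, Category.assoc, tfunctor_fst,
        can_fst, id_eMul (C := E.cat), h2, tcell_fst, h1]
    exact key

/-- The component of a 2-morphism at `(x, i)`, as a morphism of `μ ↓ i`. -/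
def tmod {F G : Gr.gr X ⟶ E} (ξ : F ⟶ G) {i : I} (x : ob X i) :
    𝟙_ V ⟶ (tobj F x ⟶[V] tobj G x) :=
  Comma.lift (tobj F x) (tobj G x) _ (homog_gnt ξ ⟨i, x⟩)

lemma tmod_fst {F G : Gr.gr X ⟶ E} (ξ : F ⟶ G) {i : I} (x : ob X i) :
    tmod ξ x ≫ (tobj F x).fst (tobj G x) = (gnt ξ).app ⟨i, x⟩ :=
  Comma.lift_fst _ _ _ (homog_gnt ξ ⟨i, x⟩)

/-- The modification corresponding to a 2-morphism between left morphisms on `Gr(X)`. -/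
def toMod {F G : Gr.gr X ⟶ E} (ξ : F ⟶ G) : toTrans F ⟶ toTrans G where
  as :=
    { app i :=
        { app := fun (x : ob X i.as) => tmod ξ x
          naturality := fun (x y : ob X i.as) => Comma.hom_ext (by
            have h := (gnt ξ).naturality ⟨i.as, x⟩ ⟨i.as, y⟩
            have key : ((tfunctor F i.as).map x y ≫ ePost _ (tmod ξ y)) ≫
                  (tobj F x).fst (tobj G y) =
                ((tfunctor G i.as).map x y ≫ ePre (tmod ξ x) _) ≫
                  (tobj F x).fst (tobj G y) := by
              rw [Category.assoc, Comma.ePost_fst, reassoc_of% (tfunctor_fst F x y), tmod_fst,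
                Category.assoc, Comma.ePre_fst, reassoc_of% (tfunctor_fst G x y), tmod_fst, h]
            exact key) }
      naturality {i j} u := hom_ext fun (x : ob X i.as) => by
        have key : eMul (tmod ξ x ≫ (shift u.as).map (tobj F x) (tobj G x)) (tcell G u.as x) =
            eMul (tcell F u.as x) (tmod ξ ((fn X u.as).obj x)) :=
          Comma.hom_ext (by
            have h1 := shift_fst u.as (tobj F x) (tobj G x)
            have h2 := congrArg (Gr.cocart u.as x ≫ ·)
              ((gnt ξ).naturality ⟨i.as, x⟩ ⟨j.as, (fn X u.as).obj x⟩)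
            simp only [← Category.assoc, comp_ePost, comp_ePre] at h2
            rw [Comma.eMul_fst, Comma.eMul_fst, Category.assoc, h1, tmod_fst, tmod_fst,
              tcell_fst, tcell_fst, h2])
        exact key }

variable (X E) in
/-- The functor from left morphisms `Gr(X) ⟶ (E, μ)` to left transformations `X ⟶ Γ(μ)`. -/
def transpose : (Gr.gr X ⟶ E) ⥤ (X ⟶ Smash.obj E) where
  obj F := toTrans F
  map ξ := toMod ξ
  map_id F := Oplax.LaxTrans.homCategory.ext fun i => hom_ext fun (x : ob X i.as) => by
    have key : tmod (𝟙 F) x = eId V (tobj F x) :=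
      Comma.hom_ext (by rw [tmod_fst, Comma.id_fst]; rfl)
    exact key
  map_comp {F G H} ξ ζ := Oplax.LaxTrans.homCategory.ext fun i =>
    hom_ext fun (x : ob X i.as) => by
      have key : tmod (ξ ≫ ζ) x = eMul (tmod ξ x) (tmod ζ x) :=
        Comma.hom_ext (by rw [Comma.eMul_fst, tmod_fst, tmod_fst, tmod_fst]; rfl)
      exact key

/-! ### From left transformations to left morphisms on the Grothendieck construction -/

/-- The object `(e, u)` of `μ ↓ i` underlying an object `((e, u), i)` of `Gr(Γ(μ))`. -/
abbrev cobj (a : Gr.Obj (Smash.obj E)) : E.gr.Comma a.i := a.x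

/-- The action on morphisms of the `V`-functor `Gr(Γ(μ)) ⟶ E` given by `((e, u), i) ↦ e`: on each
summand it is the projection from the pullback. -/
def counitMap (a b : Gr.Obj (Smash.obj E)) : (a ⟶[V] b) ⟶ ((cobj a).e ⟶[V] (cobj b).e) :=
  Sigma.desc fun u : a.i ⟶ b.i => ((cobj a).push u).fst (cobj b)

lemma inj_counitMap (a b : Gr.Obj (Smash.obj E)) (u : a.i ⟶ b.i) :
    Gr.inj a b u ≫ counitMap a b = ((cobj a).push u).fst (cobj b) :=
  Sigma.ι_desc _ _

/-- The projections take the composition of `Gr(Γ(μ))` to that of `E`; the structure cell `θ` of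
`Γ(μ)` has identity components and hence disappears. -/
lemma mul_fst (a b c : Gr.Obj (Smash.obj E)) (u : a.i ⟶ b.i) (v : b.i ⟶ c.i) :
    Gr.mul a b c u v ≫ ((cobj a).push (u ≫ v)).fst (cobj c) =
      (((cobj a).push u).fst (cobj b) ⊗ₘ ((cobj b).push v).fst (cobj c)) ≫ eComp V _ _ _ := by
  have h1 := shift_fst v ((cobj a).push u) (cobj b)
  have h2 := Comma.mul_fst (((cobj a).push u).push v) ((cobj b).push v) (cobj c)
  have h3 := Comma.ePre_fst (can (Category.assoc (cobj a).u u v).symm) (cobj c)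
  have key : ((shift v).map ((cobj a).push u) (cobj b) ▷ _ ≫
        eComp V (((cobj a).push u).push v) ((cobj b).push v) (cobj c) ≫
          ePre (can (Category.assoc (cobj a).u u v).symm) (cobj c)) ≫
            ((cobj a).push (u ≫ v)).fst (cobj c) =
      (((cobj a).push u).fst (cobj b) ⊗ₘ ((cobj b).push v).fst (cobj c)) ≫ eComp V _ _ _ := by
    rw [Category.assoc, Category.assoc, h3, can_fst, ePre_id, Category.comp_id]
    refine (congrArg (_ ≫ ·) h2).trans ?_
    rw [← tensorHom_id, tensorHom_comp_tensorHom_assoc, h1, Category.id_comp]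
  exact key

variable (E) in
/-- The `V`-functor `Gr(Γ(μ)) ⟶ E` given by `((e, u), i) ↦ e`. -/
abbrev counit : EnrichedFunctor V (Gr.Obj (Smash.obj E)) E.cat where
  obj a := (cobj a).e
  map a b := counitMap a b
  map_id a := by
    have h : can (Category.comp_id (cobj a).u) ≫ ((cobj a).push (𝟙 a.i)).fst (cobj a) =
        eId V (cobj a).e := can_fst _
    rw [Gr.category_id, Category.assoc, inj_counitMap]
    exact h
  map_comp a b c := Gr.category_tensor_ext fun u v => by
    have h := Gr.category_comp a b c u v
    rw [reassoc_of% h, inj_counitMap, mul_fst, tensorHom_comp_tensorHom_assoc, inj_counitMap,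
      inj_counitMap]
    rfl

lemma lift_counitMap {i : I} {a b : E.gr.Comma i} (s : 𝟙_ V ⟶ (a ⟶[V] b)) :
    Gr.lift (X := Smash.obj E) s ≫ counitMap ⟨i, a⟩ ⟨i, b⟩ = s ≫ a.fst b := by
  have key : eMul (can (Category.comp_id a.u)) s ≫ (a.push (𝟙 i)).fst b = s ≫ a.fst b := by
    rw [Comma.eMul_fst, can_fst, id_eMul]
  have h : (eMul (η (Smash.obj E) i a) s ≫ Gr.inj (⟨i, a⟩ : Gr.Obj (Smash.obj E)) ⟨i, b⟩ (𝟙 i)) ≫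
      counitMap (⟨i, a⟩ : Gr.Obj (Smash.obj E)) ⟨i, b⟩ = s ≫ a.fst b := by
    rw [Category.assoc, inj_counitMap]
    exact key
  exact h

lemma incl_counitMap {i : I} (a b : E.gr.Comma i) :
    Gr.incl (X := Smash.obj E) a b ≫ counitMap ⟨i, a⟩ ⟨i, b⟩ = a.fst b := by
  have h : (ePre (η (Smash.obj E) i a) b ≫ Gr.inj (⟨i, a⟩ : Gr.Obj (Smash.obj E)) ⟨i, b⟩ (𝟙 i)) ≫
      counitMap (⟨i, a⟩ : Gr.Obj (Smash.obj E)) ⟨i, b⟩ = a.fst b := by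
    rw [Category.assoc, inj_counitMap]
    refine (Comma.ePre_fst (can (Category.comp_id a.u)) b).trans ?_
    rw [can_fst, ePre_id]
    exact Category.comp_id _
  exact h

/-- The object `K(i)(x)` of `μ ↓ i`. -/
abbrev kobj (K : X ⟶ Smash.obj E) {i : I} (x : ob X i) : E.gr.Comma i := (tfn K i).obj x

/-- The `V`-functor `Gr(X) ⟶ E` corresponding to a left transformation `X ⟶ Γ(μ)`. -/
abbrev fromFn (K : X ⟶ Smash.obj E) : EnrichedFunctor V (Gr.Obj X) E.cat :=
  vcomp (Gr.functor K) (counit E)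

lemma inj_fromFn (K : X ⟶ Smash.obj E) (a b : Gr.Obj X) (u : a.i ⟶ b.i) :
    Gr.inj a b u ≫ (fromFn K).map a b =
      Gr.onComp K a b u ≫ ((kobj K a.x).push u).fst (kobj K b.x) := by
  have h : Gr.inj a b u ≫ Gr.onHom K a b ≫ counitMap _ _ =
      Gr.onComp K a b u ≫ ((kobj K a.x).push u).fst (kobj K b.x) := by
    rw [← Category.assoc, Gr.inj_onHom, Category.assoc, inj_counitMap]
  exact h

/-- The left morphism `Gr(X) ⟶ (E, μ)` corresponding to a left transformation `X ⟶ Γ(μ)`. -/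
def fromTrans (K : X ⟶ Smash.obj E) : Gr.gr X ⟶ E :=
  GradedCat.Hom.mk' (E := Gr.gr X) (fromFn K) (fun a : Gr.Obj X => (kobj K a.x).u)
    fun (a b : Gr.Obj X) => (homog_inj_iff (fromFn K) (fun a => (kobj K a.x).u) a b).2 fun u => by
      rw [inj_fromFn]
      exact (Comma.homog_fst ((kobj K a.x).push u) (kobj K b.x)).precomp _

/-- The 2-morphism corresponding to a modification. -/
def fromMod {K L : X ⟶ Smash.obj E} (Θ : K ⟶ L) : fromTrans K ⟶ fromTrans L where
  nt := VNatTrans.whiskerR (Gr.trans Θ.as) (counit E)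
  comm := (GradedCat.comm_iff (F := fromTrans K) (G := fromTrans L) _).2
    fun (a : Gr.Obj X) => by
      have h1 : Gr.lift (mapp Θ.as a.i a.x) ≫ counitMap (Gr.onObj K a) (Gr.onObj L a) =
          mapp Θ.as a.i a.x ≫ (kobj K a.x).fst (kobj L a.x) := lift_counitMap (mapp Θ.as a.i a.x)
      have h2 := (Comma.homog_fst (kobj K a.x) (kobj L a.x)).precomp (mapp Θ.as a.i a.x)
      have key : (Gr.lift (mapp Θ.as a.i a.x) ≫ counitMap (Gr.onObj K a) (Gr.onObj L a)) ≫
          E.gr.coact _ _ ≫ _ ◁ ePost _ (fel (j := Gr.p a) (kobj L a.x).u) =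
          etens (Gr.lift (mapp Θ.as a.i a.x) ≫ counitMap (Gr.onObj K a) (Gr.onObj L a))
            (fel (j := Gr.p a) (kobj K a.x).u) := by
        rw [h1, etens_eq]
        exact h2
      exact key

lemma fromMod_app {K L : X ⟶ Smash.obj E} (Θ : K ⟶ L) (a : Gr.Obj X) :
    (gnt (fromMod Θ)).app a = mapp Θ.as a.i a.x ≫ (kobj K a.x).fst (kobj L a.x) :=
  lift_counitMap (mapp Θ.as a.i a.x)

variable (X E) in
/-- The functor from left transformations `X ⟶ Γ(μ)` to left morphisms `Gr(X) ⟶ (E, μ)`. -/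
def untranspose : (X ⟶ Smash.obj E) ⥤ (Gr.gr X ⟶ E) where
  obj K := fromTrans K
  map Θ := fromMod Θ
  map_id K := GradedCat.Hom₂.ext (hom_ext fun (a : Gr.Obj X) =>
    (fromMod_app (𝟙 K) a).trans (Comma.id_fst (kobj K a.x)))
  map_comp Θ Ξ := GradedCat.Hom₂.ext (hom_ext fun (a : Gr.Obj X) => by
    have key : (gnt (fromMod (Θ ≫ Ξ))).app a =
        eMul ((gnt (fromMod Θ)).app a) ((gnt (fromMod Ξ)).app a) := by
      rw [fromMod_app, fromMod_app, fromMod_app]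
      exact Comma.eMul_fst _ _
    exact key)

/-! ### The two constructions are mutually inverse -/

/-- Modifications between equal left transformations into `Γ(μ)` are compared on components. -/
lemma transHom_heq {K L K' L' : X ⟶ Smash.obj E} (hK : K = K') (hL : L = L') {Θ : K ⟶ L}
    {Ξ : K' ⟶ L'} (h : ∀ (i : I) (x : ob X i), HEq (mapp Θ.as i x) (mapp Ξ.as i x)) :
    HEq Θ Ξ :=
  modification_heq hK hL fun i => vNatTrans_heq (by rw [hK]) (by rw [hL]) fun x => h i.as x

/-- Two left transformations into `Γ(μ)` are equal if they agree on objects and if their actions on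
morphisms and their structure cells agree after projection to `E`. -/
lemma trans_ext {K L : X ⟶ Smash.obj E}
    (hobj : ∀ (i : I) (x : ob X i), kobj K x = kobj L x)
    (hmap : ∀ (i : I) (x y : ob X i),
      HEq ((tfn K i).map x y ≫ (kobj K x).fst (kobj K y))
        ((tfn L i).map x y ≫ (kobj L x).fst (kobj L y)))
    (hcell : ∀ (i j : I) (u : i ⟶ j) (x : ob X i),
      HEq (φ K u x ≫ ((kobj K x).push u).fst (kobj K ((fn X u).obj x)))
        (φ L u x ≫ ((kobj L x).push u).fst (kobj L ((fn X u).obj x)))) : K = L := by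
  have h (i : LocallyDiscrete I) : K.app i = L.app i :=
    enrichedFunctor_ext (hobj i.as) fun x y =>
      Smash.comma_heq (hobj i.as x) (hobj i.as y) (hmap i.as x y)
  refine laxTrans_ext h fun i j u => vNatTrans_heq (by rw [h]) (by rw [h]) fun x => ?_
  exact Smash.comma_heq (congrArg (Comma.push u.as) (hobj i.as x)) (hobj j.as _)
    (hcell i.as j.as u.as x)

lemma fromTrans_toTrans (F : Gr.gr X ⟶ E) : fromTrans (toTrans F) = F :=
  GradedCat.Hom.ext' (E := Gr.gr X) (enrichedFunctor_ext (fun _ => rfl) fun (a b : Gr.Obj X) =>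
    heq_of_eq (Gr.category_hom_ext fun u => by
      have h1 := congrArg (· ≫ (gfn F).map a b) (Gr.incl_ePre_cocart u a.x b.x)
      have h2 := map_ePre (gfn F) (Gr.cocart u a.x) b
      have h3 := Comma.ePre_fst (tcell F u a.x) (tobj F b.x)
      have key : ((tfunctor F b.i).map _ _ ≫ ePre (tcell F u a.x) (tobj F b.x)) ≫
          ((tobj F a.x).push u).fst (tobj F b.x) = Gr.inj a b u ≫ (gfn F).map a b := by
        rw [Category.assoc, h3, reassoc_of% (tfunctor_fst F ((fn X u).obj a.x) b.x), tcell_fst,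
          ← h2, ← h1, Category.assoc]
      exact (inj_fromFn (toTrans F) a b u).trans key)) HEq.rfl

lemma incl_fromFn (K : X ⟶ Smash.obj E) {i : I} (x y : ob X i) :
    Gr.incl x y ≫ (fromFn K).map ⟨i, x⟩ ⟨i, y⟩ =
      (tfn K i).map x y ≫ (kobj K x).fst (kobj K y) := by
  have h1 := Gr.incl_onHom K x y
  have h2 : Gr.incl x y ≫ Gr.onHom K _ _ ≫ counitMap _ _ =
      (tfn K i).map x y ≫ (kobj K x).fst (kobj K y) := by
    rw [← Category.assoc, h1, Category.assoc]
    exact congrArg (_ ≫ ·) (incl_counitMap (kobj K x) (kobj K y))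
  exact h2

lemma cocart_fromFn (K : X ⟶ Smash.obj E) {i j : I} (u : i ⟶ j) (x : ob X i) :
    Gr.cocart u x ≫ (fromFn K).map ⟨i, x⟩ ⟨j, (fn X u).obj x⟩ =
      φ K u x ≫ ((kobj K x).push u).fst (kobj K ((fn X u).obj x)) := by
  have h1 := inj_fromFn K ⟨i, x⟩ ⟨j, (fn X u).obj x⟩ u
  have h2 := (tfn K j).map_id ((fn X u).obj x)
  have h3 : eId V ((fn X u).obj x) ≫ Gr.onComp K ⟨i, x⟩ ⟨j, (fn X u).obj x⟩ u = φ K u x := by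
    rw [Gr.onComp, ← Category.assoc, h2, comp_ePre, eMul_id]
  rw [Gr.cocart, Category.assoc, h1]
  exact (Category.assoc _ _ _).symm.trans
    (congrArg (· ≫ ((kobj K x).push u).fst (kobj K ((fn X u).obj x))) h3)

lemma toTrans_fromTrans (K : X ⟶ Smash.obj E) : toTrans (fromTrans K) = K :=
  trans_ext (fun _ _ => rfl)
    (fun _ x y => heq_of_eq ((tfunctor_fst (fromTrans K) x y).trans (incl_fromFn K x y)))
    (fun _ _ u x => heq_of_eq ((tcell_fst (fromTrans K) u x).trans (cocart_fromFn K u x)))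

lemma transpose_comp_untranspose : transpose X E ⋙ untranspose X E = 𝟭 _ :=
  Functor.hext (fun F => fromTrans_toTrans F) fun F G ξ =>
    GradedCat.Hom₂.heq (fromTrans_toTrans F) (fromTrans_toTrans G) fun (a : Gr.Obj X) =>
      heq_of_eq ((fromMod_app (toMod ξ) a).trans (tmod_fst ξ a.x))

lemma untranspose_comp_transpose : untranspose X E ⋙ transpose X E = 𝟭 _ :=
  Functor.hext (fun K => toTrans_fromTrans K) fun K L Θ =>
    transHom_heq (toTrans_fromTrans K) (toTrans_fromTrans L) fun i x => heq_of_eq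
      (Comma.hom_ext ((tmod_fst (fromMod Θ) x).trans (fromMod_app Θ ⟨i, x⟩)))

/-! ### Strict 2-naturality -/

/-- Extensionality for functors with values in a functor category, in terms of heterogeneous
equalities of components. -/
lemma functor_functor_hext {A B C : Type*} [Category* A] [Category* B] [Category* C]
    {P Q : A ⥤ B ⥤ C} (h : ∀ a b, (P.obj a).obj b = (Q.obj a).obj b)
    (h₁ : ∀ (a : A) {b b' : B} (f : b ⟶ b'), HEq ((P.obj a).map f) ((Q.obj a).map f))
    (h₂ : ∀ {a a' : A} (f : a ⟶ a') (b : B), HEq ((P.map f).app b) ((Q.map f).app b)) :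
    P = Q := by
  have h' (a : A) : P.obj a = Q.obj a := Functor.hext (h a) fun _ _ f => h₁ a f
  refine Functor.hext h' fun a a' f => ?_
  have aux : ∀ {S T S' T' : B ⥤ C} (_ : S = S') (_ : T = T') {α : S ⟶ T} {β : S' ⟶ T'},
      (∀ b, HEq (α.app b) (β.app b)) → HEq α β := by
    rintro S T _ _ rfl rfl α β hb
    exact heq_of_eq (NatTrans.ext (funext fun b => eq_of_heq (hb b)))
  exact aux (h' a) (h' a') (h₂ f)

lemma toTrans_comp_map (F : Gr.gr X ⟶ E) (G : E ⟶ E') :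
    toTrans (F ≫ G) = toTrans F ≫ Smash.map G :=
  trans_ext (fun _ _ => rfl)
    (fun i x y => heq_of_eq (by
      have h : ((tfunctor F i).map x y ≫ (Smash.functor G i).map (tobj F x) (tobj F y)) ≫
            (Smash.onObj G (tobj F x)).fst (Smash.onObj G (tobj F y)) =
          Gr.incl x y ≫ (gfn F).map ⟨i, x⟩ ⟨i, y⟩ ≫ (GradedCat.Hom.fn G).map _ _ := by
        rw [Category.assoc, Smash.functor_fst, reassoc_of% (tfunctor_fst F x y)]
      exact (tfunctor_fst (F ≫ G) x y).trans h.symm))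
    (fun i j u x => heq_of_eq (by
      -- The composite left transformation has its structure cells interspersed with the
      -- associators of `V`-functors, whose components are identities.
      have h : eMul (eId V _) (eMul (can (Category.assoc (GradedCat.Hom.deg G _) (tobj F x).u u))
            (eMul (eId V _) (eMul (tcell F u x ≫ (Smash.functor G j).map _ _) (eId V _)))) ≫
            ((Smash.onObj G (tobj F x)).push u).fst
              (Smash.onObj G (tobj F ((fn X u).obj x))) =
          Gr.cocart u x ≫ (gfn F).map ⟨i, x⟩ ⟨j, (fn X u).obj x⟩ ≫
            (GradedCat.Hom.fn G).map _ _ := by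
        rw [id_eMul, id_eMul, eMul_id, Comma.eMul_fst, can_fst, id_eMul (C := E'.cat),
          Category.assoc, Smash.functor_fst, reassoc_of% (tcell_fst F u x)]
      exact (tcell_fst (F ≫ G) u x).trans h.symm))

/-- Unlike in `toTrans_comp_map`, the two sides are not definitionally equal on objects: the
degrees differ by composition with an identity. -/
lemma toTrans_map_comp (H : X' ⟶ X) (F : Gr.gr X ⟶ E) :
    toTrans (Gr.grMap H ≫ F) = H ≫ toTrans F :=
  have hobj (i : I) (x : ob X' i) : tobj (Gr.grMap H ≫ F) x = tobj F ((tfn H i).obj x) :=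
    Smash.comma_ext (Category.comp_id _)
  trans_ext hobj
    (fun i x y => heq_of_eq (by
      have h1 : Gr.incl x y ≫ Gr.onHom H ⟨i, x⟩ ⟨i, y⟩ ≫ (gfn F).map _ _ =
          ((tfn H i).map x y ≫ (tfunctor F i).map _ _) ≫
            (tobj F ((tfn H i).obj x)).fst (tobj F ((tfn H i).obj y)) := by
        rw [Category.assoc, tfunctor_fst, reassoc_of% (Gr.incl_onHom H x y)]
      exact (tfunctor_fst (Gr.grMap H ≫ F) x y).trans h1))
    (fun i j u x => heq_of_eq (by
      have h1 := map_eMul (gfn F) (Gr.cocart u ((tfn H i).obj x)) (φ H u x ≫ Gr.incl _ _)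
      have h2 : Gr.cocart u x ≫ Gr.onHom H ⟨i, x⟩ ⟨j, (fn X' u).obj x⟩ ≫ (gfn F).map _ _ =
          eMul (eId V _) (eMul (tcell F u ((tfn H i).obj x))
            (eMul (eId V _) (eMul (φ H u x ≫ (tfunctor F j).map _ _) (eId V _)))) ≫
            ((tobj F ((tfn H i).obj x)).push u).fst (tobj F ((tfn H j).obj ((fn X' u).obj x))) := by
        rw [id_eMul, id_eMul, eMul_id, Comma.eMul_fst, tcell_fst, Category.assoc, tfunctor_fst,
          reassoc_of% (Gr.cocart_onHom H u x), h1, Category.assoc]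
      exact (tcell_fst (Gr.grMap H ≫ F) u x).trans h2))

/-- 2-naturality in `(E, μ)`. -/
lemma transpose_naturality_right : Bicategory.postcomposing (Gr.gr X) E E' ⋙
      (Functor.whiskeringRight _ _ _).obj (transpose X E') =
    (Smash.twoFunctor V I).mapFunctor E E' ⋙
      Bicategory.postcomposing X (Smash.obj E) (Smash.obj E') ⋙
        (Functor.whiskeringLeft _ _ _).obj (transpose X E) :=
  functor_functor_hext (fun G F => toTrans_comp_map F G)
    (fun G F F' ξ => transHom_heq (toTrans_comp_map F G) (toTrans_comp_map F' G)
      fun i x => heq_of_eq (Comma.hom_ext (by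
        have h : (tmod ξ x ≫ (Smash.functor G i).map (tobj F x) (tobj F' x)) ≫
            (Smash.onObj G (tobj F x)).fst (Smash.onObj G (tobj F' x)) =
            (gnt ξ).app ⟨i, x⟩ ≫ (GradedCat.Hom.fn G).map _ _ := by
          rw [Category.assoc, Smash.functor_fst, reassoc_of% (tmod_fst ξ x)]
        exact (tmod_fst (Bicategory.whiskerRight ξ G) x).trans h.symm)))
    (fun {G G'} ζ F => transHom_heq (toTrans_comp_map F G) (toTrans_comp_map F G')
      fun i x => heq_of_eq (Comma.hom_ext
        ((tmod_fst (Bicategory.whiskerLeft F ζ) x).trans (Smash.tapp_fst ζ (tobj F x)).symm)))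

/-- 2-naturality in `X`. -/
lemma transpose_naturality_left : (Gr.twoFunctor V I).mapFunctor X' X ⋙
      Bicategory.precomposing (Gr.gr X') (Gr.gr X) E ⋙
        (Functor.whiskeringRight _ _ _).obj (transpose X' E) =
    Bicategory.precomposing X' X (Smash.obj E) ⋙
      (Functor.whiskeringLeft _ _ _).obj (transpose X E) :=
  functor_functor_hext (fun H F => toTrans_map_comp H F)
    (fun H F F' ξ => transHom_heq (toTrans_map_comp H F) (toTrans_map_comp H F')
      fun i x => Smash.comma_heq (Smash.comma_ext (Category.comp_id _))
        (Smash.comma_ext (Category.comp_id _)) (heq_of_eq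
          ((tmod_fst (Bicategory.whiskerLeft (Gr.grMap H) ξ) x).trans
            (tmod_fst ξ ((tfn H i).obj x)).symm)))
    (fun {H H'} Θ F => transHom_heq (toTrans_map_comp H F) (toTrans_map_comp H' F)
      fun i x => Smash.comma_heq (Smash.comma_ext (Category.comp_id _))
        (Smash.comma_ext (Category.comp_id _)) (heq_of_eq (by
          have h : (mapp Θ.as i x ≫ (tfunctor F i).map ((tfn H i).obj x) ((tfn H' i).obj x)) ≫
              (tobj F ((tfn H i).obj x)).fst (tobj F ((tfn H' i).obj x)) =
              Gr.lift (mapp Θ.as i x) ≫ (gfn F).map _ _ := by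
            rw [Category.assoc, tfunctor_fst, ← Category.assoc, Gr.comp_incl]
          exact (tmod_fst (Bicategory.whiskerRight (Gr.grMap₂ Θ) F) x).trans h.symm)))

end Adj
end EnrichedGr

end

theorem mainTheorem1 {V : Type u} [Category.{v} V] [MonoidalCategory V] [SymmetricCategory V]
    [EnrichedGr.CoproductMonoidal V] [HasFiniteLimits V] (I : Type v) [SmallCategory I] :
    ∃ (Φ : ∀ (X : OplaxFunctor (LocallyDiscrete I) (EnrichedGr.VCat V))
          (E : EnrichedGr.GradedCat V I),
        ((EnrichedGr.Gr.twoFunctor V I).obj X ⟶ E) ⥤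
          (X ⟶ (EnrichedGr.Smash.twoFunctor V I).obj E))
      (Ψ : ∀ (X : OplaxFunctor (LocallyDiscrete I) (EnrichedGr.VCat V))
          (E : EnrichedGr.GradedCat V I),
        (X ⟶ (EnrichedGr.Smash.twoFunctor V I).obj E) ⥤
          ((EnrichedGr.Gr.twoFunctor V I).obj X ⟶ E)),
      -- `Φ X E` is an isomorphism of categories with inverse `Ψ X E`
      (∀ X E, Φ X E ⋙ Ψ X E = 𝟭 _ ∧ Ψ X E ⋙ Φ X E = 𝟭 _) ∧
      -- `Φ X E` is strictly 2-natural in `E`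
      (∀ (X : OplaxFunctor (LocallyDiscrete I) (EnrichedGr.VCat V))
          (E E' : EnrichedGr.GradedCat V I),
        Bicategory.postcomposing ((EnrichedGr.Gr.twoFunctor V I).obj X) E E' ⋙
            (Functor.whiskeringRight _ _ _).obj (Φ X E') =
          (EnrichedGr.Smash.twoFunctor V I).mapFunctor E E' ⋙
            Bicategory.postcomposing X ((EnrichedGr.Smash.twoFunctor V I).obj E)
              ((EnrichedGr.Smash.twoFunctor V I).obj E') ⋙
            (Functor.whiskeringLeft _ _ _).obj (Φ X E)) ∧
      -- `Φ X E` is strictly 2-natural in `X`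
      (∀ (X' X : OplaxFunctor (LocallyDiscrete I) (EnrichedGr.VCat V))
          (E : EnrichedGr.GradedCat V I),
        (EnrichedGr.Gr.twoFunctor V I).mapFunctor X' X ⋙
            Bicategory.precomposing ((EnrichedGr.Gr.twoFunctor V I).obj X')
              ((EnrichedGr.Gr.twoFunctor V I).obj X) E ⋙
            (Functor.whiskeringRight _ _ _).obj (Φ X' E) =
          Bicategory.precomposing X' X ((EnrichedGr.Smash.twoFunctor V I).obj E) ⋙
            (Functor.whiskeringLeft _ _ _).obj (Φ X E)) :=
  ⟨fun X E => EnrichedGr.Adj.transpose X E, fun X E => EnrichedGr.Adj.untranspose X E,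
    fun _ _ => ⟨EnrichedGr.Adj.transpose_comp_untranspose,
      EnrichedGr.Adj.untranspose_comp_transpose⟩,
    fun _ _ _ => EnrichedGr.Adj.transpose_naturality_right,
    fun _ _ _ => EnrichedGr.Adj.transpose_naturality_left⟩
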